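/- Let $G_{\mathbb C}$ be a complex semisimple Lie group with Lie algebra $\mathfrak g_{\mathbb C}$, and let $n=\dim_{\mathbb R}\mathfrak g_{\mathbb C}$. Let $MG_{\mathbb C}$ be the group of holomorphic maps $f:\mathbb C^*\to G_{\mathbb C}$ under pointwise multiplication, with the compact-open topology. Let $\Omega^1(\mathbb C^*,\mathfrak g_{\mathbb C})$ be the space of holomorphic $\mathfrak g_{\mathbb C}$-valued $1$-forms $\omega=h(z)\,dz$ on $\mathbb C^*$, with the topology of compact convergence and the grading $\|\omega\|_k=\sup\{\|h(z)\| : e^{-k}\le |z|\le e^{k}\}$, $k\in\mathbb N_0$. Definitions. A graded Fréchet space is a Fréchet space with an increasing sequence of seminorms defining its topology (a normed space is graded by its norm, repeated; products carry the sum of the seminorms and linear subspaces the restricted ones). A linear map $\varphi$ between graded spaces is tame if for some $r,b\in\mathbb N$ and constants $C(k)$ one has $\|\varphi(x)\|_k\le C(k)\|x\|_{k+r}$ for all $x$ and all $k\ge b$. A tame Fréchet space is a graded Fréchet space $F$ for which there are a Banach space $B$ and tame linear maps $F\to\Sigma(B)\to F$ composing to the identity, where $\Sigma(B)$ is the space of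 sequences in $B$ with $\|(x_j)\|_k=\sum_j e^{kj}\|x_j\|<\infty$ for all $k$. A map $\Phi:U\subseteq F\to F'$ on an open set $U$ is tame if $\|\Phi(x)\|_k\le C(k)(1+\|x\|_{k+r})$ for all $x\in U$, $k\ge b$, for some $r,b,C(k)$; it is smooth tame if it is tame, all iterated directional derivatives $D^j\Phi:U\times F^j\to F'$ exist and are continuous, and each satisfies such tame estimates near every point of $U\times F^j$. A tame Fréchet manifold is a Hausdorff space with an atlas of homeomorphisms onto open subsets of a tame Fréchet space whose transition maps are smooth tame. A subset $M$ of a tame Fréchet space $F$ is a tame submanifold of finite codimension $n$, modelled on a tame Fréchet space $K$, if each $m\in M$ has an open neighbourhood $U\subseteq F$ with a submanifold chart, that is, a homeomorphism $\psi$ of $U$ onto an open set $V\subseteq K\times\mathbb R^n$ such that $\psi,\psi^{-1}$ are smooth tame and $\psi(M\cap U)=(K\times\{0\})\cap V$. A form $\alpha\in\Omega^1(\mathbb C^*,\mathfrak g_{\mathbb C})$ has trivial monodromy if for every $C^1$ loop $c$ in $\mathbb C^*$ based at $1$ the solution of $\gamma^{-1}d\gamma=c^*\alpha$, $\gamma(0)=1$,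 satisfies $\gamma(1)=1$; let $\mathcal M\subseteq\Omega^1(\mathbb C^*,\mathfrak g_{\mathbb C})$ be the set of these forms. Theorem. For $f\in MG_{\mathbb C}$ the logarithmic derivative $\delta(f)=f^{-1}df$ is a holomorphic $1$-form, and $$\varphi: MG_{\mathbb C}\to\Omega^1(\mathbb C^*,\mathfrak g_{\mathbb C})\times G_{\mathbb C},\qquad f\mapsto(f^{-1}df,\,f(1))$$ is a topological embedding. The image of its first component $\delta$ is $\mathcal M$, and the image of $\varphi$ is $\mathcal M\times G_{\mathbb C}$. There is a linear subspace $K\subseteq\Omega^1(\mathbb C^*,\mathfrak g_{\mathbb C})$ such that $\mathcal M$ is a tame submanifold of $\Omega^1(\mathbb C^*,\mathfrak g_{\mathbb C})$ of finite codimension $n$ modelled on $K$, and $MG_{\mathbb C}$ has an atlas making it a tame Fréchet manifold modelled on $K\times\mathfrak g_{\mathbb C}$, each chart of which has the form $f\mapsto\bigl(\mathrm{pr}_K\,\psi(\delta(f)),\,\theta(f(1))\bigr)$ on the set of all $f$ with $\delta(f)\in\operatorname{dom}\psi$ and $f(1)\in\operatorname{dom}\theta$, where $\psi$ is a submanifold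 chart for $\mathcal M$ as above and $\theta$ is a holomorphic chart of the Lie group $G_{\mathbb C}$. -/

import Mathlib

open Set Filter Topology
open scoped Manifold ContDiff

noncomputable section

/-! ## Graded Fréchet spaces and tame maps -/

/-- A grading on a real vector space: an increasing sequence of seminorms
`‖·‖₀ ≤ ‖·‖₁ ≤ ‖·‖₂ ≤ …`. -/
class Grading (F : Type*) [AddCommGroup F] [Module ℝ F] where
  seminorm : ℕ → Seminorm ℝ F
  mono : Monotone seminorm

/-- `gnorm n f` is the `n`-th seminorm `‖f‖ₙ` of the grading. -/
def gnorm {F : Type*} [AddCommGroup F] [Module ℝ F] [Grading F] (n : ℕ) (f : F) : ℝ :=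
  Grading.seminorm (F := F) n f

/-- A normed space is graded by the constant sequence consisting of its norm. -/
instance (priority := 50) Grading.ofNormed (E : Type*) [NormedAddCommGroup E] [NormedSpace ℝ E] :
    Grading E where
  seminorm _ := normSeminorm ℝ E
  mono _ _ _ := le_rfl

/-- The product grading `‖(f, g)‖ₙ = ‖f‖ₙ + ‖g‖ₙ`. -/
instance Grading.prod (F G : Type*) [AddCommGroup F] [Module ℝ F] [Grading F]
    [AddCommGroup G] [Module ℝ G] [Grading G] : Grading (F × G) where
  seminorm n := (Grading.seminorm n).comp (LinearMap.fst ℝ F G) +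
    (Grading.seminorm n).comp (LinearMap.snd ℝ F G)
  mono _ _ h x := add_le_add (Grading.mono h x.1) (Grading.mono h x.2)

/-- The grading induced on a linear subspace. -/
instance Grading.submodule {F : Type*} [AddCommGroup F] [Module ℝ F] [Grading F]
    (K : Submodule ℝ F) : Grading K where
  seminorm n := (Grading.seminorm n).comp K.subtype
  mono _ _ h x := Grading.mono h (x : F)

/-- A graded Fréchet space: the seminorms of the grading define the topology, which is Hausdorff
and (sequentially, hence, being metrizable) complete. -/
structure IsGradedFrechetSpace (F : Type*) [AddCommGroup F] [Module ℝ F] [TopologicalSpace F]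
    [Grading F] : Prop where
  withSeminorms : WithSeminorms (Grading.seminorm (F := F))
  t2 : T2Space F
  complete : ∀ u : ℕ → F,
    (∀ n : ℕ, ∀ ε > 0, ∃ N : ℕ, ∀ i ≥ N, ∀ j ≥ N, gnorm n (u i - u j) < ε) →
      ∃ l : F, Tendsto u atTop (𝓝 l)

/-- A linear map is tame if `‖φ f‖ₙ ≤ C(n) ‖f‖ₙ₊ᵣ` for all `n ≥ b`, for some `r`, `b`, `C`. -/
def IsTameLinear {F G : Type*} [AddCommGroup F] [Module ℝ F] [Grading F]
    [AddCommGroup G] [Module ℝ G] [Grading G] (φ : F →ₗ[ℝ] G) : Prop :=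
  ∃ (r b : ℕ) (C : ℕ → ℝ), ∀ n ≥ b, ∀ f : F, gnorm n (φ f) ≤ C n * gnorm (n + r) f

/-- `F` is a tame direct summand of `G`. -/
def IsTameDirectSummand (F G : Type*) [AddCommGroup F] [Module ℝ F] [Grading F]
    [AddCommGroup G] [Module ℝ G] [Grading G] : Prop :=
  ∃ (φ : F →ₗ[ℝ] G) (ψ : G →ₗ[ℝ] F), IsTameLinear φ ∧ IsTameLinear ψ ∧ ∀ f : F, ψ (φ f) = f

/-- The weighted sequence `k ↦ e^{nk} ‖fₖ‖`. -/
def expWeighted {B : Type*} [NormedAddCommGroup B] (n : ℕ) (f : ℕ → B) (k : ℕ) : ℝ :=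
  Real.exp ((n : ℝ) * k) * ‖f k‖

lemma expWeighted_nonneg {B : Type*} [NormedAddCommGroup B] (n : ℕ) (f : ℕ → B) (k : ℕ) :
    0 ≤ expWeighted n f k := by
  unfold expWeighted; positivity

lemma expWeighted_add_le {B : Type*} [NormedAddCommGroup B] (n : ℕ) (f g : ℕ → B) (k : ℕ) :
    expWeighted n (f + g) k ≤ expWeighted n f k + expWeighted n g k := by
  unfold expWeighted
  rw [← mul_add]
  exact mul_le_mul_of_nonneg_left (norm_add_le _ _) (Real.exp_pos _).le

lemma expWeighted_smul {B : Type*} [NormedAddCommGroup B] [NormedSpace ℝ B] (n : ℕ) (c : ℝ)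
    (f : ℕ → B) (k : ℕ) : expWeighted n (c • f) k = ‖c‖ * expWeighted n f k := by
  unfold expWeighted
  rw [Pi.smul_apply, norm_smul]; ring

/-- The space `Σ(B)` of exponentially decreasing sequences in a Banach space `B`. -/
def expSeqSubmodule (B : Type*) [NormedAddCommGroup B] [NormedSpace ℝ B] :
    Submodule ℝ (ℕ → B) where
  carrier := {f | ∀ n : ℕ, Summable (expWeighted n f)}
  add_mem' {f g} hf hg n := Summable.of_nonneg_of_le (expWeighted_nonneg n _)
    (expWeighted_add_le n f g) ((hf n).add (hg n))
  zero_mem' n := by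
    have : expWeighted n (0 : ℕ → B) = fun _ => 0 := by funext k; simp [expWeighted]
    rw [this]; exact summable_zero
  smul_mem' c f hf n := by
    have : expWeighted n (c • f) = fun k => ‖c‖ * expWeighted n f k := by
      funext k; exact expWeighted_smul n c f k
    rw [this]; exact (hf n).mul_left _

/-- The space `Σ(B)` of exponentially decreasing sequences in a Banach space `B`. -/
def ExpSeq (B : Type*) [NormedAddCommGroup B] [NormedSpace ℝ B] : Type _ :=
  ↥(expSeqSubmodule B)

instance (B : Type*) [NormedAddCommGroup B] [NormedSpace ℝ B] : AddCommGroup (ExpSeq B) :=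
  inferInstanceAs (AddCommGroup ↥(expSeqSubmodule B))

instance (B : Type*) [NormedAddCommGroup B] [NormedSpace ℝ B] : Module ℝ (ExpSeq B) :=
  inferInstanceAs (Module ℝ ↥(expSeqSubmodule B))

/-- The grading `‖f‖ₙ = ∑ₖ e^{nk} ‖fₖ‖` on `Σ(B)`. -/
instance (B : Type*) [NormedAddCommGroup B] [NormedSpace ℝ B] : Grading (ExpSeq B) where
  seminorm n := Seminorm.of (fun f : ↥(expSeqSubmodule B) => ∑' k, expWeighted n f.1 k)
    (fun f g => by
      rw [← (f.2 n).tsum_add (g.2 n)]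
      exact ((f + g).2 n).tsum_le_tsum (expWeighted_add_le n f.1 g.1) ((f.2 n).add (g.2 n)))
    (fun c f => by
      rw [← tsum_mul_left]
      exact tsum_congr (expWeighted_smul n c f.1))
  mono := by
    intro m n h f
    refine (f.2 m).tsum_le_tsum (fun k => ?_) (f.2 n)
    unfold expWeighted
    have : (m : ℝ) ≤ n := by exact_mod_cast h
    gcongr

/-- A tame Fréchet space: a graded Fréchet space which is a tame direct summand of `Σ(B)` for some
Banach space `B`. -/
def IsTameFrechetSpace.{u} (F : Type u) [AddCommGroup F] [Module ℝ F] [TopologicalSpace F]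
    [Grading F] : Prop :=
  IsGradedFrechetSpace F ∧
    ∃ (B : Type u) (_ : NormedAddCommGroup B) (_ : NormedSpace ℝ B) (_ : CompleteSpace B),
      IsTameDirectSummand F (ExpSeq B)

/-- A (nonlinear) map `Φ : U ⊆ F → G` is tame if `‖Φ f‖ₙ ≤ C(n) (1 + ‖f‖ₙ₊ᵣ)` for all `f ∈ U` and
`n ≥ b`, for some `r`, `b`, `C`. -/
def IsTameOn {F G : Type*} [AddCommGroup F] [Module ℝ F] [Grading F]
    [AddCommGroup G] [Module ℝ G] [Grading G] (Φ : F → G) (U : Set F) : Prop :=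
  ∃ (r b : ℕ) (C : ℕ → ℝ), ∀ n ≥ b, ∀ f ∈ U, gnorm n (Φ f) ≤ C n * (1 + gnorm (n + r) f)

/-- A map `Φ` on an open subset `U` of a graded Fréchet space is smooth tame if it is tame, all
its iterated directional derivatives `D k f (h₁, …, hₖ) = DᵏΦ(f)(h₁, …, hₖ)` exist and are jointly
continuous on `U × Fᵏ`, and each of them satisfies tame estimates near every point of `U × Fᵏ`. -/
def IsSmoothTameOn {F G : Type*} [AddCommGroup F] [Module ℝ F] [TopologicalSpace F] [Grading F]
    [AddCommGroup G] [Module ℝ G] [TopologicalSpace G] [Grading G] (Φ : F → G) (U : Set F) :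
    Prop :=
  IsTameOn Φ U ∧ ∃ D : (k : ℕ) → F → (Fin k → F) → G,
    (∀ f ∈ U, ∀ h : Fin 0 → F, D 0 f h = Φ f) ∧
    (∀ k : ℕ, ∀ f ∈ U, ∀ (h : Fin k → F) (v : F),
      Tendsto (fun t : ℝ => t⁻¹ • (D k (f + t • v) h - D k f h)) (𝓝[≠] 0)
        (𝓝 (D (k + 1) f (Fin.snoc (α := fun _ => F) h v)))) ∧
    (∀ k : ℕ, ContinuousOn (fun p : F × (Fin k → F) => D k p.1 p.2) (U ×ˢ univ)) ∧
    (∀ k : ℕ, ∀ f ∈ U, ∀ h : Fin k → F, ∃ W ∈ 𝓝 (f, h), ∃ (r b : ℕ) (C : ℕ → ℝ),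
      ∀ n ≥ b, ∀ p ∈ W, p.1 ∈ U →
        gnorm n (D k p.1 p.2) ≤ C n * (1 + gnorm (n + r) p.1 + ∑ i, gnorm (n + r) (p.2 i)))

/-! ## Tame Fréchet manifolds and submanifolds of finite type -/

/-- `A` is an atlas turning the topological space `M` into a tame Fréchet manifold modelled on the
tame Fréchet space `F`: its charts are homeomorphisms from open subsets of `M` onto open subsets of
`F`, their domains cover `M`, and all chart transition functions are smooth tame. -/
structure IsTameFrechetManifold (F : Type*) [AddCommGroup F] [Module ℝ F] [TopologicalSpace F]
    [Grading F] (M : Type*) [TopologicalSpace M] (A : Set (OpenPartialHomeomorph M F)) : Prop where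
  model : IsTameFrechetSpace F
  t2 : T2Space M
  cover : ∀ x : M, ∃ φ ∈ A, x ∈ φ.source
  transition : ∀ φ ∈ A, ∀ ψ ∈ A, IsSmoothTameOn (φ.symm.trans ψ) (φ.symm.trans ψ).source

/-- `ψ : U → V ⊆ K × ℝⁿ` is a smooth tame diffeomorphism from an open `U ⊆ F` onto an open `V`
with `ψ(M ∩ U) = (K × {0}) ∩ V`. -/
structure IsTameSubmanifoldChart {F : Type*} [AddCommGroup F] [Module ℝ F] [TopologicalSpace F]
    [Grading F] {K : Type*} [AddCommGroup K] [Module ℝ K] [TopologicalSpace K] [Grading K]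
    {n : ℕ} (M : Set F) (ψ : OpenPartialHomeomorph F (K × EuclideanSpace ℝ (Fin n))) : Prop where
  smoothTame : IsSmoothTameOn ψ ψ.source
  smoothTame_symm : IsSmoothTameOn ψ.symm ψ.target
  image_eq : ψ '' (M ∩ ψ.source) = {p | p.2 = 0} ∩ ψ.target

/-- `M ⊆ F` is a tame Fréchet submanifold of finite type, of (real) codimension `n`, modelled on
the tame Fréchet space `K`. -/
structure IsTameSubmanifold {F : Type*} [AddCommGroup F] [Module ℝ F] [TopologicalSpace F]
    [Grading F] (K : Type*) [AddCommGroup K] [Module ℝ K] [TopologicalSpace K] [Grading K]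
    (n : ℕ) (M : Set F) : Prop where
  ambient : IsTameFrechetSpace F
  model : IsTameFrechetSpace K
  chart : ∀ m ∈ M, ∃ ψ : OpenPartialHomeomorph F (K × EuclideanSpace ℝ (Fin n)),
    m ∈ ψ.source ∧ IsTameSubmanifoldChart M ψ

/-! ## Holomorphic 1-forms on `ℂ*`

The punctured plane `ℂ*` is the open Riemann surface `ℂˣ`, with coordinate `z`. -/

/-- The annulus `Aₙ = {z | e⁻ⁿ ≤ |z| ≤ eⁿ}`. -/
def annulus (n : ℕ) : Set ℂˣ :=
  {z | Real.exp (-(n : ℝ)) ≤ ‖(z : ℂ)‖ ∧ ‖(z : ℂ)‖ ≤ Real.exp n}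

lemma isCompact_annulus (n : ℕ) : IsCompact (annulus n) := by
  rw [Units.isOpenEmbedding_val.isInducing.isCompact_iff]
  have : Units.val '' annulus n =
      (fun z : ℂ => ‖z‖) ⁻¹' Icc (Real.exp (-(n : ℝ))) (Real.exp n) := by
    ext z
    constructor
    · rintro ⟨u, hu, rfl⟩
      exact hu
    · intro hz
      have hz0 : z ≠ 0 := by
        rintro rfl
        have h1 := hz.1
        simp only [norm_zero] at h1
        exact absurd (Real.exp_pos (-(n : ℝ))) (not_lt.mpr h1)
      exact ⟨Units.mk0 z hz0, hz, rfl⟩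
  rw [this]
  refine Metric.isCompact_of_isClosed_isBounded (isClosed_Icc.preimage continuous_norm) ?_
  refine (Metric.isBounded_closedBall (x := (0 : ℂ)) (r := Real.exp n)).subset ?_
  intro z hz
  simpa using hz.2

lemma annulus_nonempty (n : ℕ) : (annulus n).Nonempty :=
  ⟨1, by simp [annulus]⟩

lemma annulus_mono {m n : ℕ} (h : m ≤ n) : annulus m ⊆ annulus n := by
  have h' : (m : ℝ) ≤ n := by exact_mod_cast h
  intro z hz
  exact ⟨(Real.exp_le_exp.mpr (neg_le_neg h')).trans hz.1,
    hz.2.trans (Real.exp_le_exp.mpr h')⟩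

section Forms

variable (E : Type*) [NormedAddCommGroup E] [NormedSpace ℂ E]

/-- Holomorphic maps `ℂ* → E`. -/
def holSubmodule : Submodule ℝ (ℂˣ → E) where
  carrier := {f | MDifferentiable 𝓘(ℂ, ℂ) 𝓘(ℂ, E) f}
  add_mem' hf hg := MDifferentiable.add hf hg
  zero_mem' := mdifferentiable_const
  smul_mem' c f hf := by
    have h : MDifferentiable 𝓘(ℂ, ℂ) 𝓘(ℂ, E) ((c : ℂ) • f) := MDifferentiable.const_smul (c : ℂ) hf
    have e : (c : ℂ) • f = c • f := by
      funext z
      exact Complex.coe_smul c (f z)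
    exact e ▸ h

/-- The space `Ω¹(ℂ*, E)` of holomorphic `E`-valued 1-forms on `ℂ*`. The form `f(z) dz` is
represented by its coefficient function `f`. -/
def HolForm : Type _ := ↥(holSubmodule E)

instance : AddCommGroup (HolForm E) := inferInstanceAs (AddCommGroup ↥(holSubmodule E))

instance : Module ℝ (HolForm E) := inferInstanceAs (Module ℝ ↥(holSubmodule E))

/-- `α z` is the value at `z` of the coefficient function of the form `α`. -/
instance : CoeFun (HolForm E) (fun _ => ℂˣ → E) := ⟨fun α => α.1⟩

variable {E}

lemma HolForm.continuous (α : HolForm E) : Continuous α :=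
  MDifferentiable.continuous (I := 𝓘(ℂ, ℂ)) (I' := 𝓘(ℂ, E)) α.2

lemma HolForm.bddAbove (α : HolForm E) (n : ℕ) :
    BddAbove (range fun z : annulus n => ‖α z‖) := by
  have := ((isCompact_annulus n).image α.continuous.norm).bddAbove
  rwa [image_eq_range] at this

variable (E)

/-- `Ω¹(ℂ*, E)` carries the topology of compact convergence (the compact-open topology). -/
instance : TopologicalSpace (HolForm E) :=
  TopologicalSpace.induced (fun α => (⟨α, α.continuous⟩ : C(ℂˣ, E))) inferInstance

/-- The grading of `Ω¹(ℂ*, E)`: `‖f dz‖ₙ = sup {‖f z‖ | z ∈ Aₙ}`. -/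
instance : Grading (HolForm E) where
  seminorm n := Seminorm.of (fun α : HolForm E => ⨆ z : annulus n, ‖α z‖)
    (fun α β => by
      have : Nonempty (annulus n) := (annulus_nonempty n).to_subtype
      refine ciSup_le fun z => (norm_add_le (α z) (β z)).trans ?_
      exact add_le_add (le_ciSup (α.bddAbove n) z) (le_ciSup (β.bddAbove n) z))
    (fun c α => by
      rw [Real.mul_iSup_of_nonneg (norm_nonneg c)]
      exact congrArg iSup (funext fun z => norm_smul c (α z)))
  mono := by
    intro m n h α
    have : Nonempty (annulus m) := (annulus_nonempty m).to_subtype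
    exact ciSup_le fun z => le_ciSup (α.bddAbove n) (⟨z.1, annulus_mono h z.2⟩ : annulus n)

end Forms

/-! ## The group of holomorphic maps `ℂ* → G` -/

section LoopGroup

variable (E : Type*) [NormedAddCommGroup E] [NormedSpace ℂ E]
  (G : Type*) [TopologicalSpace G] [ChartedSpace E G] [Group G] [LieGroup 𝓘(ℂ, E) ω G]

/-- The group `MG` of holomorphic maps `ℂ* → G` under pointwise multiplication, as a subgroup of
the group of all maps. -/
def holLoopSubgroup : Subgroup (ℂˣ → G) where
  carrier := {f | MDifferentiable 𝓘(ℂ, ℂ) 𝓘(ℂ, E) f}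
  mul_mem' {f g} hf hg := by
    have hm : MDifferentiable (𝓘(ℂ, E).prod 𝓘(ℂ, E)) 𝓘(ℂ, E) (fun p : G × G => p.1 * p.2) :=
      (contMDiff_mul 𝓘(ℂ, E) ω).mdifferentiable (by simp)
    exact hm.comp (hf.prodMk hg)
  one_mem' := mdifferentiable_const
  inv_mem' {f} hf := by
    have hi : MDifferentiable 𝓘(ℂ, E) 𝓘(ℂ, E) (fun x : G => x⁻¹) :=
      (contMDiff_inv 𝓘(ℂ, E) ω).mdifferentiable (by simp)
    exact hi.comp hf

/-- The group `MG` of holomorphic maps from `ℂ*` to the complex Lie group `G`. -/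
def HolLoopGroup : Type _ := ↥(holLoopSubgroup E G)

instance : Group (HolLoopGroup E G) := inferInstanceAs (Group ↥(holLoopSubgroup E G))

instance : CoeFun (HolLoopGroup E G) (fun _ => ℂˣ → G) := ⟨fun f => f.1⟩

variable {E G}

lemma HolLoopGroup.continuous (f : HolLoopGroup E G) : Continuous f :=
  MDifferentiable.continuous (I := 𝓘(ℂ, ℂ)) (I' := 𝓘(ℂ, E)) f.2

/-- `MG` carries the compact-open topology. -/
instance : TopologicalSpace (HolLoopGroup E G) :=
  TopologicalSpace.induced (fun f => (⟨f, f.continuous⟩ : C(ℂˣ, G))) inferInstance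

/-- The coefficient at `z` of the left logarithmic derivative `f⁻¹ df` with respect to `dz`:
the image of `f'(z)` in the Lie algebra `T₁G` under left translation by `f(z)⁻¹`. The vector space
underlying the Lie algebra `T₁G` is the model space `E`. -/
def leftLogDeriv (f : HolLoopGroup E G) (z : ℂˣ) : E :=
  mfderiv 𝓘(ℂ, E) 𝓘(ℂ, E) (fun x : G => (f z)⁻¹ * x) (f z)
    (mfderiv 𝓘(ℂ, ℂ) 𝓘(ℂ, E) f z (1 : ℂ))

/-- `γ` solves the equation `γ⁻¹ dγ = c^*α` along the path `c` in `ℂ*`: the velocity `γ'(t)` is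
the left translate by `γ(t)` of `α_{c(t)}(c'(t))`. -/
def IsDevelopment (α : HolForm E) (c : ℝ → ℂˣ) (γ : ℝ → G) : Prop :=
  ∀ t : ℝ, HasMFDerivAt 𝓘(ℝ, ℝ) 𝓘(ℝ, E) γ t
    (ContinuousLinearMap.toSpanSingleton ℝ
      (mulInvariantVectorField (I := 𝓘(ℂ, E))
        (deriv (fun s : ℝ => (c s : ℂ)) t • α (c t) : E) (γ t) : E) : ℝ →L[ℝ] E)

variable (E G)

/-- The forms `α` with trivial monodromy: along every `C¹` loop in `ℂ*` based at `1`, the solution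
of `γ⁻¹ dγ = c^*α` with `γ(0) = 1` returns to `1`. -/
def trivialMonodromyLocus : Set (HolForm E) :=
  {α | ∀ c : ℝ → ℂˣ, ContDiff ℝ 1 (fun t => (c t : ℂ)) → c 0 = 1 → c 1 = 1 →
    ∃ γ : ℝ → G, IsDevelopment α c γ ∧ γ 0 = 1 ∧ γ 1 = 1}

end LoopGroup

end

/-! Everything rests on the equation γ⁻¹γ' = β for paths in `G`. In a chart centred at 1 and for
small β it reads x = ∫ a(x)β, where a is `leftFrame`. On the Banach space of continuous paths the
map (β, x) ↦ (β, x − ∫ a(x)β) is smooth and its derivative at 0 is an invertible shear. The inverse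
function theorem therefore gives a smooth solution operator `dev`, whose derivative at 0 is
integration (`exists_smooth_solution_operator`). Solutions are unique because γ₁γ₂⁻¹ has vanishing
logarithmic derivative (`eqOn_of_hasLogDerivWithinAt`).

Image. Developing along radial segments, and then continuing outwards in small steps, yields a
primitive F : ℂ → `G` of every entire form (`exists_primitive`). Apply this to the pull-back of α
under w ↦ e^w. The primitive descends to ℂ* as soon as F(2πi) = F(0), which is triviality of the
monodromy along the unit circle. Two maps with the same logarithmic derivative and the same value at
1 coincide, so φ is a bijection onto 𝓜 × `G`.

Topology. The identity δ(fg⁻¹) = Ad(g)(δf − δg) moves every question to the constant map 1. There δ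
is continuous by Cauchy's estimate (`norm_loopForm_le`). Conversely f(u) is f(1) times the
development of δf along a segment in the logarithmic plane, whose length is bounded on each annulus
(`tendsto_one_of_tendsto_loopForm`).

Submanifold. A form α near 0 lies in 𝓜 exactly when the endpoint m(α) of its development along the
unit circle is 0. The derivative of m at 0 is the period ∮α. With K the kernel of the period, Ω¹ is
the sum of K and the multiples of dz/z, and α ↦ (K-part of α, m(α)) straightens 𝓜 near 0. The affine
maps β ↦ Ad(f)(β − δf) preserve 𝓜 and carry this chart to every δf.

Tameness. The function m sees α only through a path in a Banach space. Hence the charts and their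
inverses are affine tame maps plus bounded smooth maps that factor through normed spaces. This class
(`IsNormedPerturbationOn`) is closed under composition and consists of smooth tame maps, which
settles the submanifold charts and the transition maps together. The spaces themselves are tame
because Laurent coefficients decay faster than every exponential, so that Ω¹ is a tame summand of
Σ(E × E). -/

noncomputable section

set_option linter.unusedSectionVars false

section

open unitInterval

/-! ## Superposition operators on `C(I, E)` -/

section Superposition

variable {E : Type*} [NormedAddCommGroup E] [NormedSpace ℂ E]
  {F : Type*} [NormedAddCommGroup F] [NormedSpace ℂ F]

/-- The superposition operator `x ↦ a ∘ x` on continuous paths; the value is `0` if `a ∘ x` is not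
continuous. -/
def superposition (a : E → F) (x : C(I, E)) : C(I, F) :=
  open Classical in if h : Continuous fun t => a (x t) then ⟨fun t => a (x t), h⟩ else 0

/-- The continuous paths with values in `U`. -/
def pathsIn (U : Set E) : Set C(I, E) := {x | ∀ t, x t ∈ U}

lemma isOpen_pathsIn {U : Set E} (hU : IsOpen U) : IsOpen (pathsIn U) := by
  have := ContinuousMap.isOpen_setOfPred_mapsTo (X := I) (Y := E) isCompact_univ hU
  convert this using 1
  ext x
  simp [pathsIn, MapsTo]

lemma superposition_apply {a : E → F} {U : Set E} (ha : ContinuousOn a U) {x : C(I, E)}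
    (hx : x ∈ pathsIn U) (t : I) : superposition a x t = a (x t) := by
  have h : Continuous fun t => a (x t) := ha.comp_continuous x.continuous hx
  simp [superposition, h]

/-- Pointwise application of a path of linear maps to a path of vectors. -/
def pointwiseApply (E F : Type*) [NormedAddCommGroup E] [NormedSpace ℂ E]
    [NormedAddCommGroup F] [NormedSpace ℂ F] :
    C(I, E →L[ℂ] F) →L[ℂ] C(I, E) →L[ℂ] C(I, F) :=
  LinearMap.mkContinuous₂
    (LinearMap.mk₂ ℂ (fun (T : C(I, E →L[ℂ] F)) (x : C(I, E)) =>
      (⟨fun t => T t (x t), T.continuous.clm_apply x.continuous⟩ : C(I, F)))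
      (fun _ _ _ => by ext; simp) (fun _ _ _ => by ext; simp)
      (fun _ _ _ => by ext; simp) (fun _ _ _ => by ext; simp)) 1
    (fun T x => by
      rw [one_mul]
      refine (ContinuousMap.norm_le _ (by positivity)).2 fun t => ?_
      refine ((T t).le_opNorm _).trans ?_
      gcongr
      · exact T.norm_coe_le_norm t
      · exact x.norm_coe_le_norm t)

@[simp] lemma pointwiseApply_apply (T : C(I, E →L[ℂ] F)) (x : C(I, E)) (t : I) :
    pointwiseApply E F T x t = T t (x t) := rfl

lemma contDiff_pointwiseApply (E F : Type*) [NormedAddCommGroup E] [NormedSpace ℂ E]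
    [NormedAddCommGroup F] [NormedSpace ℂ F] : ContDiff ℂ ∞ (pointwiseApply E F) :=
  by fun_prop

lemma hasFDerivAt_pointwiseApply (E F : Type*) [NormedAddCommGroup E] [NormedSpace ℂ E]
    [NormedAddCommGroup F] [NormedSpace ℂ F] (T : C(I, E →L[ℂ] F)) :
    HasFDerivAt (pointwiseApply E F) (pointwiseApply E F) T :=
  by apply ContinuousLinearMap.hasFDerivAt

/-- The path has compact range, so `fderiv ℂ a` is uniformly continuous near it. The mean value
inequality then bounds the remainder at each time with a radius independent of the time, which is an
estimate in the supremum norm. -/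
lemma hasFDerivAt_superposition {a : E → F} {U : Set E} (hU : IsOpen U)
    (ha : ContDiffOn ℂ 1 a U) {x : C(I, E)} (hx : x ∈ pathsIn U) :
    HasFDerivAt (superposition a) (pointwiseApply E F (superposition (fderiv ℂ a) x)) x := by
  have hd : DifferentiableOn ℂ a U := ha.differentiableOn (by norm_num)
  have hc : ContinuousOn (fderiv ℂ a) U := ha.continuousOn_fderiv_of_isOpen hU (by norm_num)
  have hK : IsCompact (range x) := isCompact_range x.continuous
  have hKU : range x ⊆ U := by rintro _ ⟨t, rfl⟩; exact hx t
  obtain ⟨δ₁, hδ₁, hU₁⟩ := hK.exists_thickening_subset_open hU hKU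
  rw [hasFDerivAt_iff_isLittleO_nhds_zero, Asymptotics.isLittleO_iff]
  intro ε hε
  have huc := hK.uniformContinuousAt_of_continuousAt (fderiv ℂ a)
    (fun y hy => hc.continuousAt (hU.mem_nhds (hKU hy))) (Metric.dist_mem_uniformity hε)
  obtain ⟨δ₂, hδ₂, hU₂⟩ := Metric.mem_uniformity_dist.1 huc
  have hball : Metric.ball (0 : C(I, E)) (min δ₁ δ₂) ∈ 𝓝 0 :=
    Metric.ball_mem_nhds _ (lt_min hδ₁ hδ₂)
  filter_upwards [hball] with h hh
  have hh' : ‖h‖ < min δ₁ δ₂ := by simpa using hh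
  have key : ∀ t, Metric.ball (x t) (min δ₁ δ₂) ⊆ U := fun t y hy =>
    hU₁ (Metric.mem_thickening_iff.2 ⟨x t, mem_range_self t, lt_of_lt_of_le hy (min_le_left _ _)⟩)
  have hmem : ∀ t, x t + h t ∈ Metric.ball (x t) (min δ₁ δ₂) := fun t => by
    simpa using (h.norm_coe_le_norm t).trans_lt hh'
  have hxh : x + h ∈ pathsIn U := fun t => key t (hmem t)
  refine (ContinuousMap.norm_le _ (by positivity)).2 fun t => ?_
  simp only [ContinuousMap.sub_apply, pointwiseApply_apply,
    superposition_apply hd.continuousOn hxh, superposition_apply hd.continuousOn hx,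
    superposition_apply hc hx, ContinuousMap.add_apply]
  -- The mean value inequality relative to the fixed linear map at the centre: on the ball the
  -- derivative differs from it by at most `ε`.
  have := (convex_ball (x t) (min δ₁ δ₂)).norm_image_sub_le_of_norm_hasFDerivWithin_le'
    (f := a) (f' := fderiv ℂ a) (φ := fderiv ℂ a (x t)) (C := ε) (x := x t) (y := x t + h t)
    (fun y hy => ((hd.differentiableAt (hU.mem_nhds (key t hy))).hasFDerivAt).hasFDerivWithinAt)
    (fun y hy => by
      rw [← dist_eq_norm, dist_comm]
      refine (hU₂ ?_ (mem_range_self t)).le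
      rw [dist_comm]; exact lt_of_lt_of_le hy (min_le_right _ _))
    (Metric.mem_ball_self (lt_min hδ₁ hδ₂)) (hmem t)
  rw [add_sub_cancel_left] at this
  refine this.trans ?_
  gcongr
  exact h.norm_coe_le_norm t

end Superposition

/-- The derivative of a superposition operator is the superposition operator of `fderiv ℂ a`
followed by the bounded map `pointwiseApply`. This permits induction, at the price of one derivative
of `a`. The target `F` varies because the step passes to `E →L[ℂ] F`; the common universe makes that
space admissible. -/
lemma contDiffOn_superposition_nat.{u} {E : Type u} [NormedAddCommGroup E] [NormedSpace ℂ E]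
    {U : Set E} (hU : IsOpen U) (n : ℕ) : ∀ {F : Type u} [NormedAddCommGroup F]
    [NormedSpace ℂ F] {a : E → F}, ContDiffOn ℂ (n + 1) a U →
    ContDiffOn ℂ n (superposition a) (pathsIn U) := by
  induction n with
  | zero =>
    intro F _ _ a ha
    rw [Nat.cast_zero, contDiffOn_zero]
    exact fun x hx => (hasFDerivAt_superposition hU (by simpa using ha) hx
      ).continuousAt.continuousWithinAt
  | succ n ih =>
    intro F _ _ a ha
    have h1 : ContDiffOn ℂ 1 a U := ha.of_le (by exact_mod_cast Nat.le_add_left _ _)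
    push_cast
    rw [contDiffOn_succ_iff_fderiv_of_isOpen (isOpen_pathsIn hU)]
    refine ⟨fun x hx => (hasFDerivAt_superposition hU h1 hx
      ).differentiableAt.differentiableWithinAt, fun h => by simp at h, ?_⟩
    have ha' : ContDiffOn ℂ (n + 1) (fderiv ℂ a) U :=
      ((contDiffOn_succ_iff_fderiv_of_isOpen hU).1 (by exact_mod_cast ha)).2.2
    refine ((pointwiseApply E F).contDiff.comp_contDiffOn (ih ha')).congr fun x hx => ?_
    exact (hasFDerivAt_superposition hU h1 hx).fderiv

lemma contDiffOn_superposition.{u} {E F : Type u} [NormedAddCommGroup E] [NormedSpace ℂ E]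
    [NormedAddCommGroup F] [NormedSpace ℂ F] {U : Set E} (hU : IsOpen U) {a : E → F}
    (ha : ContDiffOn ℂ ∞ a U) : ContDiffOn ℂ ∞ (superposition a) (pathsIn U) :=
  contDiffOn_infty.2 fun n => contDiffOn_superposition_nat hU n
    (ha.of_le (by exact_mod_cast le_top))

/-! ## The inverse function theorem for `C^∞` maps -/

/-- A local inverse is smooth wherever the derivative at the preimage is invertible. Invertible
operators form an open set, so shrinking the source to `W` makes the inverse smooth on the whole
target, not only at the image of `x`. -/
theorem exists_openPartialHomeomorph_contDiffOn {𝕜 X Y : Type*} [RCLike 𝕜]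
    [NormedAddCommGroup X] [NormedSpace 𝕜 X] [CompleteSpace X]
    [NormedAddCommGroup Y] [NormedSpace 𝕜 Y] {f : X → Y} {U : Set X} (hU : IsOpen U)
    (hf : ContDiffOn 𝕜 ∞ f U) {x : X} (hx : x ∈ U) {f' : X ≃L[𝕜] Y}
    (hf' : HasFDerivAt f (f' : X →L[𝕜] Y) x) :
    ∃ e : OpenPartialHomeomorph X Y, x ∈ e.source ∧ e.source ⊆ U ∧ (∀ y, e y = f y) ∧
      ContDiffOn 𝕜 ∞ e.symm e.target := by
  have hfx : ContDiffAt 𝕜 ∞ f x := hf.contDiffAt (hU.mem_nhds hx)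
  set e₀ := hfx.toOpenPartialHomeomorph f hf' (by simp) with he₀
  have hc : ContinuousOn (fderiv 𝕜 f) U := hf.continuousOn_fderiv_of_isOpen hU (by simp)
  set W : Set X := U ∩ fderiv 𝕜 f ⁻¹' range ((↑) : (X ≃L[𝕜] Y) → X →L[𝕜] Y) with hW
  have hWo : IsOpen W := hc.isOpen_inter_preimage hU ContinuousLinearEquiv.isOpen
  have hxW : x ∈ W := ⟨hx, f', hf'.fderiv.symm⟩
  refine ⟨e₀.restrOpen W hWo, ⟨hfx.mem_toOpenPartialHomeomorph_source hf' (by simp), hxW⟩,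
    fun y hy => hy.2.1, fun y => rfl, ?_⟩
  intro y hy
  set e := e₀.restrOpen W hWo
  have hz : e.symm y ∈ W := (e.map_target hy).2
  obtain ⟨g, hg⟩ := hz.2
  have hcd : ContDiffAt 𝕜 ∞ f (e.symm y) := hf.contDiffAt (hU.mem_nhds hz.1)
  refine (e.contDiffAt_symm (f₀' := g) hy ?_ hcd).contDiffWithinAt
  rw [hg]
  exact (hcd.differentiableAt (by simp)).hasFDerivAt

end

section

open unitInterval

/-! ## Ordinary differential equations with small right hand side -/

section ODE

variable {E : Type*} [NormedAddCommGroup E] [NormedSpace ℂ E]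

/-- The primitive vanishing at `0` of the extension of `g` to the real line by constants. -/
def pathPrimitive (g : C(I, E)) (t : ℝ) : E := ∫ s in (0 : ℝ)..t, g (projIcc 0 1 zero_le_one s)

lemma continuous_comp_projIcc (g : C(I, E)) :
    Continuous fun s : ℝ => g (projIcc 0 1 zero_le_one s) :=
  g.continuous.comp continuous_projIcc

lemma hasDerivAt_pathPrimitive [CompleteSpace E] (g : C(I, E)) (t : ℝ) :
    HasDerivAt (pathPrimitive g) (g (projIcc 0 1 zero_le_one t)) t :=
  intervalIntegral.integral_hasDerivAt_right
    ((continuous_comp_projIcc g).intervalIntegrable _ _)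
    ((continuous_comp_projIcc g).stronglyMeasurableAtFilter _ _)
    (continuous_comp_projIcc g).continuousAt

/-- The operator `g ↦ (t ↦ ∫₀ᵗ g)` on `C(I, E)`. -/
def volterra (E : Type*) [NormedAddCommGroup E] [NormedSpace ℂ E] [CompleteSpace E] :
    C(I, E) →L[ℂ] C(I, E) :=
  LinearMap.mkContinuous
    { toFun := fun g => ⟨fun t => pathPrimitive g t,
        (continuous_iff_continuousAt.2 fun t =>
          (hasDerivAt_pathPrimitive g t).continuousAt).comp continuous_subtype_val⟩
      map_add' := fun f g => by
        ext t
        exact intervalIntegral.integral_add ((continuous_comp_projIcc f).intervalIntegrable _ _)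
          ((continuous_comp_projIcc g).intervalIntegrable _ _)
      map_smul' := fun c g => by
        ext t
        exact intervalIntegral.integral_smul c _ } 1
    (fun g => by
      rw [one_mul]
      refine (ContinuousMap.norm_le _ (norm_nonneg _)).2 fun t => ?_
      refine (intervalIntegral.norm_integral_le_of_norm_le_const (C := ‖g‖)
        (fun s _ => g.norm_coe_le_norm _)).trans ?_
      rw [sub_zero, abs_of_nonneg t.2.1]
      exact mul_le_of_le_one_right (norm_nonneg _) t.2.2)

lemma volterra_apply [CompleteSpace E] (g : C(I, E)) (t : I) :
    volterra E g t = pathPrimitive g t := rfl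

end ODE

/-- The integral equation is `Θ (β, x) = (β, 0)`. Inverting `Θ` near the origin yields existence of
the solution and its smooth dependence on `β` at once, with no iteration. -/
theorem exists_smooth_solution_operator.{u} {E : Type u} [NormedAddCommGroup E] [NormedSpace ℂ E]
    [CompleteSpace E] {U : Set E} (hU : IsOpen U) (h0 : (0 : E) ∈ U) {a : E → E →L[ℂ] E}
    (ha : ContDiffOn ℂ ∞ a U) (ha0 : a 0 = ContinuousLinearMap.id ℂ E) :
    ∃ ε > 0, ∃ S : C(I, E) → C(I, E), ContDiffOn ℂ ∞ S (Metric.ball 0 ε) ∧ S 0 = 0 ∧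
      HasFDerivAt S (volterra E) 0 ∧ ∀ β ∈ Metric.ball (0 : C(I, E)) ε, S β ∈ pathsIn U ∧
        S β = volterra E (pointwiseApply E E (superposition a (S β)) β) := by
  have hA := contDiffOn_superposition hU ha
  have hP := isOpen_pathsIn (E := E) hU
  have h0P : (0 : C(I, E)) ∈ pathsIn U := fun t => h0
  have hA0 : superposition a (0 : C(I, E)) = ContinuousMap.const I (ContinuousLinearMap.id ℂ E) := by
    ext t : 1
    rw [superposition_apply ha.continuousOn h0P]
    exact ha0
  have hPA0 : pointwiseApply E E (superposition a (0 : C(I, E))) = ContinuousLinearMap.id ℂ C(I, E) := by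
    rw [hA0]; ext x t; rfl
  set R : C(I, E) × C(I, E) → C(I, E) := fun p => volterra E (pointwiseApply E E (superposition a p.2) p.1) with hR
  have hRs : ContDiffOn ℂ ∞ R (univ ×ˢ pathsIn U) := by
    refine (volterra E).contDiff.comp_contDiffOn ?_
    have h1 : ContDiffOn ℂ ∞ (fun p : C(I, E) × C(I, E) => superposition a p.2) (univ ×ˢ pathsIn U) :=
      hA.comp contDiff_snd.contDiffOn fun p hp => hp.2
    have h2 : ContDiffOn ℂ ∞ (fun p : C(I, E) × C(I, E) => pointwiseApply E E (superposition a p.2))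
        (univ ×ˢ pathsIn U) := (contDiff_pointwiseApply E E).comp_contDiffOn h1
    exact h2.clm_apply contDiff_fst.contDiffOn
  have hAd : DifferentiableAt ℂ (superposition a) (0 : C(I, E)) :=
    (hA.contDiffAt (hP.mem_nhds h0P)).differentiableAt (by simp)
  -- The dependence of `a` on `x` does not contribute at the origin, since there it is multiplied by
  -- `p.1 = 0`.
  have hRd : HasFDerivAt R ((volterra E).comp (ContinuousLinearMap.fst ℂ C(I, E) C(I, E))) ((0 : C(I, E)), (0 : C(I, E))) := by
    have h1 : HasFDerivAt (fun p : C(I, E) × C(I, E) => pointwiseApply E E (superposition a p.2))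
        ((pointwiseApply E E).comp ((fderiv ℂ (superposition a) (0 : C(I, E))).comp
          (ContinuousLinearMap.snd ℂ C(I, E) C(I, E)))) ((0 : C(I, E)), (0 : C(I, E))) := by
      have h3 : HasFDerivAt (fun p : C(I, E) × C(I, E) => superposition a p.2) ((fderiv ℂ (superposition a)
          (0 : C(I, E))).comp (ContinuousLinearMap.snd ℂ C(I, E) C(I, E))) ((0 : C(I, E)), (0 : C(I, E))) :=
        HasFDerivAt.comp (f := Prod.snd) ((0 : C(I, E)), (0 : C(I, E))) hAd.hasFDerivAt hasFDerivAt_snd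
      have h4 := hasFDerivAt_pointwiseApply E E (superposition a (0 : C(I, E)))
      exact HasFDerivAt.comp (g := pointwiseApply E E) (f := fun p : C(I, E) × C(I, E) =>
        superposition a p.2) _ h4 h3
    have h2 := (volterra E).hasFDerivAt.comp ((0 : C(I, E)), (0 : C(I, E))) (h1.clm_apply hasFDerivAt_fst)
    refine h2.congr_fderiv ?_
    refine ContinuousLinearMap.ext fun p => ?_
    simp [hPA0]
  set Θ : C(I, E) × C(I, E) → C(I, E) × C(I, E) := fun p => (p.1, p.2 - R p) with hΘ
  have hΘs : ContDiffOn ℂ ∞ Θ (univ ×ˢ pathsIn U) :=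
    contDiff_fst.contDiffOn.prodMk (contDiff_snd.contDiffOn.sub hRs)
  set V1 := (volterra E).comp (ContinuousLinearMap.fst ℂ C(I, E) C(I, E))
  -- The derivative of `Θ` is the shear `(β, x) ↦ (β, x - volterra β)`; its inverse changes the
  -- sign.
  set Te : (C(I, E) × C(I, E)) ≃L[ℂ] (C(I, E) × C(I, E)) := ContinuousLinearEquiv.equivOfInverse
    ((ContinuousLinearMap.fst ℂ C(I, E) C(I, E)).prod (ContinuousLinearMap.snd ℂ C(I, E) C(I, E) - V1))
    ((ContinuousLinearMap.fst ℂ C(I, E) C(I, E)).prod (ContinuousLinearMap.snd ℂ C(I, E) C(I, E) + V1))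
    (fun p => by simp [V1]) (fun p => by simp [V1]) with hTe
  have hΘd : HasFDerivAt Θ (Te : C(I, E) × C(I, E) →L[ℂ] C(I, E) × C(I, E)) ((0 : C(I, E)), (0 : C(I, E))) :=
    hasFDerivAt_fst.prodMk (hasFDerivAt_snd.sub hRd)
  obtain ⟨e, he0, heU, hecoe, hes⟩ := exists_openPartialHomeomorph_contDiffOn
    (isOpen_univ.prod hP) hΘs (x := ((0 : C(I, E)), (0 : C(I, E)))) ⟨trivial, h0P⟩ hΘd
  have hΘ0 : Θ ((0 : C(I, E)), (0 : C(I, E))) = (0, 0) := by simp [hΘ, hR]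
  have hinv0 : e.symm ((0 : C(I, E)), (0 : C(I, E))) = (0, 0) := by
    have := e.left_inv he0
    rwa [hecoe, hΘ0] at this
  have ht0 : ((0 : C(I, E)), (0 : C(I, E))) ∈ e.target := by
    have := e.map_source he0
    rwa [hecoe, hΘ0] at this
  have hopen : IsOpen ((fun β : C(I, E) => (β, (0 : C(I, E)))) ⁻¹' e.target) :=
    e.open_target.preimage (by fun_prop)
  obtain ⟨ε, hε, hball⟩ := Metric.isOpen_iff.1 hopen 0 ht0
  set S : C(I, E) → C(I, E) := fun β => (e.symm (β, 0)).2 with hS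
  have hSs : ContDiffOn ℂ ∞ S (Metric.ball 0 ε) := by
    refine contDiff_snd.comp_contDiffOn (hes.comp ?_ hball)
    exact (contDiff_id.prodMk contDiff_const).contDiffOn
  have hS0 : S 0 = 0 := by simp [hS, hinv0]
  have hsol : ∀ β ∈ Metric.ball (0 : C(I, E)) ε, S β ∈ pathsIn U ∧ S β = R (β, S β) := by
    intro β hβ
    have h1 := e.right_inv (hball hβ)
    have h2 := heU (e.map_target (hball hβ))
    rw [hecoe] at h1
    have h3 : (e.symm (β, 0)).1 = β := congrArg Prod.fst h1
    have h4 : S β - R (e.symm (β, 0)) = 0 := congrArg Prod.snd h1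
    have h5 : e.symm (β, 0) = (β, S β) := Prod.ext h3 rfl
    rw [h5] at h4
    exact ⟨h2.2, sub_eq_zero.1 h4⟩
  refine ⟨ε, hε, S, hSs, hS0, ?_, hsol⟩
  have hSd : HasFDerivAt S (fderiv ℂ S 0) 0 :=
    ((hSs.contDiffAt (Metric.ball_mem_nhds _ hε)).differentiableAt (by simp)).hasFDerivAt
  -- Differentiate the fixed point equation. The derivative of `R` at the origin ignores the second
  -- variable, so the derivative of `S` on the right drops out.
  have h1 : HasFDerivAt (fun β => R (β, S β)) (volterra E) 0 := by
    have : HasFDerivAt R V1 ((0 : C(I, E)), S 0) := by rw [hS0]; exact hRd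
    refine (HasFDerivAt.comp (0 : C(I, E)) (g := R) this
      ((hasFDerivAt_id (0 : C(I, E))).prodMk hSd)).congr_fderiv ?_
    ext x; simp [V1]
  refine h1.congr_of_eventuallyEq ?_
  filter_upwards [Metric.ball_mem_nhds (0 : C(I, E)) hε] with β hβ using (hsol β hβ).2

end

open ContinuousLinearMap (toSpanSingleton)

/-! ## A chart at the identity of a complex Lie group -/

section IdentityChart

variable (E : Type*) [NormedAddCommGroup E] [NormedSpace ℂ E]
  (G : Type*) [TopologicalSpace G] [ChartedSpace E G] [Group G]

/-- The preferred chart at `1`, translated so that it maps `1` to `0`. -/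
def idChart : OpenPartialHomeomorph G E :=
  (chartAt E (1 : G)).transHomeomorph (Homeomorph.addRight (-(chartAt E (1 : G) 1)))

variable {G} in
lemma idChart_apply (g : G) : idChart E G g = chartAt E (1 : G) g - chartAt E (1 : G) 1 := by
  simp [idChart, sub_eq_add_neg]

lemma idChart_symm_apply (x : E) :
    (idChart E G).symm x = (chartAt E (1 : G)).symm (x + chartAt E (1 : G) 1) := by
  simp [idChart, Homeomorph.addRight]

@[simp] lemma idChart_one : idChart E G 1 = 0 := by simp [idChart_apply]

lemma one_mem_idChart_source : (1 : G) ∈ (idChart E G).source := mem_chart_source E (1 : G)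

lemma zero_mem_idChart_target : (0 : E) ∈ (idChart E G).target := by
  simpa using (idChart E G).map_source (one_mem_idChart_source E G)

@[simp] lemma idChart_symm_zero : (idChart E G).symm 0 = 1 := by
  simpa using (idChart E G).left_inv (one_mem_idChart_source E G)

lemma idChart_source_mem_nhds : (idChart E G).source ∈ 𝓝 (1 : G) :=
  (idChart E G).open_source.mem_nhds (one_mem_idChart_source E G)

lemma idChart_target_mem_nhds : (idChart E G).target ∈ 𝓝 (0 : E) :=
  (idChart E G).open_target.mem_nhds (zero_mem_idChart_target E G)

variable [LieGroup 𝓘(ℂ, E) ω G]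

variable {G} in
lemma contMDiffAt_idChart {g : G} (hg : g ∈ (idChart E G).source) :
    ContMDiffAt 𝓘(ℂ, E) 𝓘(ℂ, E) ω (idChart E G) g := by
  have h1 : ContMDiffAt 𝓘(ℂ, E) 𝓘(ℂ, E) ω (chartAt E (1 : G)) g :=
    contMDiffOn_chart.contMDiffAt ((chartAt E (1 : G)).open_source.mem_nhds hg)
  have h2 : ContDiff ℂ ω fun x : E => x - chartAt E (1 : G) 1 := contDiff_id.sub contDiff_const
  exact (h2.contMDiff.contMDiffAt.comp g h1).congr_of_eventuallyEq
    (Eventually.of_forall fun g => idChart_apply E g)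

lemma contMDiffAt_idChart_symm {x : E} (hx : x ∈ (idChart E G).target) :
    ContMDiffAt 𝓘(ℂ, E) 𝓘(ℂ, E) ω (idChart E G).symm x := by
  have h2 : ContDiff ℂ ω fun x : E => x + chartAt E (1 : G) 1 := contDiff_id.add contDiff_const
  have hx' : x + chartAt E (1 : G) 1 ∈ (chartAt E (1 : G)).target := by
    simpa [idChart, Homeomorph.addRight] using hx
  have h1 : ContMDiffAt 𝓘(ℂ, E) 𝓘(ℂ, E) ω (chartAt E (1 : G)).symm (x + chartAt E (1 : G) 1) :=
    contMDiffOn_chart_symm.contMDiffAt ((chartAt E (1 : G)).open_target.mem_nhds hx')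
  exact (h1.comp x h2.contMDiff.contMDiffAt).congr_of_eventuallyEq
    (Eventually.of_forall fun g => idChart_symm_apply E G g)

variable {E G} in
lemma ContMDiffAt.contDiffAt_idChart {W : Type*} [NormedAddCommGroup W] [NormedSpace ℂ W]
    {m : W → G} {p : W} (hm : ContMDiffAt 𝓘(ℂ, W) 𝓘(ℂ, E) ω m p)
    (hp : m p ∈ (idChart E G).source) : ContDiffAt ℂ ω (fun q => idChart E G (m q)) p :=
  ((contMDiffAt_idChart E hp).comp p hm).contDiffAt

variable {E} in
lemma ContDiffAt.contMDiffAt_idChart_symm {W : Type*} [NormedAddCommGroup W] [NormedSpace ℂ W]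
    {u : W → E} {p : W} (hu : ContDiffAt ℂ ω u p) (hp : u p ∈ (idChart E G).target) :
    ContMDiffAt 𝓘(ℂ, W) 𝓘(ℂ, E) ω (fun q => (idChart E G).symm (u q)) p :=
  (_root_.contMDiffAt_idChart_symm E G hp).comp p hu.contMDiffAt

/-- The left invariant frame, in the chart at the identity. -/
def leftFrame (x : E) : E →L[ℂ] E :=
  fderiv ℂ (fun y => idChart E G ((idChart E G).symm x * (idChart E G).symm y)) 0

/-- The coframe dual to the left invariant frame, in the chart at the identity. -/
def leftCoframe (x : E) : E →L[ℂ] E :=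
  fderiv ℂ (fun y => idChart E G (((idChart E G).symm x)⁻¹ * (idChart E G).symm y)) x

lemma contDiffAt_mul_idChart {x : E} (hx : x ∈ (idChart E G).target) :
    ContDiffAt ℂ ω (Function.uncurry fun x y =>
      idChart E G ((idChart E G).symm x * (idChart E G).symm y)) (x, 0) := by
  refine ContMDiffAt.contDiffAt_idChart (m := fun p : E × E =>
    (idChart E G).symm p.1 * (idChart E G).symm p.2) ?_ ?_
  · exact (contDiffAt_fst.contMDiffAt_idChart_symm G hx).mul
      (contDiffAt_snd.contMDiffAt_idChart_symm G (zero_mem_idChart_target E G))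
  · simpa using (idChart E G).map_target hx

lemma contDiffAt_inv_mul_idChart {x : E} (hx : x ∈ (idChart E G).target) :
    ContDiffAt ℂ ω (Function.uncurry fun x y =>
      idChart E G (((idChart E G).symm x)⁻¹ * (idChart E G).symm y)) (x, x) := by
  refine ContMDiffAt.contDiffAt_idChart (m := fun p : E × E =>
    ((idChart E G).symm p.1)⁻¹ * (idChart E G).symm p.2) ?_ ?_
  · exact (contDiffAt_fst.contMDiffAt_idChart_symm G hx).inv.mul
      (contDiffAt_snd.contMDiffAt_idChart_symm G hx)
  · simpa using one_mem_idChart_source E G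

lemma contDiffOn_leftFrame : ContDiffOn ℂ ω (leftFrame E G) (idChart E G).target := fun _ hx =>
  (ContDiffAt.fderiv (contDiffAt_mul_idChart E G hx) contDiffAt_const le_rfl).contDiffWithinAt

lemma contDiffOn_leftCoframe : ContDiffOn ℂ ω (leftCoframe E G) (idChart E G).target := fun _ hx =>
  (ContDiffAt.fderiv (contDiffAt_inv_mul_idChart E G hx) contDiffAt_id le_rfl).contDiffWithinAt

lemma hasFDerivAt_leftFrame {x : E} (hx : x ∈ (idChart E G).target) :
    HasFDerivAt (fun y => idChart E G ((idChart E G).symm x * (idChart E G).symm y))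
      (leftFrame E G x) 0 := by
  have h1 : ContDiffAt ℂ ω (fun y : E => (x, y)) 0 := contDiffAt_const.prodMk contDiffAt_id
  have h2 := (ContDiffAt.comp (0 : E) (contDiffAt_mul_idChart E G hx) h1)
  exact (h2.differentiableAt (by simp)).hasFDerivAt

lemma hasFDerivAt_leftCoframe {x : E} (hx : x ∈ (idChart E G).target) :
    HasFDerivAt (fun y => idChart E G (((idChart E G).symm x)⁻¹ * (idChart E G).symm y))
      (leftCoframe E G x) x := by
  have h1 : ContDiffAt ℂ ω (fun y : E => (x, y)) x := contDiffAt_const.prodMk contDiffAt_id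
  have h2 := (ContDiffAt.comp x (contDiffAt_inv_mul_idChart E G hx) h1)
  exact (h2.differentiableAt (by simp)).hasFDerivAt

lemma continuousAt_idChart_symm_zero : ContinuousAt (idChart E G).symm 0 :=
  (idChart E G).symm.continuousAt (zero_mem_idChart_target E G)

lemma tendsto_idChart_symm : Tendsto (idChart E G).symm (𝓝 0) (𝓝 1) := by
  simpa [ContinuousAt] using continuousAt_idChart_symm_zero E G

/-- Chain rule for the cancellation x⁻¹(xy) = y near y = 1. This identity recovers a logarithmic
derivative from an ordinary derivative in the chart. -/
lemma leftCoframe_leftFrame {x : E} (hx : x ∈ (idChart E G).target) :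
    (leftCoframe E G x).comp (leftFrame E G x) = ContinuousLinearMap.id ℂ E := by
  have : IsTopologicalGroup G := topologicalGroup_of_lieGroup 𝓘(ℂ, E) ω
  have h1 := hasFDerivAt_leftFrame E G hx
  have hx' := (idChart E G).map_target hx
  have e : idChart E G ((idChart E G).symm x * (idChart E G).symm 0) = x := by
    simp [(idChart E G).right_inv hx]
  have h2 : HasFDerivAt (fun y => idChart E G (((idChart E G).symm x)⁻¹ * (idChart E G).symm y))
      (leftCoframe E G x) (idChart E G ((idChart E G).symm x * (idChart E G).symm 0)) := by
    rw [e]; exact hasFDerivAt_leftCoframe E G hx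
  refine (h2.comp 0 h1).unique ((hasFDerivAt_id (0 : E)).congr_of_eventuallyEq ?_)
  have h3 : ∀ᶠ y in 𝓝 (0 : E), (idChart E G).symm x * (idChart E G).symm y ∈
      (idChart E G).source := by
    have : Tendsto (fun y => (idChart E G).symm x * (idChart E G).symm y) (𝓝 0)
        (𝓝 ((idChart E G).symm x)) := by
      simpa using (tendsto_idChart_symm E G).const_mul ((idChart E G).symm x)
    exact this ((idChart E G).open_source.mem_nhds hx')
  filter_upwards [h3, idChart_target_mem_nhds E G] with y hy hy'
  simp [(idChart E G).left_inv hy, (idChart E G).right_inv hy']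

lemma leftFrame_zero : leftFrame E G 0 = ContinuousLinearMap.id ℂ E := by
  refine (hasFDerivAt_leftFrame E G (zero_mem_idChart_target E G)).unique
    ((hasFDerivAt_id (0 : E)).congr_of_eventuallyEq ?_)
  filter_upwards [idChart_target_mem_nhds E G] with y hy
  simp [(idChart E G).right_inv hy]

/-- The derivative is linear, hence determined by its restrictions to the first axis and to the
diagonal. The map is the identity on the former, and constant on the latter because xx⁻¹ = 1. -/
lemma hasFDerivAt_mul_inv_idChart :
    HasFDerivAt (fun p : E × E => idChart E G ((idChart E G).symm p.1 * ((idChart E G).symm p.2)⁻¹))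
      (ContinuousLinearMap.fst ℂ E E - ContinuousLinearMap.snd ℂ E E) 0 := by
  have h0 := zero_mem_idChart_target E G
  have hs : ContDiffAt ℂ ω (fun p : E × E =>
      idChart E G ((idChart E G).symm p.1 * ((idChart E G).symm p.2)⁻¹)) (0, 0) := by
    refine ContMDiffAt.contDiffAt_idChart (m := fun p : E × E =>
      (idChart E G).symm p.1 * ((idChart E G).symm p.2)⁻¹) ?_ ?_
    · exact (contDiffAt_fst.contMDiffAt_idChart_symm G h0).mul
        (contDiffAt_snd.contMDiffAt_idChart_symm G h0).inv
    · simpa using one_mem_idChart_source E G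
  have hd := (hs.differentiableAt (by simp)).hasFDerivAt
  set D := fderiv ℂ (fun p : E × E =>
      idChart E G ((idChart E G).symm p.1 * ((idChart E G).symm p.2)⁻¹)) (0, 0)
  refine hd.congr_fderiv ?_
  have h1 : D.comp (ContinuousLinearMap.inl ℂ E E) = ContinuousLinearMap.id ℂ E := by
    have hi : HasFDerivAt (fun x : E => (x, (0 : E))) (ContinuousLinearMap.inl ℂ E E) 0 :=
      (ContinuousLinearMap.inl ℂ E E).hasFDerivAt
    refine (HasFDerivAt.comp (f := fun x : E => (x, (0 : E))) (0 : E) hd hi).unique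
      ((hasFDerivAt_id (0 : E)).congr_of_eventuallyEq ?_)
    filter_upwards [idChart_target_mem_nhds E G] with y hy
    simp [(idChart E G).right_inv hy]
  have h2 : D.comp ((ContinuousLinearMap.id ℂ E).prod (ContinuousLinearMap.id ℂ E)) = 0 := by
    have hi : HasFDerivAt (fun x : E => (x, x))
        ((ContinuousLinearMap.id ℂ E).prod (ContinuousLinearMap.id ℂ E)) 0 :=
      (hasFDerivAt_id (0 : E)).prodMk (hasFDerivAt_id (0 : E))
    refine (HasFDerivAt.comp (f := fun x : E => (x, x)) (0 : E) hd hi).unique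
      ((hasFDerivAt_const (0 : E) (0 : E)).congr_of_eventuallyEq ?_)
    exact Eventually.of_forall fun y => by simp
  refine ContinuousLinearMap.ext fun p => ?_
  have e1 : D (p.1 - p.2, 0) = p.1 - p.2 := DFunLike.congr_fun h1 (p.1 - p.2)
  have e2 : D (p.2, p.2) = 0 := DFunLike.congr_fun h2 p.2
  have e3 : p = (p.1 - p.2, 0) + (p.2, p.2) := by ext <;> simp
  conv_lhs => rw [e3, map_add, e1, e2, add_zero]
  simp

/-! ## The adjoint representation -/

variable {G}

/-- The adjoint action of `g` on the tangent space at the identity. -/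
def adjointMap (g : G) : E →L[ℂ] E :=
  fderiv ℂ (fun y => idChart E G (g * (idChart E G).symm y * g⁻¹)) 0

/-- Two choices of `u` matter: `u = 0` gives smoothness of a single conjugation, and `u = id` gives
the dependence of the adjoint action on the group element. -/
lemma contDiffAt_conj_idChart (u : E → E) (hu : ContDiffAt ℂ ω u 0) (hu0 : u 0 = 0) (g : G) :
    ContDiffAt ℂ ω (Function.uncurry fun x y => idChart E G (g * (idChart E G).symm (u x) *
      (idChart E G).symm y * (g * (idChart E G).symm (u x))⁻¹)) (0, 0) := by
  have h0 := zero_mem_idChart_target E G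
  refine ContMDiffAt.contDiffAt_idChart (m := fun p : E × E => g * (idChart E G).symm (u p.1) *
      (idChart E G).symm p.2 * (g * (idChart E G).symm (u p.1))⁻¹) ?_ ?_
  · have h1 : ContMDiffAt 𝓘(ℂ, E × E) 𝓘(ℂ, E) ω (fun p : E × E => g * (idChart E G).symm (u p.1))
        (0, 0) := contMDiffAt_const.mul (ContDiffAt.contMDiffAt_idChart_symm G
          (ContDiffAt.comp ((0 : E), (0 : E)) hu contDiffAt_fst) (by simpa [hu0] using h0))
    exact (h1.mul (contDiffAt_snd.contMDiffAt_idChart_symm G h0)).mul h1.inv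
  · simpa [hu0] using one_mem_idChart_source E G

lemma hasFDerivAt_adjointMap (g : G) :
    HasFDerivAt (fun y => idChart E G (g * (idChart E G).symm y * g⁻¹)) (adjointMap E g) 0 := by
  have h1 : ContDiffAt ℂ ω (fun y : E => ((0 : E), y)) 0 := contDiffAt_const.prodMk contDiffAt_id
  have h2 := (ContDiffAt.comp (0 : E)
    (contDiffAt_conj_idChart E (fun _ => 0) contDiffAt_const rfl g) h1)
  have h3 := (h2.differentiableAt (by simp))
  refine DifferentiableAt.hasFDerivAt ?_
  convert h3 using 1
  ext y
  simp [Function.uncurry]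

lemma eventually_conj_mem_idChart (g : G) :
    ∀ᶠ y in 𝓝 (0 : E), g * (idChart E G).symm y * g⁻¹ ∈ (idChart E G).source := by
  have : IsTopologicalGroup G := topologicalGroup_of_lieGroup 𝓘(ℂ, E) ω
  have : Tendsto (fun y => g * (idChart E G).symm y * g⁻¹) (𝓝 0) (𝓝 1) := by
    simpa using ((tendsto_idChart_symm E G).const_mul g).mul_const g⁻¹
  exact this (idChart_source_mem_nhds E G)

lemma adjointMap_mul (g h : G) : adjointMap E (g * h) = (adjointMap E g).comp (adjointMap E h) := by
  have h1 := hasFDerivAt_adjointMap E h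
  have h2 : HasFDerivAt (fun y => idChart E G (g * (idChart E G).symm y * g⁻¹)) (adjointMap E g)
      (idChart E G (h * (idChart E G).symm 0 * h⁻¹)) := by
    simpa using hasFDerivAt_adjointMap E g
  refine (hasFDerivAt_adjointMap E (g * h)).unique ((h2.comp 0 h1).congr_of_eventuallyEq ?_)
  filter_upwards [eventually_conj_mem_idChart E h] with y hy
  simp only [Function.comp_apply, (idChart E G).left_inv hy]
  congr 1
  group

lemma adjointMap_one : adjointMap E (1 : G) = ContinuousLinearMap.id ℂ E := by
  refine (hasFDerivAt_adjointMap E (1 : G)).unique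
    ((hasFDerivAt_id (0 : E)).congr_of_eventuallyEq ?_)
  filter_upwards [idChart_target_mem_nhds E G] with y hy
  simp [(idChart E G).right_inv hy]

@[simp] lemma adjointMap_inv_apply_apply (g : G) (x : E) :
    adjointMap E g⁻¹ (adjointMap E g x) = x := by
  have := DFunLike.congr_fun (adjointMap_mul E g⁻¹ g) x
  rw [inv_mul_cancel, adjointMap_one] at this
  exact this.symm

@[simp] lemma adjointMap_apply_inv_apply (g : G) (x : E) :
    adjointMap E g (adjointMap E g⁻¹ x) = x := by
  simpa using adjointMap_inv_apply_apply E g⁻¹ x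

lemma differentiableAt_adjointMap_idChart_symm (g : G) :
    DifferentiableAt ℂ (fun x => adjointMap E (g * (idChart E G).symm x)) 0 :=
  (ContDiffAt.fderiv (n := ω) (m := ω) (contDiffAt_conj_idChart E id contDiffAt_id rfl g)
    contDiffAt_const le_rfl).differentiableAt (by simp)

end IdentityChart

/-! ## Left logarithmic derivatives -/

section LogDeriv

variable {E : Type*} [NormedAddCommGroup E] [NormedSpace ℂ E]
  {G : Type*} [TopologicalSpace G] [ChartedSpace E G] [Group G]
  {V : Type*} [NormedAddCommGroup V] [NormedSpace ℝ V]
  {W : Type*} [NormedAddCommGroup W] [NormedSpace ℝ W]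

/-- `γ` has left logarithmic derivative `ξ` at `t` within `s`. -/
def HasLogDerivWithinAt (γ : V → G) (ξ : V →L[ℝ] E) (s : Set V) (t : V) : Prop :=
  -- Continuity is demanded separately. Away from its source the function `idChart` takes
  -- uncontrolled values, so differentiability of the second map alone would not keep `γ τ` near `γ
  -- t`.
  ContinuousWithinAt γ s t ∧ HasFDerivWithinAt (fun τ => idChart E G ((γ t)⁻¹ * γ τ)) ξ s t

lemma HasLogDerivWithinAt.mono {γ : V → G} {ξ : V →L[ℝ] E} {s s' : Set V} {t : V}
    (h : HasLogDerivWithinAt γ ξ s t) (hs : s' ⊆ s) : HasLogDerivWithinAt γ ξ s' t :=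
  ⟨h.1.mono hs, h.2.mono hs⟩

lemma HasLogDerivWithinAt.congr_of_eventuallyEq {γ γ' : V → G} {ξ : V →L[ℝ] E} {t : V}
    (h : HasLogDerivWithinAt γ ξ univ t) (hs : γ' =ᶠ[𝓝 t] γ) :
    HasLogDerivWithinAt γ' ξ univ t := by
  refine ⟨?_, ?_⟩
  · rw [continuousWithinAt_univ]
    exact ((continuousWithinAt_univ _ _).1 h.1).congr hs.symm
  · have h2 := h.2
    rw [hasFDerivWithinAt_univ] at h2 ⊢
    refine h2.congr_of_eventuallyEq ?_
    filter_upwards [hs] with τ hτ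
    rw [hτ, hs.eq_of_nhds]

lemma HasLogDerivWithinAt.unique {γ : V → G} {ξ ξ' : V →L[ℝ] E} {t : V}
    (h : HasLogDerivWithinAt γ ξ univ t) (h' : HasLogDerivWithinAt γ ξ' univ t) : ξ = ξ' :=
  (hasFDerivWithinAt_univ.1 h.2).unique (hasFDerivWithinAt_univ.1 h'.2)

lemma HasLogDerivWithinAt.comp {γ : V → G} {ξ : V →L[ℝ] E} {s : Set V} {c : W → V}
    {c' : W →L[ℝ] V} {s' : Set W} (t : W) (h : HasLogDerivWithinAt γ ξ s (c t))
    (hc : HasFDerivWithinAt c c' s' t) (hs : MapsTo c s' s) :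
    HasLogDerivWithinAt (fun τ => γ (c τ)) (ξ.comp c') s' t :=
  ⟨h.1.comp hc.continuousWithinAt hs, HasFDerivWithinAt.comp t h.2 hc hs⟩

lemma hasLogDerivWithinAt_const (g : G) (s : Set V) (t : V) :
    HasLogDerivWithinAt (fun _ => g) (0 : V →L[ℝ] E) s t :=
  ⟨continuousWithinAt_const, hasFDerivWithinAt_const _ _ _⟩

variable [LieGroup 𝓘(ℂ, E) ω G]

lemma HasLogDerivWithinAt.const_mul {γ : V → G} {ξ : V →L[ℝ] E} {s : Set V} {t : V} (g : G)
    (h : HasLogDerivWithinAt γ ξ s t) : HasLogDerivWithinAt (fun τ => g * γ τ) ξ s t := by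
  have : IsTopologicalGroup G := topologicalGroup_of_lieGroup 𝓘(ℂ, E) ω
  refine ⟨continuousWithinAt_const.mul h.1, ?_⟩
  simpa [mul_assoc] using h.2

lemma HasLogDerivWithinAt.eventually_mem {γ : V → G} {ξ : V →L[ℝ] E} {s : Set V} {t : V}
    (h : HasLogDerivWithinAt γ ξ s t) :
    Tendsto (fun τ => (γ t)⁻¹ * γ τ) (𝓝[s] t) (𝓝 1) := by
  have : IsTopologicalGroup G := topologicalGroup_of_lieGroup 𝓘(ℂ, E) ω
  have h1 : Tendsto (fun τ => (γ t)⁻¹ * γ τ) (𝓝[s] t) (𝓝 ((γ t)⁻¹ * γ t)) :=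
    Tendsto.const_mul _ h.1
  simpa using h1

lemma hasLogDerivWithinAt_idChart_symm {x : V → E} {x' : V →L[ℝ] E} {s : Set V} {t : V}
    (hx : HasFDerivWithinAt x x' s t) (ht : x t ∈ (idChart E G).target) :
    HasLogDerivWithinAt (fun τ => (idChart E G).symm (x τ))
      (((leftCoframe E G (x t)).restrictScalars ℝ).comp x') s t :=
  ⟨((idChart E G).symm.continuousAt ht).comp_continuousWithinAt hx.continuousWithinAt,
    ((hasFDerivAt_leftCoframe E G ht).restrictScalars ℝ).comp_hasFDerivWithinAt t hx⟩

lemma HasLogDerivWithinAt.hasFDerivWithinAt_idChart {γ : V → G} {ξ : V →L[ℝ] E} {s : Set V} {t : V}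
    (h : HasLogDerivWithinAt γ ξ s t) (ht : γ t ∈ (idChart E G).source) :
    HasFDerivWithinAt (fun τ => idChart E G (γ τ))
      (((leftFrame E G (idChart E G (γ t))).restrictScalars ℝ).comp ξ) s t := by
  have h1 := (hasFDerivAt_leftFrame E G ((idChart E G).map_source ht)).restrictScalars ℝ
  have h2 : HasFDerivAt (fun y => idChart E G ((idChart E G).symm (idChart E G (γ t)) *
      (idChart E G).symm y)) ((leftFrame E G (idChart E G (γ t))).restrictScalars ℝ)
      (idChart E G ((γ t)⁻¹ * γ t)) := by simpa using h1
  refine (h2.comp_hasFDerivWithinAt t h.2).congr_of_eventuallyEq ?_ ?_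
  · filter_upwards [h.eventually_mem (idChart_source_mem_nhds E G)] with τ hτ
    have hτ' : (γ t)⁻¹ * γ τ ∈ (idChart E G).source := hτ
    simp [(idChart E G).left_inv hτ', (idChart E G).left_inv ht]
  · simp [(idChart E G).left_inv ht]

/-- Put p = γ₁(t)⁻¹γ₁(τ) and q = γ₂(t)⁻¹γ₂(τ). The increment of γ₁γ₂⁻¹ from t to τ is pq⁻¹
conjugated by γ₂(t). To first order pq⁻¹ is the difference of the two derivatives, and the
conjugation gives the adjoint factor. -/
lemma HasLogDerivWithinAt.mul_inv {γ₁ γ₂ : V → G} {ξ₁ ξ₂ : V →L[ℝ] E} {s : Set V} {t : V}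
    (h₁ : HasLogDerivWithinAt γ₁ ξ₁ s t) (h₂ : HasLogDerivWithinAt γ₂ ξ₂ s t) :
    HasLogDerivWithinAt (fun τ => γ₁ τ * (γ₂ τ)⁻¹)
      (((adjointMap E (γ₂ t)).restrictScalars ℝ).comp (ξ₁ - ξ₂)) s t := by
  have : IsTopologicalGroup G := topologicalGroup_of_lieGroup 𝓘(ℂ, E) ω
  refine ⟨h₁.1.mul h₂.1.inv, ?_⟩
  set p := fun τ => idChart E G ((γ₁ t)⁻¹ * γ₁ τ) with hp
  set q := fun τ => idChart E G ((γ₂ t)⁻¹ * γ₂ τ) with hq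
  have hpq : HasFDerivWithinAt (fun τ => (p τ, q τ)) (ξ₁.prod ξ₂) s t := h₁.2.prodMk h₂.2
  have hM : HasFDerivAt (fun p : E × E =>
      idChart E G ((idChart E G).symm p.1 * ((idChart E G).symm p.2)⁻¹))
      ((ContinuousLinearMap.fst ℂ E E - ContinuousLinearMap.snd ℂ E E).restrictScalars ℝ)
      (p t, q t) := by
    have : (p t, q t) = (0 : E × E) := by simp [hp, hq]
    rw [this]; exact (hasFDerivAt_mul_inv_idChart E G).restrictScalars ℝ
  have hA : HasFDerivAt (fun y => idChart E G (γ₂ t * (idChart E G).symm y * (γ₂ t)⁻¹))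
      ((adjointMap E (γ₂ t)).restrictScalars ℝ)
      (idChart E G ((idChart E G).symm (p t) * ((idChart E G).symm (q t))⁻¹)) := by
    have : idChart E G ((idChart E G).symm (p t) * ((idChart E G).symm (q t))⁻¹) = 0 := by
      simp [hp, hq]
    rw [this]; exact (hasFDerivAt_adjointMap E (γ₂ t)).restrictScalars ℝ
  have key := hA.comp_hasFDerivWithinAt t (HasFDerivAt.comp_hasFDerivWithinAt t hM hpq)
  have key' : HasFDerivWithinAt
      (fun τ => idChart E G (γ₂ t * (idChart E G).symm (idChart E G ((idChart E G).symm (p τ) *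
        ((idChart E G).symm (q τ))⁻¹)) * (γ₂ t)⁻¹))
      (((adjointMap E (γ₂ t)).restrictScalars ℝ).comp (ξ₁ - ξ₂)) s t :=
    key.congr_fderiv (by ext v; simp)
  have hd : Tendsto (fun τ => ((γ₁ t)⁻¹ * γ₁ τ) * ((γ₂ t)⁻¹ * γ₂ τ)⁻¹) (𝓝[s] t) (𝓝 1) := by
    simpa using h₁.eventually_mem.mul h₂.eventually_mem.inv
  refine key'.congr_of_eventuallyEq ?_ ?_
  · filter_upwards [h₁.eventually_mem (idChart_source_mem_nhds E G),
      h₂.eventually_mem (idChart_source_mem_nhds E G),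
      hd (idChart_source_mem_nhds E G)] with τ e1 e2 e3
    have e1' : (γ₁ t)⁻¹ * γ₁ τ ∈ (idChart E G).source := e1
    have e2' : (γ₂ t)⁻¹ * γ₂ τ ∈ (idChart E G).source := e2
    have e3' : ((γ₁ t)⁻¹ * γ₁ τ) * ((γ₂ t)⁻¹ * γ₂ τ)⁻¹ ∈ (idChart E G).source := e3
    simp only [hp, hq, (idChart E G).left_inv e1', (idChart E G).left_inv e2',
      (idChart E G).left_inv e3']
    congr 1
    group
  · simp [hp, hq]

/-- Write γ₁γ₂ as γ₁(1·γ₂⁻¹)⁻¹ and use the rule for quotients twice. -/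
lemma HasLogDerivWithinAt.mul {γ₁ γ₂ : V → G} {ξ₁ ξ₂ : V →L[ℝ] E} {s : Set V} {t : V}
    (h₁ : HasLogDerivWithinAt γ₁ ξ₁ s t) (h₂ : HasLogDerivWithinAt γ₂ ξ₂ s t) :
    HasLogDerivWithinAt (fun τ => γ₁ τ * γ₂ τ)
      (((adjointMap E (γ₂ t)⁻¹).restrictScalars ℝ).comp ξ₁ + ξ₂) s t := by
  have h3 := h₁.mul_inv ((hasLogDerivWithinAt_const (1 : G) s t).mul_inv h₂)
  have e : ((adjointMap E (1 * (γ₂ t)⁻¹)).restrictScalars ℝ).comp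
      (ξ₁ - ((adjointMap E (γ₂ t)).restrictScalars ℝ).comp (0 - ξ₂)) =
      ((adjointMap E (γ₂ t)⁻¹).restrictScalars ℝ).comp ξ₁ + ξ₂ := by
    ext v; simp
  rw [e] at h3
  simpa using h3

/-- A map with vanishing logarithmic derivative on a convex set is constant. -/
theorem eq_of_hasLogDerivWithinAt_zero {γ : V → G} {s : Set V} (hs : Convex ℝ s)
    (h : ∀ t ∈ s, HasLogDerivWithinAt γ (0 : V →L[ℝ] E) s t) {t₀ t₁ : V} (h₀ : t₀ ∈ s)
    (h₁ : t₁ ∈ s) : γ t₀ = γ t₁ := by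
  have : PreconnectedSpace s := isPreconnected_iff_preconnectedSpace.1 hs.isPreconnected
  -- After left translation by `(γ t)⁻¹`, nearby values lie in the chart at the identity. There an
  -- ordinary derivative vanishes on a convex set, and the mean value inequality with constant `0`
  -- applies.
  have hloc : IsLocallyConstant fun t : s => γ t := by
    rw [IsLocallyConstant.iff_eventually_eq]
    intro t
    have h1 := (h t t.2).eventually_mem (idChart_source_mem_nhds E G)
    obtain ⟨r, hr, hball⟩ := Metric.mem_nhdsWithin_iff.1 h1
    have hconv : Convex ℝ (Metric.ball (t : V) r ∩ s) := (convex_ball _ _).inter hs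
    have hd : ∀ τ ∈ Metric.ball (t : V) r ∩ s,
        HasFDerivWithinAt (fun τ => idChart E G ((γ t)⁻¹ * γ τ)) (0 : V →L[ℝ] E)
          (Metric.ball (t : V) r ∩ s) τ := by
      intro τ hτ
      have := (((h τ hτ.2).const_mul (γ t)⁻¹).hasFDerivWithinAt_idChart (hball hτ)).mono
        (inter_subset_right (s := Metric.ball (t : V) r))
      simpa using this
    have hball' : Metric.ball t r ∈ 𝓝 t := Metric.ball_mem_nhds _ hr
    filter_upwards [hball'] with τ hτ
    have hτ' : (τ : V) ∈ Metric.ball (t : V) r ∩ s := ⟨hτ, τ.2⟩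
    have h2 := hconv.norm_image_sub_le_of_norm_hasFDerivWithin_le (C := 0) hd (by simp)
      ⟨Metric.mem_ball_self hr, t.2⟩ hτ'
    have h3 : idChart E G ((γ t)⁻¹ * γ τ) = 0 := by
      rw [zero_mul, norm_le_zero_iff] at h2
      simpa using h2
    have h4 := (idChart E G).left_inv (hball hτ')
    rw [h3, idChart_symm_zero] at h4
    exact (inv_mul_eq_one.1 h4.symm).symm
  exact hloc.apply_eq_of_preconnectedSpace ⟨t₀, h₀⟩ ⟨t₁, h₁⟩

/-- Two maps with the same logarithmic derivative on a convex set which agree at one point agree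
everywhere. -/
theorem eqOn_of_hasLogDerivWithinAt {γ₁ γ₂ : V → G} {ξ : V → V →L[ℝ] E} {s : Set V}
    (hs : Convex ℝ s) (h₁ : ∀ t ∈ s, HasLogDerivWithinAt γ₁ (ξ t) s t)
    (h₂ : ∀ t ∈ s, HasLogDerivWithinAt γ₂ (ξ t) s t) {t₀ : V} (h₀ : t₀ ∈ s)
    (h : γ₁ t₀ = γ₂ t₀) : EqOn γ₁ γ₂ s := by
  intro t ht
  -- The quotient has derivative Ad(γ₂)(ξ − ξ) = 0, hence is constant.
  have h3 : ∀ t ∈ s, HasLogDerivWithinAt (fun τ => γ₁ τ * (γ₂ τ)⁻¹) (0 : V →L[ℝ] E) s t :=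
    fun t ht => by simpa using (h₁ t ht).mul_inv (h₂ t ht)
  have h4 := eq_of_hasLogDerivWithinAt_zero hs h3 ht h₀
  simp only [h, mul_inv_cancel] at h4
  exact mul_inv_eq_one.1 h4

/-! ### Holomorphic maps of one complex variable -/

/-- `F : ℂ → G` is complex differentiable at `w` and its left logarithmic derivative is `ξ dw`. -/
def HasHolLogDerivAt (F : ℂ → G) (ξ : E) (w : ℂ) : Prop :=
  HasLogDerivWithinAt F ((toSpanSingleton ℂ ξ).restrictScalars ℝ) univ w

lemma HasHolLogDerivAt.unique {F : ℂ → G} {ξ ξ' : E} {w : ℂ} (h : HasHolLogDerivAt F ξ w)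
    (h' : HasHolLogDerivAt F ξ' w) : ξ = ξ' := by
  have := DFunLike.congr_fun (HasLogDerivWithinAt.unique h h') (1 : ℂ)
  simpa using this

lemma HasHolLogDerivAt.continuousAt {F : ℂ → G} {ξ : E} {w : ℂ} (h : HasHolLogDerivAt F ξ w) :
    ContinuousAt F w := (continuousWithinAt_univ _ _).1 h.1

lemma HasHolLogDerivAt.const_mul {F : ℂ → G} {ξ : E} {w : ℂ} (h : HasHolLogDerivAt F ξ w)
    (g : G) : HasHolLogDerivAt (fun w => g * F w) ξ w :=
  HasLogDerivWithinAt.const_mul g h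

lemma HasHolLogDerivAt.mul_inv {F₁ F₂ : ℂ → G} {ξ₁ ξ₂ : E} {w : ℂ}
    (h₁ : HasHolLogDerivAt F₁ ξ₁ w) (h₂ : HasHolLogDerivAt F₂ ξ₂ w) :
    HasHolLogDerivAt (fun w => F₁ w * (F₂ w)⁻¹) (adjointMap E (F₂ w) (ξ₁ - ξ₂)) w := by
  have := HasLogDerivWithinAt.mul_inv h₁ h₂
  unfold HasHolLogDerivAt
  convert this using 1
  ext v; simp [smul_sub]

lemma HasHolLogDerivAt.mul {F₁ F₂ : ℂ → G} {ξ₁ ξ₂ : E} {w : ℂ}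
    (h₁ : HasHolLogDerivAt F₁ ξ₁ w) (h₂ : HasHolLogDerivAt F₂ ξ₂ w) :
    HasHolLogDerivAt (fun w => F₁ w * F₂ w) (adjointMap E (F₂ w)⁻¹ ξ₁ + ξ₂) w := by
  have := HasLogDerivWithinAt.mul h₁ h₂
  unfold HasHolLogDerivAt
  convert this using 1
  ext v; simp

lemma HasHolLogDerivAt.comp {F : ℂ → G} {ξ : E} {c : ℂ → ℂ} {c' w : ℂ}
    (h : HasHolLogDerivAt F ξ (c w)) (hc : HasDerivAt c c' w) :
    HasHolLogDerivAt (fun w => F (c w)) (c' • ξ) w := by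
  have := HasLogDerivWithinAt.comp w h (hc.hasFDerivAt.restrictScalars ℝ).hasFDerivWithinAt
    (mapsTo_univ _ univ)
  unfold HasHolLogDerivAt
  convert this using 1
  ext v; simp [smul_smul]

lemma HasHolLogDerivAt.comp_path {F : ℂ → G} {ξ : E} {c : ℝ → ℂ} {c' : ℂ} {s : Set ℝ} {t : ℝ}
    (h : HasHolLogDerivAt F ξ (c t)) (hc : HasDerivWithinAt c c' s t) :
    HasLogDerivWithinAt (fun t => F (c t)) (toSpanSingleton ℝ (c' • ξ)) s t := by
  have := HasLogDerivWithinAt.comp t h hc.hasFDerivWithinAt (mapsTo_univ _ _)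
  convert this using 1
  ext; simp

lemma hasHolLogDerivAt_idChart_symm {x : ℂ → E} {x' : E} {w : ℂ} (hx : HasDerivAt x x' w)
    (hw : x w ∈ (idChart E G).target) :
    HasHolLogDerivAt (fun w => (idChart E G).symm (x w)) (leftCoframe E G (x w) x') w := by
  have := hasLogDerivWithinAt_idChart_symm (G := G) (s := univ)
    (hx.hasFDerivAt.restrictScalars ℝ).hasFDerivWithinAt hw
  unfold HasHolLogDerivAt
  convert this using 1
  ext v; simp

/-- The chart expression is known to be real differentiable. Its derivative is complex linear, as
`leftFrame` is, and therefore the expression is complex differentiable. -/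
lemma HasHolLogDerivAt.hasDerivAt_idChart {F : ℂ → G} {ξ : E} {w : ℂ}
    (h : HasHolLogDerivAt F ξ w) (hw : F w ∈ (idChart E G).source) :
    HasDerivAt (fun w => idChart E G (F w)) (leftFrame E G (idChart E G (F w)) ξ) w := by
  have h1 := hasFDerivWithinAt_univ.1 (HasLogDerivWithinAt.hasFDerivWithinAt_idChart h hw)
  refine hasFDerivAt_of_restrictScalars ℝ h1 ?_
  ext v; simp

/-- The logarithmic derivative of a holomorphic map is holomorphic. -/
theorem differentiableOn_of_hasHolLogDerivAt [CompleteSpace E] {F : ℂ → G} {ξ : ℂ → E} {U : Set ℂ}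
    (hU : IsOpen U) (h : ∀ w ∈ U, HasHolLogDerivAt F (ξ w) w) : DifferentiableOn ℂ ξ U := by
  have : IsTopologicalGroup G := topologicalGroup_of_lieGroup 𝓘(ℂ, E) ω
  intro w₀ hw₀
  have hF : ContinuousOn F U := fun w hw => (h w hw).continuousAt.continuousWithinAt
  set U' := U ∩ (fun w => (F w₀)⁻¹ * F w) ⁻¹' (idChart E G).source
  have hU' : IsOpen U' :=
    (continuousOn_const.mul hF).isOpen_inter_preimage hU (idChart E G).open_source
  have hw₀' : w₀ ∈ U' := ⟨hw₀, by simpa using one_mem_idChart_source E G⟩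
  set u : ℂ → E := fun w => idChart E G ((F w₀)⁻¹ * F w) with hu
  have hud : ∀ w ∈ U', HasDerivAt u (leftFrame E G (u w) (ξ w)) w := fun w hw =>
    ((h w hw.1).const_mul (F w₀)⁻¹).hasDerivAt_idChart hw.2
  have hut : ∀ w ∈ U', u w ∈ (idChart E G).target := fun w hw => (idChart E G).map_source hw.2
  have hudiff : DifferentiableOn ℂ u U' := fun w hw =>
    (hud w hw).differentiableAt.differentiableWithinAt
  have h1 : DifferentiableOn ℂ (deriv u) U' := hudiff.deriv hU'
  have h2 : DifferentiableOn ℂ (fun w => leftCoframe E G (u w)) U' :=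
    ((contDiffOn_leftCoframe E G).differentiableOn (by simp)).comp hudiff hut
  -- Near `w₀` the coefficient `ξ` is the coframe applied to the derivative of a holomorphic
  -- function, and that derivative is again holomorphic.
  have h3 : EqOn ξ (fun w => leftCoframe E G (u w) (deriv u w)) U' := fun w hw => by
    simp only [(hud w hw).deriv]
    exact (DFunLike.congr_fun (leftCoframe_leftFrame E G (hut w hw)) (ξ w)).symm
  exact (((h2.clm_apply h1).congr h3).differentiableAt (hU'.mem_nhds hw₀')).differentiableWithinAt

lemma HasHolLogDerivAt.differentiableAt_adjointMap {F : ℂ → G} {ξ : E} {w : ℂ}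
    (h : HasHolLogDerivAt F ξ w) : DifferentiableAt ℂ (fun w => adjointMap E (F w)) w := by
  have h1 := (h.const_mul (F w)⁻¹).hasDerivAt_idChart
    (by simpa using one_mem_idChart_source E G)
  have h2 := differentiableAt_adjointMap_idChart_symm E (F w)
  have h3 : DifferentiableAt ℂ (fun x => adjointMap E (F w * (idChart E G).symm x))
      (idChart E G ((F w)⁻¹ * F w)) := by simpa using h2
  refine (h3.comp w h1.differentiableAt).congr_of_eventuallyEq ?_
  have h4 := HasLogDerivWithinAt.eventually_mem h
  rw [nhdsWithin_univ] at h4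
  filter_upwards [h4 (idChart_source_mem_nhds E G)] with τ hτ
  have hτ' : (F w)⁻¹ * F τ ∈ (idChart E G).source := hτ
  simp [(idChart E G).left_inv hτ']

end LogDeriv

section

open unitInterval

/-! ## Developments of small paths -/

section Development

variable (E : Type*) [NormedAddCommGroup E] [NormedSpace ℂ E] [CompleteSpace E]
  (G : Type*) [TopologicalSpace G] [ChartedSpace E G] [Group G] [LieGroup 𝓘(ℂ, E) ω G]

lemma exists_development_operator :
    ∃ ε > 0, ∃ S : C(I, E) → C(I, E), ContDiffOn ℂ ∞ S (Metric.ball 0 ε) ∧ S 0 = 0 ∧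
      HasFDerivAt S (volterra E) 0 ∧ ∀ β ∈ Metric.ball (0 : C(I, E)) ε,
        S β ∈ pathsIn (idChart E G).target ∧
        S β = volterra E (pointwiseApply E E (superposition (leftFrame E G) (S β)) β) :=
  exists_smooth_solution_operator (idChart E G).open_target (zero_mem_idChart_target E G)
    ((contDiffOn_leftFrame E G).of_le (by simp)) (leftFrame_zero E G)

/-- Paths of norm less than `devRadius E G` can be developed within the chart at the identity. -/
def devRadius : ℝ := (exists_development_operator E G).choose

lemma devRadius_pos : 0 < devRadius E G := (exists_development_operator E G).choose_spec.1

/-- The development of a small path in the Lie algebra, in the chart at the identity. -/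
def dev : C(I, E) → C(I, E) := (exists_development_operator E G).choose_spec.2.choose

lemma contDiffOn_dev : ContDiffOn ℂ ∞ (dev E G) (Metric.ball 0 (devRadius E G)) :=
  (exists_development_operator E G).choose_spec.2.choose_spec.1

@[simp] lemma dev_zero : dev E G 0 = 0 :=
  (exists_development_operator E G).choose_spec.2.choose_spec.2.1

lemma hasFDerivAt_dev_zero : HasFDerivAt (dev E G) (volterra E) 0 :=
  (exists_development_operator E G).choose_spec.2.choose_spec.2.2.1

variable {E}

lemma dev_mem {β : C(I, E)} (hβ : ‖β‖ < devRadius E G) (t : I) :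
    dev E G β t ∈ (idChart E G).target :=
  ((exists_development_operator E G).choose_spec.2.choose_spec.2.2.2 β
    (by rwa [mem_ball_zero_iff])).1 t

lemma hasDerivWithinAt_dev {β : C(I, E)} (hβ : ‖β‖ < devRadius E G) {t : ℝ} (ht : t ∈ Icc 0 1) :
    HasDerivWithinAt (fun t : ℝ => dev E G β (projIcc 0 1 zero_le_one t))
      (leftFrame E G (dev E G β (projIcc 0 1 zero_le_one t)) (β (projIcc 0 1 zero_le_one t)))
      (Icc 0 1) t := by
  have h1 := ((exists_development_operator E G).choose_spec.2.choose_spec.2.2.2 β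
    (by rwa [mem_ball_zero_iff])).2
  change dev E G β = volterra E (pointwiseApply E E (superposition (leftFrame E G) (dev E G β)) β)
    at h1
  have h2 := hasDerivAt_pathPrimitive
    (pointwiseApply E E (superposition (leftFrame E G) (dev E G β)) β) t
  rw [pointwiseApply_apply, superposition_apply (contDiffOn_leftFrame E G).continuousOn
    (fun t => dev_mem G hβ t)] at h2
  refine h2.hasDerivWithinAt.congr_of_mem (fun s hs => ?_) ht
  conv_lhs => rw [h1]
  rw [volterra_apply, projIcc_of_mem _ hs]

lemma dev_apply_zero {β : C(I, E)} (hβ : ‖β‖ < devRadius E G) : dev E G β 0 = 0 := by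
  have h1 := ((exists_development_operator E G).choose_spec.2.choose_spec.2.2.2 β
    (by rwa [mem_ball_zero_iff])).2
  change dev E G β = volterra E (pointwiseApply E E (superposition (leftFrame E G) (dev E G β)) β)
    at h1
  rw [h1, volterra_apply]
  simp [pathPrimitive]

lemma hasLogDerivWithinAt_dev {β : C(I, E)} (hβ : ‖β‖ < devRadius E G) {t : ℝ}
    (ht : t ∈ Icc (0 : ℝ) 1) :
    HasLogDerivWithinAt (fun t : ℝ => (idChart E G).symm (dev E G β (projIcc 0 1 zero_le_one t)))
      (toSpanSingleton ℝ (β (projIcc 0 1 zero_le_one t))) (Icc 0 1) t := by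
  have h1 := hasLogDerivWithinAt_idChart_symm (hasDerivWithinAt_dev G hβ ht).hasFDerivWithinAt
    (dev_mem G hβ _)
  convert h1 using 1
  ext
  have := DFunLike.congr_fun (leftCoframe_leftFrame E G (dev_mem G hβ (projIcc 0 1 zero_le_one t)))
    (β (projIcc 0 1 zero_le_one t))
  simpa using this.symm

/-- A path in `G` with small logarithmic derivative `β` is given by the development of `β`. -/
lemma eq_mul_dev {β : C(I, E)} (hβ : ‖β‖ < devRadius E G) {γ : ℝ → G}
    (hγ : ∀ t ∈ Icc (0 : ℝ) 1,
      HasLogDerivWithinAt γ (toSpanSingleton ℝ (β (projIcc 0 1 zero_le_one t))) (Icc 0 1) t)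
    (t : I) : γ t = γ 0 * (idChart E G).symm (dev E G β t) := by
  have h := eqOn_of_hasLogDerivWithinAt (convex_Icc (0 : ℝ) 1) hγ
    (fun t ht => (hasLogDerivWithinAt_dev G hβ ht).const_mul (γ 0)) (left_mem_Icc.2 zero_le_one)
    (by simp [dev_apply_zero G hβ])
  simpa using h t.2

/-! ### Forms along segments -/

/-- The segment from `p` to `q`. -/
def segPath (p q : ℂ) : C(I, ℂ) := ⟨fun t => p + (t : ℝ) * (q - p), by fun_prop⟩

/-- The pullback of the form `A dz` to the segment from `p` to `q`. -/
def segForm (A : ℂ → E) (p q : ℂ) : C(I, E) := (q - p) • superposition A (segPath p q)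

lemma segForm_apply {A : ℂ → E} (hA : Differentiable ℂ A) (p q : ℂ) (t : I) :
    segForm A p q t = (q - p) • A (p + (t : ℝ) * (q - p)) := by
  rw [segForm, ContinuousMap.smul_apply, superposition_apply (U := univ)
    hA.continuous.continuousOn (fun _ => mem_univ _)]
  rfl

/-- The segment depends affinely on its endpoints as an element of the space of paths, and
superposition with an entire function is differentiable. Developments along moving segments are thus
holomorphic in the endpoints. -/
lemma differentiable_segForm {A : ℂ → E} (hA : Differentiable ℂ A) {p q : ℂ → ℂ}
    (hp : Differentiable ℂ p) (hq : Differentiable ℂ q) :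
    Differentiable ℂ fun w => segForm A (p w) (q w) := by
  have h1 : Differentiable ℂ (superposition (E := ℂ) A) := fun x =>
    (hasFDerivAt_superposition isOpen_univ hA.contDiff.contDiffOn
      (fun _ => mem_univ _)).differentiableAt
  set j : C(I, ℂ) := ⟨fun t => ((t : ℝ) : ℂ), by fun_prop⟩
  have h2 : Differentiable ℂ fun w => segPath (p w) (q w) := by
    have : (fun w => segPath (p w) (q w)) =
        fun w => p w • (1 : C(I, ℂ)) + (q w - p w) • j := by
      funext w
      ext t
      simp [segPath, j, mul_comm]
    rw [this]
    exact (hp.smul_const _).add ((hq.sub hp).smul_const _)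
  exact (hq.sub hp).smul (h1.comp h2)

lemma norm_segForm_le {A : ℂ → E} (hA : Differentiable ℂ A) {p q : ℂ} {C : ℝ}
    (hC : ∀ z ∈ segment ℝ p q, ‖A z‖ ≤ C) : ‖segForm A p q‖ ≤ ‖q - p‖ * C := by
  have hC0 : 0 ≤ C := (norm_nonneg _).trans (hC p (left_mem_segment ℝ p q))
  refine (ContinuousMap.norm_le _ (by positivity)).2 fun t => ?_
  rw [segForm_apply hA, norm_smul]
  gcongr
  refine hC _ ?_
  rw [segment_eq_image']
  exact ⟨t, t.2, by simp⟩

lemma eq_mul_dev_segForm {A : ℂ → E} (hA : Differentiable ℂ A) {p q : ℂ} {F : ℂ → G}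
    (hF : ∀ z ∈ segment ℝ p q, HasHolLogDerivAt F (A z) z) (h : ‖segForm A p q‖ < devRadius E G)
    (t : I) : F (p + (t : ℝ) * (q - p)) = F p * (idChart E G).symm (dev E G (segForm A p q) t) := by
  have hc : ∀ t : ℝ, HasDerivWithinAt (fun t : ℝ => p + (t : ℂ) * (q - p)) (q - p) (Icc 0 1) t :=
    fun t => by
      simpa using ((Complex.ofRealCLM.hasDerivAt (x := t)).mul_const (q - p)
        |>.const_add p).hasDerivWithinAt
  have h1 := eq_mul_dev G h (γ := fun t : ℝ => F (p + t * (q - p))) (fun t ht => by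
    rw [segForm_apply hA, projIcc_of_mem _ ht]
    refine HasHolLogDerivAt.comp_path (hF _ ?_) (hc t)
    rw [segment_eq_image']
    exact ⟨t, ht, by simp⟩) t
  simpa using h1

/-! ### Existence of primitives -/

/-- The primitive at `w` is the endpoint of the development along the segment from `0` to `w`. It is
holomorphic in `w` because `dev` is, so its complex derivative can be read off from the radial
derivative, which the differential equation supplies. -/
lemma exists_local_primitive {A : ℂ → E} (hA : Differentiable ℂ A) :
    ∃ r > 0, ∃ F : ℂ → G, F 0 = 1 ∧ ∀ w ∈ Metric.ball (0 : ℂ) r, HasHolLogDerivAt F (A w) w := by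
  have hβ : Differentiable ℂ fun w => segForm A 0 w :=
    differentiable_segForm hA (differentiable_const _) differentiable_id
  have hβ0 : segForm A 0 0 = 0 := by ext t; simp [segForm_apply hA]
  have hev : ∀ᶠ w in 𝓝 (0 : ℂ), ‖segForm A 0 w‖ < devRadius E G := by
    have : Tendsto (fun w => ‖segForm A 0 w‖) (𝓝 0) (𝓝 ‖segForm A 0 0‖) :=
      hβ.continuous.norm.continuousAt
    rw [hβ0, norm_zero] at this
    exact this.eventually_lt_const (devRadius_pos E G)
  obtain ⟨r, hr, hball⟩ := Metric.eventually_nhds_iff_ball.1 hev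
  set x : ℂ → E := fun w => dev E G (segForm A 0 w) 1 with hx
  have hxd : DifferentiableOn ℂ x (Metric.ball 0 r) := by
    have h1 : DifferentiableOn ℂ (fun w => dev E G (segForm A 0 w)) (Metric.ball 0 r) :=
      ((contDiffOn_dev E G).differentiableOn (by simp)).comp hβ.differentiableOn
        (fun w hw => by simpa using hball w hw)
    exact (ContinuousMap.evalCLM ℂ (1 : I)).differentiable.comp_differentiableOn h1
  have hxt : ∀ w ∈ Metric.ball (0 : ℂ) r, x w ∈ (idChart E G).target := fun w hw =>
    dev_mem G (hball w hw) 1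
  -- By uniqueness, the development along the shorter segment to `t * w` is the initial part,
  -- reparametrised, of the development to `w`.
  have hscale : ∀ w ∈ Metric.ball (0 : ℂ) r, ∀ t ∈ Icc (0 : ℝ) 1,
      x (t * w) = dev E G (segForm A 0 w) (projIcc 0 1 zero_le_one t) := by
    intro w hw t ht
    have htw : (t : ℂ) * w ∈ Metric.ball (0 : ℂ) r := by
      rw [mem_ball_zero_iff] at hw ⊢
      rw [norm_mul, Complex.norm_real, Real.norm_of_nonneg ht.1]
      exact (mul_le_of_le_one_left (norm_nonneg _) ht.2).trans_lt hw
    have h1 := eq_mul_dev G (hball _ htw) (γ := fun s : ℝ => (idChart E G).symm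
      (dev E G (segForm A 0 w) (projIcc 0 1 zero_le_one (t * s)))) (fun s hs => by
        have hts : t * s ∈ Icc (0 : ℝ) 1 :=
          ⟨mul_nonneg ht.1 hs.1, mul_le_one₀ ht.2 hs.1 hs.2⟩
        have hc : HasFDerivWithinAt (fun s : ℝ => t * s) (toSpanSingleton ℝ t) (Icc 0 1) s := by
          simpa using ((hasDerivAt_id s).const_mul t).hasDerivWithinAt.hasFDerivWithinAt
        have h2 := HasLogDerivWithinAt.comp s (hasLogDerivWithinAt_dev G (hball w hw) hts) hc
          (fun s hs => ⟨mul_nonneg ht.1 hs.1, mul_le_one₀ ht.2 hs.1 hs.2⟩)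
        convert h2 using 1
        ext
        simp only [segForm_apply hA, projIcc_of_mem _ hts, projIcc_of_mem _ hs]
        simp [mul_smul, mul_assoc, mul_left_comm]) 1
    simp only [Icc.coe_one, mul_one, mul_zero] at h1
    have h3 : projIcc (0 : ℝ) 1 zero_le_one 0 = 0 := projIcc_left _
    rw [h3, dev_apply_zero G (hball w hw), idChart_symm_zero, one_mul] at h1
    have h4 := congrArg (idChart E G) h1
    rw [(idChart E G).right_inv (dev_mem G (hball w hw) _),
      (idChart E G).right_inv (dev_mem G (hball _ htw) _)] at h4
    exact h4.symm
  -- Compute the derivative of `t ↦ x (t * w)` at `t = 1` both by the chain rule and from the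
  -- differential equation, then cancel the factor `w`.
  have hne : ∀ w ∈ Metric.ball (0 : ℂ) r, w ≠ 0 → deriv x w = leftFrame E G (x w) (A w) := by
    intro w hw hw0
    have hxw : HasDerivAt x (deriv x w) w :=
      (hxd.differentiableAt (Metric.isOpen_ball.mem_nhds hw)).hasDerivAt
    have h1m : (1 : ℝ) ∈ Icc (0 : ℝ) 1 := right_mem_Icc.2 zero_le_one
    have h1 : HasDerivWithinAt (fun t : ℝ => x (t * w)) (w • deriv x w) (Icc 0 1) (1 : ℝ) := by
      have h2 : HasDerivAt (fun t : ℝ => (t : ℂ) * w) w 1 := by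
        simpa using (Complex.ofRealCLM.hasDerivAt (x := (1 : ℝ))).mul_const w
      have h3 : HasDerivAt x (deriv x w) (((1 : ℝ) : ℂ) * w) := by simpa using hxw
      exact (h3.scomp (1 : ℝ) h2).hasDerivWithinAt
    have h2 := (hasDerivWithinAt_dev G (hball w hw) h1m).congr_of_mem
      (fun t ht => hscale w hw t ht) h1m
    have h3 := (uniqueDiffOn_Icc zero_lt_one (1 : ℝ) h1m).eq_deriv _ h1 h2
    have h4 : projIcc (0 : ℝ) 1 zero_le_one 1 = 1 := projIcc_right _
    rw [h4, segForm_apply hA] at h3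
    simp only [sub_zero, Icc.coe_one, Complex.ofReal_one, one_mul, zero_add, map_smul] at h3
    exact smul_right_injective E hw0 h3
  have h0mem : (0 : ℂ) ∈ Metric.ball (0 : ℂ) r := Metric.mem_ball_self hr
  -- At `w = 0` that factor cannot be cancelled; both sides are continuous there and agree on the
  -- punctured ball.
  have hall : ∀ w ∈ Metric.ball (0 : ℂ) r, deriv x w = leftFrame E G (x w) (A w) := by
    intro w hw
    rcases eq_or_ne w 0 with rfl | hw0
    · have c1 : ContinuousAt (deriv x) 0 :=
        (hxd.deriv Metric.isOpen_ball).continuousOn.continuousAt (Metric.isOpen_ball.mem_nhds hw)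
      have c2 : ContinuousAt (fun w => leftFrame E G (x w) (A w)) 0 :=
        ((((contDiffOn_leftFrame E G).continuousOn.comp hxd.continuousOn hxt).continuousAt
          (Metric.isOpen_ball.mem_nhds hw)).clm_apply hA.continuous.continuousAt)
      refine tendsto_nhds_unique (f := deriv x) (l := 𝓝[≠] (0 : ℂ))
        (c1.tendsto.mono_left nhdsWithin_le_nhds) ((c2.tendsto.mono_left nhdsWithin_le_nhds).congr' ?_)
      filter_upwards [self_mem_nhdsWithin, nhdsWithin_le_nhds (Metric.isOpen_ball.mem_nhds hw)]
        with w hw1 hw2 using (hne w hw2 hw1).symm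
    · exact hne w hw hw0
  refine ⟨r, hr, fun w => (idChart E G).symm (x w), by simp [hx, hβ0], fun w hw => ?_⟩
  have h1 : HasDerivAt x (leftFrame E G (x w) (A w)) w := by
    rw [← hall w hw]
    exact (hxd.differentiableAt (Metric.isOpen_ball.mem_nhds hw)).hasDerivAt
  have h2 := hasHolLogDerivAt_idChart_symm h1 (hxt w hw)
  rwa [show leftCoframe E G (x w) (leftFrame E G (x w) (A w)) = A w from
    DFunLike.congr_fun (leftCoframe_leftFrame E G (hxt w hw)) (A w)] at h2

/-- The extension at `w` is `F (c * w)` times the development along the short segment from `c * w`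
to `w`. It is holomorphic with some logarithmic derivative `ξ`. Where it coincides with `F` one has
`ξ = A`, and the identity theorem carries this equality to the larger ball. -/
lemma exists_primitive_extension {A : ℂ → E} (hA : Differentiable ℂ A) {R R' c : ℝ} (hR : 0 < R)
    (hc0 : 0 < c) (hR' : c * R' ≤ R)
    (hsmall : ∀ w ∈ Metric.ball (0 : ℂ) R', ‖segForm A (c * w) w‖ < devRadius E G)
    {F : ℂ → G} (hF0 : F 0 = 1) (hF : ∀ w ∈ Metric.ball (0 : ℂ) R, HasHolLogDerivAt F (A w) w) :
    ∃ F' : ℂ → G, F' 0 = 1 ∧ ∀ w ∈ Metric.ball (0 : ℂ) R', HasHolLogDerivAt F' (A w) w := by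
  rcases le_or_gt R' 0 with hR'0 | hR'0
  · exact ⟨F, hF0, fun w hw => by
      rw [Metric.ball_eq_empty.2 hR'0] at hw; exact absurd hw (notMem_empty w)⟩
  have hcw : ∀ w ∈ Metric.ball (0 : ℂ) R', (c : ℂ) * w ∈ Metric.ball (0 : ℂ) R := by
    intro w hw
    rw [mem_ball_zero_iff] at hw ⊢
    rw [norm_mul, Complex.norm_real, Real.norm_of_nonneg hc0.le]
    exact (mul_lt_mul_of_pos_left hw hc0).trans_le hR'
  set y : ℂ → E := fun w => dev E G (segForm A (c * w) w) 1 with hy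
  have hyd : DifferentiableOn ℂ y (Metric.ball 0 R') := by
    have h1 : DifferentiableOn ℂ (fun w => dev E G (segForm A (c * w) w)) (Metric.ball 0 R') :=
      ((contDiffOn_dev E G).differentiableOn (by simp)).comp
        (differentiable_segForm hA (differentiable_id.const_mul _)
          differentiable_id).differentiableOn (fun w hw => by simpa using hsmall w hw)
    exact (ContinuousMap.evalCLM ℂ (1 : I)).differentiable.comp_differentiableOn h1
  set F' : ℂ → G := fun w => F (c * w) * (idChart E G).symm (y w) with hF'
  set ξ : ℂ → E := fun w => adjointMap E ((idChart E G).symm (y w))⁻¹ ((c : ℂ) • A (c * w)) +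
    leftCoframe E G (y w) (deriv y w)
  have hF'd : ∀ w ∈ Metric.ball (0 : ℂ) R', HasHolLogDerivAt F' (ξ w) w := by
    intro w hw
    have h1 : HasHolLogDerivAt (fun w => F (c * w)) ((c : ℂ) • A (c * w)) w :=
      (hF _ (hcw w hw)).comp (by simpa using (hasDerivAt_id w).const_mul (c : ℂ))
    exact h1.mul (hasHolLogDerivAt_idChart_symm
      (hyd.differentiableAt (Metric.isOpen_ball.mem_nhds hw)).hasDerivAt
      (dev_mem G (hsmall w hw) 1))
  have heq : ∀ w ∈ Metric.ball (0 : ℂ) R', w ∈ Metric.ball (0 : ℂ) R → F' w = F w := by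
    intro w hw hw'
    have h1 := eq_mul_dev_segForm G hA (p := c * w) (q := w) (F := F) (fun z hz => hF z
      ((convex_ball (0 : ℂ) R).segment_subset (hcw w hw) hw' hz)) (hsmall w hw) 1
    simpa using h1.symm
  refine ⟨F', ?_, fun w hw => ?_⟩
  · rw [heq 0 (Metric.mem_ball_self hR'0) (Metric.mem_ball_self hR), hF0]
  · have hξ := differentiableOn_of_hasHolLogDerivAt Metric.isOpen_ball hF'd
    have h1 : EqOn ξ A (Metric.ball 0 R') := by
      refine AnalyticOnNhd.eqOn_of_preconnected_of_eventuallyEq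
        (hξ.analyticOnNhd Metric.isOpen_ball)
        (hA.differentiableOn.analyticOnNhd Metric.isOpen_ball) (convex_ball _ _).isPreconnected
        (Metric.mem_ball_self hR'0) ?_
      filter_upwards [Metric.ball_mem_nhds (0 : ℂ) hR, Metric.ball_mem_nhds (0 : ℂ) hR'0]
        with z hz hz'
      refine (hF'd z hz').unique ?_
      refine HasLogDerivWithinAt.congr_of_eventuallyEq (hF z hz) ?_
      filter_upwards [Metric.isOpen_ball.mem_nhds hz, Metric.isOpen_ball.mem_nhds hz'] with v hv hv'
      exact heq v hv' hv
    rw [← h1 hw]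
    exact hF'd w hw

/-- A fixed ratio `1 - d` makes all connecting segments inside the ball short enough to be
developed. Each extension then enlarges the radius by the factor `1 / (1 - d)`, so finitely many
reach `R`. -/
lemma exists_primitive_on_ball {A : ℂ → E} (hA : Differentiable ℂ A) (R : ℝ) :
    ∃ F : ℂ → G, F 0 = 1 ∧ ∀ w ∈ Metric.ball (0 : ℂ) R, HasHolLogDerivAt F (A w) w := by
  rcases le_or_gt R 0 with hR | hR
  · exact ⟨1, rfl, fun w hw => by
      rw [Metric.ball_eq_empty.2 hR] at hw; exact absurd hw (notMem_empty w)⟩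
  obtain ⟨r, hr, F₀, hF₀, hF₀'⟩ := exists_local_primitive G hA
  obtain ⟨C, hC⟩ := (isCompact_closedBall (0 : ℂ) R).exists_bound_of_continuousOn
    hA.continuous.continuousOn
  have hC0 : 0 ≤ C := (norm_nonneg _).trans (hC 0 (Metric.mem_closedBall_self hR.le))
  obtain ⟨d, hd0, hd1, hd⟩ : ∃ d : ℝ, 0 < d ∧ d < 1 ∧ d * (R * C) < devRadius E G := by
    have hε := devRadius_pos E G
    -- The minimum with `1 / 2` keeps `d < 1`; the summand `1` keeps the denominator positive when
    -- `C = 0`.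
    refine ⟨min (1 / 2) (devRadius E G / (2 * (R * C + 1))), by positivity,
      (min_le_left _ _).trans_lt (by norm_num), ?_⟩
    calc _ ≤ devRadius E G / (2 * (R * C + 1)) * (R * C) := by
          gcongr; exact min_le_right _ _
      _ < devRadius E G := by
          rw [div_mul_eq_mul_div, div_lt_iff₀ (by positivity)]
          nlinarith [mul_nonneg hR.le hC0]
  have hsmall : ∀ w ∈ Metric.ball (0 : ℂ) R,
      ‖segForm A (((1 - d : ℝ) : ℂ) * w) w‖ < devRadius E G := by
    intro w hw
    have hwR : ‖w‖ < R := by simpa using hw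
    have hmem : ((1 - d : ℝ) : ℂ) * w ∈ Metric.ball (0 : ℂ) R := by
      rw [mem_ball_zero_iff, norm_mul, Complex.norm_real, Real.norm_of_nonneg (by linarith)]
      exact (mul_le_of_le_one_left (norm_nonneg _) (by linarith)).trans_lt hwR
    refine (norm_segForm_le hA (C := C) fun z hz => hC z (Metric.ball_subset_closedBall
      ((convex_ball (0 : ℂ) R).segment_subset hmem hw hz))).trans_lt (lt_of_le_of_lt ?_ hd)
    have : w - ((1 - d : ℝ) : ℂ) * w = (d : ℂ) * w := by push_cast; ring
    rw [this, norm_mul, Complex.norm_real, Real.norm_of_nonneg hd0.le, mul_assoc]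
    gcongr
  have hstep : ∀ n : ℕ, ∃ F : ℂ → G, F 0 = 1 ∧
      ∀ w ∈ Metric.ball (0 : ℂ) (min (r / (1 - d) ^ n) R), HasHolLogDerivAt F (A w) w := by
    intro n
    have hd' : 0 < 1 - d := by linarith
    induction n with
    | zero => exact ⟨F₀, hF₀, fun w hw => hF₀' w
        (Metric.ball_subset_ball (by simp) hw)⟩
    | succ n ih =>
      obtain ⟨F, hF0, hF⟩ := ih
      refine exists_primitive_extension G hA (c := 1 - d) (by positivity) hd' ?_
        (fun w hw => hsmall w (Metric.ball_subset_ball (min_le_right _ _) hw)) hF0 hF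
      refine le_min ?_ ?_
      · calc (1 - d) * min (r / (1 - d) ^ (n + 1)) R ≤ (1 - d) * (r / (1 - d) ^ (n + 1)) := by
              gcongr; exact min_le_left _ _
          _ = r / (1 - d) ^ n := by field_simp; ring
      · calc (1 - d) * min (r / (1 - d) ^ (n + 1)) R ≤ 1 * R := by
              gcongr
              · linarith
              · exact min_le_right _ _
          _ = R := one_mul R
  obtain ⟨n, hn⟩ : ∃ n : ℕ, (1 - d) ^ n < r / R :=
    exists_pow_lt_of_lt_one (by positivity) (by linarith)
  obtain ⟨F, hF0, hF⟩ := hstep n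
  refine ⟨F, hF0, fun w hw => hF w ?_⟩
  have hd' : 0 < (1 - d) ^ n := pow_pos (by linarith) n
  rwa [min_eq_right]
  rw [le_div_iff₀ hd', mul_comm]
  exact ((lt_div_iff₀ hR).1 hn).le

/-- Every entire form `A dw` has a primitive `F : ℂ → G`, `F⁻¹ dF = A dw`, with `F 0 = 1`. -/
theorem exists_primitive {A : ℂ → E} (hA : Differentiable ℂ A) :
    ∃ F : ℂ → G, F 0 = 1 ∧ ∀ w, HasHolLogDerivAt F (A w) w := by
  choose F hF0 hF using fun n : ℕ => exists_primitive_on_ball G hA (n + 1)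
  have hagree : ∀ m n : ℕ, m ≤ n → ∀ w ∈ Metric.ball (0 : ℂ) (m + 1), F n w = F m w := by
    intro m n hmn
    have hsub : Metric.ball (0 : ℂ) ((m : ℝ) + 1) ⊆ Metric.ball 0 (n + 1) :=
      Metric.ball_subset_ball (by gcongr)
    exact eqOn_of_hasLogDerivWithinAt (convex_ball (0 : ℂ) ((m : ℝ) + 1))
      (fun w hw => HasLogDerivWithinAt.mono (hF n w (hsub hw)) (subset_univ _))
      (fun w hw => HasLogDerivWithinAt.mono (hF m w hw) (subset_univ _))
      (Metric.mem_ball_self (by positivity)) (by rw [hF0, hF0])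
  -- The primitives on the balls of radius `n + 1` agree on overlaps. Near `w` the glued function
  -- therefore equals the single primitive with index `⌊‖w‖⌋₊`, even where the floor of the norm
  -- jumps.
  refine ⟨fun w => F ⌊‖w‖⌋₊ w, by simp [hF0], fun w => ?_⟩
  have hw : w ∈ Metric.ball (0 : ℂ) ((⌊‖w‖⌋₊ : ℝ) + 1) := by
    simpa using Nat.lt_floor_add_one ‖w‖
  refine HasLogDerivWithinAt.congr_of_eventuallyEq (hF _ w hw) ?_
  filter_upwards [Metric.isOpen_ball.mem_nhds hw] with z hz
  have hz' : ‖z‖ < (⌊‖w‖⌋₊ : ℝ) + 1 := by simpa using hz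
  have hle : ⌊‖z‖⌋₊ ≤ ⌊‖w‖⌋₊ := by
    rw [← Nat.lt_succ_iff, Nat.floor_lt (norm_nonneg _)]
    exact_mod_cast hz'
  exact (hagree _ _ hle z (by simpa using Nat.lt_floor_add_one ‖z‖)).symm

end Development

end

/-! ## Logarithmic derivatives and manifold derivatives -/

section Bridge

/-- The unit of `ℂ` with value `z`, for `z ≠ 0`. -/
def unitOf (z : ℂ) : ℂˣ := if h : z = 0 then 1 else Units.mk0 z h

@[simp] lemma unitOf_val (u : ℂˣ) : unitOf (u : ℂ) = u := by
  ext; simp [unitOf]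

lemma val_unitOf {z : ℂ} (hz : z ≠ 0) : (unitOf z : ℂ) = z := by simp [unitOf, hz]

lemma chartAt_units_symm {z : ℂ} (hz : z ≠ 0) (u : ℂˣ) : (chartAt ℂ u).symm z = unitOf z := by
  have h := (chartAt ℂ u).left_inv (x := unitOf z) (by rw [Units.chartAt_source]; trivial)
  rwa [Units.chartAt_apply, val_unitOf hz] at h

lemma continuousAt_unitOf {z : ℂ} (hz : z ≠ 0) : ContinuousAt unitOf z := by
  have h := (chartAt ℂ (unitOf z)).continuousAt_symm (x := z)
    (by simpa [Units.chartAt_apply, val_unitOf hz] using mem_chart_target ℂ (unitOf z))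
  refine h.congr ?_
  filter_upwards [isOpen_ne.mem_nhds hz] with y hy using chartAt_units_symm hy _

variable {E : Type*} [NormedAddCommGroup E] [NormedSpace ℂ E]
  {M : Type*} [TopologicalSpace M] [ChartedSpace E M]

lemma continuousAt_comp_unitOf_iff {f : ℂˣ → M} {u : ℂˣ} :
    ContinuousAt (fun z => f (unitOf z)) (u : ℂ) ↔ ContinuousAt f u := by
  constructor
  · intro h
    have := ContinuousAt.comp (f := ((↑) : ℂˣ → ℂ)) h Units.continuous_val.continuousAt
    simpa [Function.comp_def] using this
  · intro h
    have h1 : ContinuousAt f (unitOf (u : ℂ)) := by simpa using h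
    exact ContinuousAt.comp h1 (continuousAt_unitOf u.ne_zero)

lemma hasMFDerivAt_iff_chartAt {𝕜 V M N F : Type*} [NontriviallyNormedField 𝕜]
    [NormedAddCommGroup V] [NormedSpace 𝕜 V] [NormedAddCommGroup F] [NormedSpace 𝕜 F]
    [TopologicalSpace M] [ChartedSpace V M] [TopologicalSpace N] [ChartedSpace F N]
    {f : M → N} {x : M} {D : V →L[𝕜] F} :
    HasMFDerivAt 𝓘(𝕜, V) 𝓘(𝕜, F) f x D ↔ ContinuousAt f x ∧
      HasFDerivAt (fun y => chartAt F (f x) (f ((chartAt V x).symm y))) D (chartAt V x x) := by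
  rw [← hasFDerivWithinAt_univ, ← (range_id : range (id : V → V) = univ)]
  rfl

lemma hasMFDerivAt_units_iff {f : ℂˣ → M} {u : ℂˣ} {D : ℂ →L[ℂ] E} :
    HasMFDerivAt 𝓘(ℂ, ℂ) 𝓘(ℂ, E) f u D ↔
      ContinuousAt f u ∧ HasFDerivAt (fun z => chartAt E (f u) (f (unitOf z))) D (u : ℂ) := by
  refine hasMFDerivAt_iff_chartAt.trans (and_congr Iff.rfl ?_)
  have e : (fun y => chartAt E (f u) (f ((chartAt ℂ u).symm y))) =ᶠ[𝓝 (u : ℂ)]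
      fun z => chartAt E (f u) (f (unitOf z)) := by
    filter_upwards [isOpen_ne.mem_nhds u.ne_zero] with y hy
    rw [chartAt_units_symm hy]
  rw [Units.chartAt_apply]
  exact e.hasFDerivAt_iff

lemma mdifferentiable_units_iff {f : ℂˣ → E} :
    MDifferentiable 𝓘(ℂ, ℂ) 𝓘(ℂ, E) f ↔ DifferentiableOn ℂ (fun z => f (unitOf z)) {0}ᶜ := by
  constructor
  · intro h z hz
    have h1 := (hasMFDerivAt_units_iff.1 (h (unitOf z)).hasMFDerivAt).2
    rw [val_unitOf hz] at h1
    exact h1.differentiableAt.differentiableWithinAt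
  · intro h u
    have hu : (u : ℂ) ∈ ({0}ᶜ : Set ℂ) := u.ne_zero
    have h1 := h.differentiableAt (isOpen_compl_singleton.mem_nhds hu)
    exact (hasMFDerivAt_units_iff.2 ⟨continuousAt_comp_unitOf_iff.1 h1.continuousAt,
      h1.hasFDerivAt⟩).mdifferentiableAt

variable {G : Type*} [TopologicalSpace G] [ChartedSpace E G] [Group G] [LieGroup 𝓘(ℂ, E) ω G]

variable (E) in
lemma mdifferentiable_const_mul (g : G) : MDifferentiable 𝓘(ℂ, E) 𝓘(ℂ, E) fun x : G => g * x :=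
  (contMDiff_mul_left (I := 𝓘(ℂ, E)) (n := ω) (a := g)).mdifferentiable (by simp)

variable (E) in
/-- The tangent map at `g` of the left translation by `g⁻¹`. -/
def leftTangent (g : G) : E →L[ℂ] E :=
  mfderiv 𝓘(ℂ, E) 𝓘(ℂ, E) (fun x : G => g⁻¹ * x) g

variable (E) in
/-- The tangent map at `1` of the left translation by `g`. -/
def leftTangentInv (g : G) : E →L[ℂ] E :=
  mfderiv 𝓘(ℂ, E) 𝓘(ℂ, E) (fun x : G => g * x) 1

lemma hasFDerivAt_leftTangent (g : G) :
    HasFDerivAt (fun y => idChart E G (g⁻¹ * (chartAt E g).symm y)) (leftTangent E g)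
      (chartAt E g g) := by
  have h := (hasMFDerivAt_iff_chartAt (D := leftTangent E g).1
    ((mdifferentiable_const_mul E g⁻¹) g).hasMFDerivAt).2
  rw [inv_mul_cancel] at h
  simpa only [idChart_apply] using h.sub_const (chartAt E (1 : G) 1)

lemma hasFDerivAt_leftTangentInv (g : G) :
    HasFDerivAt (fun y => chartAt E g (g * (idChart E G).symm y)) (leftTangentInv E g) 0 := by
  have h := (hasMFDerivAt_iff_chartAt (D := leftTangentInv E g).1
    ((mdifferentiable_const_mul E g) 1).hasMFDerivAt).2
  rw [mul_one] at h
  have h2 : HasFDerivAt (fun y => chartAt E g (g * (chartAt E (1 : G)).symm y))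
    (leftTangentInv E g) (0 + chartAt E (1 : G) 1) := by
      rw [zero_add]; exact h
  have h3 := h2.comp (0 : E) ((hasFDerivAt_id (0 : E)).add_const (chartAt E (1 : G) 1))
  simpa [Function.comp_def, ← idChart_symm_apply] using h3

/-- Chain rule for g⁻¹(gy) = y, now mixing the preferred chart at `g` with the chart at the
identity. -/
lemma leftTangent_leftTangentInv (g : G) (x : E) :
    leftTangent E g (leftTangentInv E g x) = x := by
  have : IsTopologicalGroup G := topologicalGroup_of_lieGroup 𝓘(ℂ, E) ω
  have h1 := hasFDerivAt_leftTangentInv (E := E) g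
  have h2 : HasFDerivAt (fun y => idChart E G (g⁻¹ * (chartAt E g).symm y)) (leftTangent E g)
      (chartAt E g (g * (idChart E G).symm 0)) := by simpa using hasFDerivAt_leftTangent (E := E) g
  have h3 := (h2.comp (0 : E) h1).unique ((hasFDerivAt_id (0 : E)).congr_of_eventuallyEq ?_)
  · exact DFunLike.congr_fun h3 x
  have h4 : Tendsto (fun y => g * (idChart E G).symm y) (𝓝 0) (𝓝 g) := by
    simpa using (tendsto_idChart_symm E G).const_mul g
  filter_upwards [h4 (chart_source_mem_nhds E g), idChart_target_mem_nhds E G] with y hy hy'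
  have hy2 : g * (idChart E G).symm y ∈ (chartAt E g).source := hy
  simp [(chartAt E g).left_inv hy2, (idChart E G).right_inv hy']

variable {V : Type*} [NormedAddCommGroup V] [NormedSpace ℝ V]

lemma hasLogDerivWithinAt_of_chartAt {γ : V → G} {D : V →L[ℝ] E} {t : V} (hc : ContinuousAt γ t)
    (h : HasFDerivAt (fun τ => chartAt E (γ t) (γ τ)) D t) :
    HasLogDerivWithinAt γ (((leftTangent E (γ t)).restrictScalars ℝ).comp D) univ t := by
  refine ⟨hc.continuousWithinAt, hasFDerivWithinAt_univ.2 ?_⟩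
  refine (((hasFDerivAt_leftTangent (γ t)).restrictScalars ℝ).comp t h).congr_of_eventuallyEq ?_
  filter_upwards [hc (chart_source_mem_nhds E (γ t))] with τ hτ
  have hτ' : γ τ ∈ (chartAt E (γ t)).source := hτ
  simp [(chartAt E (γ t)).left_inv hτ']

lemma HasLogDerivWithinAt.hasFDerivAt_chartAt {γ : V → G} {ξ : V →L[ℝ] E} {t : V}
    (h : HasLogDerivWithinAt γ ξ univ t) :
    HasFDerivAt (fun τ => chartAt E (γ t) (γ τ))
      (((leftTangentInv E (γ t)).restrictScalars ℝ).comp ξ) t := by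
  have h1 : HasFDerivAt (fun y => chartAt E (γ t) (γ t * (idChart E G).symm y))
      ((leftTangentInv E (γ t)).restrictScalars ℝ) (idChart E G ((γ t)⁻¹ * γ t)) := by
    simpa using (hasFDerivAt_leftTangentInv (E := E) (γ t)).restrictScalars ℝ
  refine (h1.comp t (hasFDerivWithinAt_univ.1 h.2)).congr_of_eventuallyEq ?_
  have h2 := h.eventually_mem
  rw [nhdsWithin_univ] at h2
  filter_upwards [h2 (idChart_source_mem_nhds E G)] with τ hτ
  have hτ' : (γ t)⁻¹ * γ τ ∈ (idChart E G).source := hτ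
  simp [(idChart E G).left_inv hτ']

/-- Moves the manifold derivative in `IsDevelopment` to the identity chart. The invariant vector
field is `leftTangentInv` by definition, and `leftTangent` undoes it. -/
lemma isDevelopment_iff {α : HolForm E} {c : ℝ → ℂˣ} {γ : ℝ → G} :
    IsDevelopment α c γ ↔ ∀ t, HasLogDerivWithinAt γ
      (toSpanSingleton ℝ (deriv (fun s : ℝ => (c s : ℂ)) t • α (c t))) univ t := by
  refine forall_congr' fun t => ?_
  set x : E := deriv (fun s : ℝ => (c s : ℂ)) t • α (c t)
  have key : HasMFDerivAt 𝓘(ℝ, ℝ) 𝓘(ℝ, E) γ t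
      (toSpanSingleton ℝ (leftTangentInv E (γ t) x) : ℝ →L[ℝ] E) ↔
      ContinuousAt γ t ∧ HasFDerivAt (fun τ => chartAt E (γ t) (γ τ))
        (toSpanSingleton ℝ (leftTangentInv E (γ t) x)) t := hasMFDerivAt_iff_chartAt
  refine key.trans ⟨fun h => ?_, fun h => ⟨(continuousWithinAt_univ _ _).1 h.1, ?_⟩⟩
  · have h1 := hasLogDerivWithinAt_of_chartAt h.1 h.2
    have e : ((leftTangent E (γ t)).restrictScalars ℝ).comp
        (toSpanSingleton ℝ (leftTangentInv E (γ t) x)) = toSpanSingleton ℝ x := by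
      ext
      simp [leftTangent_leftTangentInv]
    rwa [e] at h1
  · have h1 := h.hasFDerivAt_chartAt
    have e : ((leftTangentInv E (γ t)).restrictScalars ℝ).comp (toSpanSingleton ℝ x) =
        toSpanSingleton ℝ (leftTangentInv E (γ t) x) := by
      ext
      simp
    rwa [e] at h1

lemma HolLoopGroup.hasHolLogDerivAt (f : HolLoopGroup E G) {z : ℂ} (hz : z ≠ 0) :
    HasHolLogDerivAt (fun z => f (unitOf z)) (leftLogDeriv f (unitOf z)) z := by
  set D : ℂ →L[ℂ] E := mfderiv 𝓘(ℂ, ℂ) 𝓘(ℂ, E) f (unitOf z) with hD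
  obtain ⟨h1, h2⟩ := (hasMFDerivAt_units_iff (D := D)).1 (f.2 (unitOf z)).hasMFDerivAt
  have h1' := continuousAt_comp_unitOf_iff.2 h1
  rw [val_unitOf hz] at h1' h2
  have h3 := hasLogDerivWithinAt_of_chartAt (γ := fun z => f (unitOf z)) h1'
    (h2.restrictScalars ℝ)
  unfold HasHolLogDerivAt
  convert h3 using 1
  refine ContinuousLinearMap.ext fun v => ?_
  have e : leftLogDeriv f (unitOf z) = leftTangent E (f (unitOf z)) (D 1) := rfl
  have : D v = v • D 1 := by rw [← map_smul, smul_eq_mul, mul_one]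
  simp [e, this]

lemma mdifferentiable_of_hasHolLogDerivAt {f : ℂˣ → G}
    (h : ∀ z : ℂ, z ≠ 0 → ∃ ξ : E, HasHolLogDerivAt (fun z => f (unitOf z)) ξ z) :
    MDifferentiable 𝓘(ℂ, ℂ) 𝓘(ℂ, E) f := by
  intro u
  obtain ⟨ξ, hξ⟩ := h u u.ne_zero
  have h1 := HasLogDerivWithinAt.hasFDerivAt_chartAt hξ
  simp only [unitOf_val] at h1
  have h2 : HasFDerivAt (fun z => chartAt E (f u) (f (unitOf z)))
      ((leftTangentInv E (f u)).comp (toSpanSingleton ℂ ξ)) (u : ℂ) :=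
    hasFDerivAt_of_restrictScalars ℝ h1 (by ext v; simp)
  exact (hasMFDerivAt_units_iff.2 ⟨continuousAt_comp_unitOf_iff.1 hξ.continuousAt,
    h2⟩).mdifferentiableAt

end Bridge

/-! ## The graded Fréchet space `Ω¹(ℂ*, E)` -/

section GradedFrechet

lemma gnorm_nonneg {F : Type*} [AddCommGroup F] [Module ℝ F] [Grading F] (n : ℕ) (f : F) :
    0 ≤ gnorm n f := apply_nonneg (Grading.seminorm (F := F) n) f

lemma gnorm_mono {F : Type*} [AddCommGroup F] [Module ℝ F] [Grading F] {m n : ℕ} (h : m ≤ n)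
    (f : F) : gnorm m f ≤ gnorm n f := Grading.mono (F := F) h f

lemma gnorm_add_le {F : Type*} [AddCommGroup F] [Module ℝ F] [Grading F] (n : ℕ) (f g : F) :
    gnorm n (f + g) ≤ gnorm n f + gnorm n g := map_add_le_add (Grading.seminorm (F := F) n) f g

lemma gnorm_prod {F G : Type*} [AddCommGroup F] [Module ℝ F] [Grading F]
    [AddCommGroup G] [Module ℝ G] [Grading G] (n : ℕ) (x : F × G) :
    gnorm n x = gnorm n x.1 + gnorm n x.2 := rfl

lemma gnorm_submodule {F : Type*} [AddCommGroup F] [Module ℝ F] [Grading F]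
    (K : Submodule ℝ F) (n : ℕ) (x : K) : gnorm n x = gnorm n (x : F) := rfl

variable {E : Type*} [NormedAddCommGroup E] [NormedSpace ℂ E]

@[ext] lemma HolForm.ext {α β : HolForm E} (h : ∀ u : ℂˣ, α u = β u) : α = β :=
  Subtype.ext (funext h)

@[simp] lemma HolForm.add_apply (α β : HolForm E) (u : ℂˣ) : (α + β) u = α u + β u := rfl
@[simp] lemma HolForm.sub_apply (α β : HolForm E) (u : ℂˣ) : (α - β) u = α u - β u := rfl
@[simp] lemma HolForm.zero_apply (u : ℂˣ) : (0 : HolForm E) u = 0 := rfl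
@[simp] lemma HolForm.smul_apply (c : ℝ) (α : HolForm E) (u : ℂˣ) : (c • α) u = c • α u := rfl

/-- The form `h dz`. -/
def HolForm.ofFun (h : ℂ → E) (hh : DifferentiableOn ℂ h {0}ᶜ) : HolForm E :=
  ⟨fun u => h u, mdifferentiable_units_iff.2 (hh.congr fun z hz => by rw [val_unitOf hz])⟩

@[simp] lemma HolForm.ofFun_apply (h : ℂ → E) (hh : DifferentiableOn ℂ h {0}ᶜ) (u : ℂˣ) :
    HolForm.ofFun h hh u = h u := rfl

lemma HolForm.differentiableOn (α : HolForm E) :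
    DifferentiableOn ℂ (fun z => α (unitOf z)) {0}ᶜ := mdifferentiable_units_iff.1 α.2

lemma HolForm.continuousOn (α : HolForm E) : ContinuousOn (fun z => α (unitOf z)) {0}ᶜ :=
  α.differentiableOn.continuousOn

lemma HolForm.norm_le_gnorm (α : HolForm E) {n : ℕ} {u : ℂˣ} (hu : u ∈ annulus n) :
    ‖α u‖ ≤ gnorm n α := le_ciSup (α.bddAbove n) ⟨u, hu⟩

lemma HolForm.gnorm_le {α : HolForm E} {n : ℕ} {C : ℝ} (h : ∀ u ∈ annulus n, ‖α u‖ ≤ C) :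
    gnorm n α ≤ C := by
  have : Nonempty (annulus n) := (annulus_nonempty n).to_subtype
  exact ciSup_le fun z : annulus n => h z z.2

/-- The continuous function |log |u|| is bounded on a compact set, so the annuli exhaust ℂ*. -/
lemma exists_subset_annulus {K : Set ℂˣ} (hK : IsCompact K) : ∃ n, K ⊆ annulus n := by
  have hc : Continuous fun u : ℂˣ => |Real.log ‖(u : ℂ)‖| :=
    (Continuous.log (Units.continuous_val.norm) fun u => norm_ne_zero_iff.2 u.ne_zero).abs
  obtain ⟨C, hC⟩ := (hK.image hc).bddAbove
  obtain ⟨n, hn⟩ := exists_nat_ge C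
  refine ⟨n, fun u hu => ?_⟩
  have h1 : |Real.log ‖(u : ℂ)‖| ≤ n := (hC (mem_image_of_mem _ hu)).trans hn
  have h2 : 0 < ‖(u : ℂ)‖ := norm_pos_iff.2 u.ne_zero
  exact ⟨(Real.le_log_iff_exp_le h2).1 (abs_le.1 h1).1, (Real.log_le_iff_le_exp h2).1 (abs_le.1 h1).2⟩

variable (E) in
/-- The inclusion of `Ω¹(ℂ*, E)` into the space of continuous maps. -/
def HolForm.toContinuousMap : HolForm E →ₗ[ℝ] C(ℂˣ, E) where
  toFun α := ⟨α, α.continuous⟩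
  map_add' _ _ := rfl
  map_smul' _ _ := rfl

variable (E) in
lemma HolForm.isInducing_toContinuousMap : IsInducing (HolForm.toContinuousMap E) := ⟨rfl⟩

instance : IsTopologicalAddGroup (HolForm E) :=
  topologicalAddGroup_induced (HolForm.toContinuousMap E)

instance : ContinuousSMul ℝ (HolForm E) :=
  (HolForm.isInducing_toContinuousMap E).continuousSMul continuous_id (map_smul _ _ _)

/-- Annuli are compact and every compact set lies in one of them, so uniform convergence on compact
sets is convergence in all seminorms of the grading. -/
lemma HolForm.tendsto_zero_iff {l : Filter (HolForm E)} :
    Tendsto id l (𝓝 (0 : HolForm E)) ↔ ∀ n, Tendsto (gnorm (F := HolForm E) n) l (𝓝 0) := by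
  have h0 : HolForm.toContinuousMap E 0 = 0 := map_zero _
  rw [(HolForm.isInducing_toContinuousMap E).tendsto_nhds_iff, h0,
    ContinuousMap.tendsto_iff_forall_isCompact_tendstoUniformlyOn]
  constructor
  · intro h n
    have h1 := h _ (isCompact_annulus n)
    rw [Metric.tendstoUniformlyOn_iff] at h1
    rw [Metric.tendsto_nhds]
    intro ε hε
    filter_upwards [h1 (ε / 2) (by positivity)] with α hα
    rw [dist_zero_right, Real.norm_of_nonneg (gnorm_nonneg n α)]
    refine (HolForm.gnorm_le fun u hu => ?_).trans_lt (half_lt_self hε)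
    have := hα u hu
    simp only [ContinuousMap.zero_apply, dist_zero_left] at this
    exact this.le
  · intro h K hK
    obtain ⟨n, hn⟩ := exists_subset_annulus hK
    rw [Metric.tendstoUniformlyOn_iff]
    intro ε hε
    filter_upwards [(Metric.tendsto_nhds.1 (h n)) ε hε] with α hα u hu
    rw [dist_zero_right, Real.norm_of_nonneg (gnorm_nonneg n α)] at hα
    simp only [ContinuousMap.zero_apply, dist_zero_left]
    exact (α.norm_le_gnorm (hn hu)).trans_lt hα

lemma HolForm.withSeminorms : WithSeminorms (Grading.seminorm (F := HolForm E)) := by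
  rw [SeminormFamily.withSeminorms_iff_nhds_eq_iInf]
  refine le_antisymm (le_iInf fun n => ?_) ?_
  · exact tendsto_iff_comap.1 (HolForm.tendsto_zero_iff.1 tendsto_id n)
  · refine HolForm.tendsto_zero_iff.2 fun n => ?_
    exact tendsto_iff_comap.2 (iInf_le _ n)

lemma HolForm.tendsto_nhds_iff {ι : Type*} {l : Filter ι} {u : ι → HolForm E} {α : HolForm E} :
    Tendsto u l (𝓝 α) ↔ ∀ n, Tendsto (fun i => gnorm n (u i - α)) l (𝓝 0) := by
  rw [tendsto_sub_nhds_zero_iff.symm]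
  have := HolForm.tendsto_zero_iff (l := l.map fun i => u i - α)
  simpa only [tendsto_map'_iff, Function.comp_def, id] using this

variable (E) in
lemma HolForm.t2Space : T2Space (HolForm E) := by
  have hinj : Function.Injective (HolForm.toContinuousMap E) := fun α β h =>
    HolForm.ext fun u => DFunLike.congr_fun h u
  exact T2Space.of_injective_continuous hinj (HolForm.isInducing_toContinuousMap E).continuous

variable (E) in
lemma isGradedFrechetSpace_holForm [CompleteSpace E] : IsGradedFrechetSpace (HolForm E) := by
  refine ⟨HolForm.withSeminorms, HolForm.t2Space E, fun u hu => ?_⟩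
  have hpt : ∀ z : ℂˣ, ∃ l : E, Tendsto (fun i => u i z) atTop (𝓝 l) := by
    intro z
    obtain ⟨n, hn⟩ := exists_subset_annulus (isCompact_singleton (x := z))
    refine cauchySeq_tendsto_of_complete (Metric.cauchySeq_iff.2 fun ε hε => ?_)
    obtain ⟨N, hN⟩ := hu n ε hε
    refine ⟨N, fun i hi j hj => ?_⟩
    rw [dist_eq_norm]
    exact ((u i - u j).norm_le_gnorm (hn rfl)).trans_lt (hN i hi j hj)
  choose f hf using hpt
  -- Letting `j` tend to infinity in the Cauchy estimate turns pointwise limits into uniform ones on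
  -- each annulus.
  have hunif : ∀ n : ℕ, ∀ ε > 0, ∃ N : ℕ, ∀ i ≥ N, ∀ z ∈ annulus n, ‖u i z - f z‖ ≤ ε := by
    intro n ε hε
    obtain ⟨N, hN⟩ := hu n ε hε
    refine ⟨N, fun i hi z hz => ?_⟩
    refine le_of_tendsto (((tendsto_const_nhds (x := u i z)).sub (hf z)).norm) ?_
    filter_upwards [eventually_ge_atTop N] with j hj
    exact ((u i - u j).norm_le_gnorm hz).trans (hN i hi j hj).le
  have hlu : TendstoLocallyUniformlyOn (fun i z => u i (unitOf z)) (fun z => f (unitOf z))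
      atTop {0}ᶜ := by
    rw [tendstoLocallyUniformlyOn_iff_forall_isCompact isOpen_compl_singleton]
    intro K hK0 hK
    have hKc : IsCompact (unitOf '' K) := hK.image_of_continuousOn fun z hz =>
      (continuousAt_unitOf (hK0 hz)).continuousWithinAt
    obtain ⟨n, hn⟩ := exists_subset_annulus hKc
    rw [Metric.tendstoUniformlyOn_iff]
    intro ε hε
    obtain ⟨N, hN⟩ := hunif n (ε / 2) (by positivity)
    filter_upwards [eventually_ge_atTop N] with i hi z hz
    rw [dist_comm, dist_eq_norm]
    exact (hN i hi _ (hn (mem_image_of_mem _ hz))).trans_lt (half_lt_self hε)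
  -- Weierstrass: a locally uniform limit of holomorphic functions is holomorphic.
  have hd := hlu.differentiableOn (Eventually.of_forall fun i => (u i).differentiableOn)
    isOpen_compl_singleton
  refine ⟨HolForm.ofFun _ hd, HolForm.tendsto_nhds_iff.2 fun n => ?_⟩
  rw [Metric.tendsto_atTop]
  intro ε hε
  obtain ⟨N, hN⟩ := hunif n (ε / 2) (by positivity)
  refine ⟨N, fun i hi => ?_⟩
  rw [dist_zero_right, Real.norm_of_nonneg (gnorm_nonneg _ _)]
  refine (HolForm.gnorm_le fun z hz => ?_).trans_lt (half_lt_self hε)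
  simpa using hN i hi z hz

lemma continuous_of_gnorm_le {F F' : Type*} [AddCommGroup F] [Module ℝ F] [TopologicalSpace F]
    [Grading F] [AddCommGroup F'] [Module ℝ F'] [TopologicalSpace F'] [Grading F']
    (hF : WithSeminorms (Grading.seminorm (F := F)))
    (hF' : WithSeminorms (Grading.seminorm (F := F'))) (L : F →ₗ[ℝ] F')
    (h : ∀ n, ∃ (m : ℕ) (C : ℝ), ∀ x, gnorm n (L x) ≤ C * gnorm m x) : Continuous L := by
  refine WithSeminorms.continuous_of_isBounded hF hF' L fun n => ?_
  obtain ⟨m, C, h⟩ := h n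
  refine ⟨{m}, ⟨|C|, abs_nonneg C⟩, fun x => ?_⟩
  rw [Finset.sup_singleton]
  exact (h x).trans (mul_le_mul_of_nonneg_right (le_abs_self C) (gnorm_nonneg m x))

end GradedFrechet

open Complex (I)
open scoped Real

/-! ## Laurent series and tameness of `Ω¹(ℂ*, E)` -/

section Tame

lemma IsTameLinear.comp {F G H : Type*} [AddCommGroup F] [Module ℝ F] [Grading F]
    [AddCommGroup G] [Module ℝ G] [Grading G] [AddCommGroup H] [Module ℝ H] [Grading H]
    {ψ : G →ₗ[ℝ] H} {φ : F →ₗ[ℝ] G} (hψ : IsTameLinear ψ) (hφ : IsTameLinear φ) :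
    IsTameLinear (ψ.comp φ) := by
  obtain ⟨r, b, C, h⟩ := hψ
  obtain ⟨r', b', C', h'⟩ := hφ
  refine ⟨r + r', max b b', fun n => |C n| * C' (n + r), fun n hn f => ?_⟩
  have h1 := h n (le_trans (le_max_left _ _) hn) (φ f)
  have h2 := h' (n + r) (le_trans (le_trans (le_max_right _ _) hn) (Nat.le_add_right _ _)) f
  rw [LinearMap.comp_apply]
  calc gnorm n (ψ (φ f)) ≤ |C n| * gnorm (n + r) (φ f) :=
        h1.trans (mul_le_mul_of_nonneg_right (le_abs_self _) (gnorm_nonneg _ _))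
    _ ≤ |C n| * (C' (n + r) * gnorm (n + r + r') f) := by gcongr
    _ = _ := by rw [← mul_assoc, add_assoc]

lemma isTameLinear_zero {F F' : Type*} [AddCommGroup F] [Module ℝ F] [Grading F]
    [AddCommGroup F'] [Module ℝ F'] [Grading F'] : IsTameLinear (0 : F →ₗ[ℝ] F') :=
  ⟨0, 0, fun _ => 0, fun n _ f => by simp [gnorm]⟩

lemma isTameLinear_fst {F F' : Type*} [AddCommGroup F] [Module ℝ F] [Grading F]
    [AddCommGroup F'] [Module ℝ F'] [Grading F'] : IsTameLinear (LinearMap.fst ℝ F F') := by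
  refine ⟨0, 0, fun _ => 1, fun n _ p => ?_⟩
  rw [one_mul]
  exact le_add_of_nonneg_right (gnorm_nonneg n p.2)

lemma IsTameLinear.prod {F F' F'' : Type*} [AddCommGroup F] [Module ℝ F] [Grading F]
    [AddCommGroup F'] [Module ℝ F'] [Grading F'] [AddCommGroup F''] [Module ℝ F''] [Grading F'']
    {φ : F →ₗ[ℝ] F'} {ψ : F →ₗ[ℝ] F''} (hφ : IsTameLinear φ)
    (hψ : IsTameLinear ψ) : IsTameLinear (φ.prod ψ) := by
  obtain ⟨r, b, C, h⟩ := hφ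
  obtain ⟨r', b', C', h'⟩ := hψ
  refine ⟨max r r', max b b', fun n => |C n| + |C' n|, fun n hn f => ?_⟩
  have h1 := h n (le_trans (le_max_left _ _) hn) f
  have h2 := h' n (le_trans (le_max_right _ _) hn) f
  have h3 : gnorm (n + r) f ≤ gnorm (n + max r r') f := gnorm_mono (by omega) f
  have h4 : gnorm (n + r') f ≤ gnorm (n + max r r') f := gnorm_mono (by omega) f
  rw [gnorm_prod, add_mul]
  refine add_le_add (h1.trans ?_) (h2.trans ?_)
  · exact mul_le_mul (le_abs_self _) h3 (gnorm_nonneg _ _) (abs_nonneg _)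
  · exact mul_le_mul (le_abs_self _) h4 (gnorm_nonneg _ _) (abs_nonneg _)

lemma IsTameDirectSummand.of_retract {F F' G : Type*} [AddCommGroup F] [Module ℝ F] [Grading F]
    [AddCommGroup F'] [Module ℝ F'] [Grading F'] [AddCommGroup G] [Module ℝ G] [Grading G]
    (h : IsTameDirectSummand F G) {i : F' →ₗ[ℝ] F} {p : F →ₗ[ℝ] F'} (hi : IsTameLinear i)
    (hp : IsTameLinear p) (hpi : ∀ x, p (i x) = x) : IsTameDirectSummand F' G := by
  obtain ⟨φ, ψ, hφ, hψ, h⟩ := h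
  exact ⟨φ.comp i, p.comp ψ, hφ.comp hi, hp.comp hψ, fun x => by simp [h, hpi]⟩

variable {E : Type*} [NormedAddCommGroup E] [NormedSpace ℂ E]

lemma HolForm.continuousOn_sphere (α : HolForm E) (k : ℤ) {r : ℝ} (hr : 0 < r) :
    ContinuousOn (fun z : ℂ => z ^ k • α (unitOf z)) (Metric.sphere 0 r) := by
  have hsub : Metric.sphere (0 : ℂ) r ⊆ {0}ᶜ := fun z hz h0 => by
    rw [mem_singleton_iff] at h0
    simp [h0, hr.ne] at hz
  have h1 : ContinuousOn (fun z : ℂ => z ^ k) (Metric.sphere 0 r) := fun z hz =>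
    (continuousAt_zpow₀ z k (Or.inl (hsub hz))).continuousWithinAt
  exact h1.smul (α.continuousOn.mono hsub)

lemma HolForm.circleIntegrable (α : HolForm E) (k : ℤ) {r : ℝ} (hr : 0 < r) :
    CircleIntegrable (fun z : ℂ => z ^ k • α (unitOf z)) 0 r :=
  (α.continuousOn_sphere k hr).circleIntegrable hr.le

/-- The Laurent coefficient of `z ^ k`. -/
def laurentCoeff (k : ℤ) : HolForm E →ₗ[ℝ] E where
  toFun α := (2 * π * I : ℂ)⁻¹ • ∮ z in C(0, 1), z ^ (-k - 1) • α (unitOf z)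
  map_add' α β := by
    rw [← smul_add, ← circleIntegral.integral_add (α.circleIntegrable _ zero_lt_one)
      (β.circleIntegrable _ zero_lt_one)]
    simp
  map_smul' c α := by
    simp only [RingHom.id_apply]
    have h : (∮ z in C(0, 1), z ^ (-k - 1) • (c • α) (unitOf z)) =
        c • ∮ z in C(0, 1), z ^ (-k - 1) • α (unitOf z) := by
      rw [← circleIntegral.integral_smul]
      refine congrArg (fun f => circleIntegral f 0 1) (funext fun z => ?_)
      rw [HolForm.smul_apply, smul_comm]
    rw [h, smul_comm]

lemma circleIntegral_eq_of_le [CompleteSpace E] (α : HolForm E) (k : ℤ) {r R : ℝ} (hr : 0 < r)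
    (hrR : r ≤ R) : ∮ z in C(0, R), z ^ k • α (unitOf z) = ∮ z in C(0, r), z ^ k • α (unitOf z) := by
  have hd : ∀ z : ℂ, z ≠ 0 → DifferentiableAt ℂ (fun z : ℂ => z ^ k • α (unitOf z)) z := fun z hz =>
    (differentiableAt_zpow.2 (Or.inl hz)).smul
      (α.differentiableOn.differentiableAt (isOpen_compl_singleton.mem_nhds hz))
  refine Complex.circleIntegral_eq_of_differentiable_on_annulus_off_countable hr hrR countable_empty
    (fun z hz => (hd z ?_).continuousAt.continuousWithinAt) (fun z hz => hd z ?_)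
  · rintro rfl
    exact hz.2 (Metric.mem_ball_self hr)
  · rintro rfl
    exact hz.1.2 (Metric.mem_closedBall_self hr.le)

/-- By Cauchy's theorem the radius of the circle is free. Letting it depend on the index of the
seminorm produces the exponential decay of the coefficients. -/
lemma laurentCoeff_eq [CompleteSpace E] (k : ℤ) (α : HolForm E) {r : ℝ} (hr : 0 < r) :
    laurentCoeff k α = (2 * π * I : ℂ)⁻¹ • ∮ z in C(0, r), z ^ (-k - 1) • α (unitOf z) := by
  rcases le_total r 1 with h | h
  · rw [← circleIntegral_eq_of_le α _ hr h]; rfl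
  · rw [circleIntegral_eq_of_le α _ zero_lt_one h]; rfl

lemma norm_laurentCoeff_le [CompleteSpace E] (k : ℤ) (α : HolForm E) {r M : ℝ} (hr : 0 < r)
    (hM : ∀ z ∈ Metric.sphere (0 : ℂ) r, ‖α (unitOf z)‖ ≤ M) :
    ‖laurentCoeff k α‖ ≤ r ^ (-k) * M := by
  rw [laurentCoeff_eq k α hr]
  refine (circleIntegral.norm_two_pi_i_inv_smul_integral_le_of_norm_le_const (C := r ^ (-k - 1) * M)
    hr.le fun z hz => ?_).trans_eq ?_
  · rw [norm_smul, norm_zpow, mem_sphere_zero_iff_norm.1 hz]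
    gcongr
    exact hM z hz
  · rw [← mul_assoc]
    congr 1
    rw [sub_eq_add_neg, zpow_add₀ hr.ne']
    field_simp

lemma unitOf_mem_annulus {n : ℕ} {x : ℝ} (hx : |x| ≤ n) {z : ℂ} (hz : ‖z‖ = Real.exp x) :
    unitOf z ∈ annulus n := by
  have hz0 : z ≠ 0 := norm_pos_iff.1 (hz ▸ Real.exp_pos x)
  rw [annulus, mem_ofPred_eq, val_unitOf hz0, hz, Real.exp_le_exp, Real.exp_le_exp]
  exact abs_le.1 hx

/-- Integrate over the outer boundary circle of the annulus, of radius `e ^ m`. -/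
lemma norm_laurentCoeff_nat_le [CompleteSpace E] (m j : ℕ) (α : HolForm E) :
    ‖laurentCoeff (j : ℤ) α‖ ≤ Real.exp (-(m * j : ℝ)) * gnorm m α := by
  have h := norm_laurentCoeff_le (j : ℤ) α (M := gnorm m α) (Real.exp_pos m) fun z hz =>
    α.norm_le_gnorm (unitOf_mem_annulus (x := m) (by simp) (mem_sphere_zero_iff_norm.1 hz))
  convert h using 2
  rw [zpow_neg, zpow_natCast, ← Real.exp_nat_mul, ← Real.exp_neg]
  congr 1; ring

/-- Integrate over the inner boundary circle, of radius `e ^ (-m)`. The exponent obtained is `-m (j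
+ 1)`, of which one factor `e ^ (-m)` is given away to match the bound for nonnegative powers. -/
lemma norm_laurentCoeff_neg_le [CompleteSpace E] (m j : ℕ) (α : HolForm E) :
    ‖laurentCoeff (-(j : ℤ) - 1) α‖ ≤ Real.exp (-(m * j : ℝ)) * gnorm m α := by
  have h := norm_laurentCoeff_le (-(j : ℤ) - 1) α (M := gnorm m α) (Real.exp_pos (-m)) fun z hz =>
    α.norm_le_gnorm (unitOf_mem_annulus (x := -m) (by simp) (mem_sphere_zero_iff_norm.1 hz))
  refine h.trans (mul_le_mul_of_nonneg_right ?_ (gnorm_nonneg m α))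
  have : (-(-(j : ℤ) - 1)) = ((j + 1 : ℕ) : ℤ) := by push_cast; ring
  rw [this, zpow_natCast, ← Real.exp_nat_mul, Real.exp_le_exp]
  push_cast
  have : (0 : ℝ) ≤ m := Nat.cast_nonneg m
  nlinarith

/-- On the annulus of index `n` the powers grow at most like `e ^ (n j)`, up to a constant. Decay
measured with the seminorm of index `n + 1` leaves a convergent geometric series. -/
lemma summable_norm_laurent [CompleteSpace E] (α : HolForm E) (u : ℂˣ) :
    Summable fun k : ℤ => ‖(u : ℂ) ^ k • laurentCoeff k α‖ := by
  obtain ⟨n, hn⟩ := exists_subset_annulus (isCompact_singleton (x := u))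
  obtain ⟨h1, h2⟩ := hn (mem_singleton u)
  have hu : 0 < ‖(u : ℂ)‖ := norm_pos_iff.2 u.ne_zero
  have hs : Summable fun j : ℕ => Real.exp (-(j : ℝ)) * gnorm (n + 1) α :=
    Real.summable_exp_neg_nat.mul_right _
  refine Summable.of_nat_of_neg_add_one ?_ ?_
  · refine Summable.of_nonneg_of_le (fun _ => norm_nonneg _) (fun j => ?_) hs
    rw [norm_smul, norm_zpow, zpow_natCast]
    calc ‖(u : ℂ)‖ ^ j * ‖laurentCoeff (j : ℤ) α‖
        ≤ Real.exp n ^ j * (Real.exp (-((n + 1 : ℕ) * j : ℝ)) * gnorm (n + 1) α) := by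
          gcongr
          exact norm_laurentCoeff_nat_le (n + 1) j α
      _ = _ := by
          rw [← mul_assoc, ← Real.exp_nat_mul, ← Real.exp_add]
          congr 2; push_cast; ring
  · refine Summable.of_nonneg_of_le (fun _ => norm_nonneg _) (fun j => ?_)
      (hs.mul_left (Real.exp n))
    have e1 : (-((j : ℤ) + 1)) = -(j : ℤ) - 1 := by ring
    have e2 : ‖(u : ℂ)‖ ^ (-(j : ℤ) - 1) = (‖(u : ℂ)‖⁻¹) ^ (j + 1) := by
      rw [← e1, zpow_neg, inv_pow]; norm_cast
    have e3 : ‖(u : ℂ)‖⁻¹ ≤ Real.exp n := by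
      rw [inv_le_comm₀ hu (Real.exp_pos _), ← Real.exp_neg]; exact h1
    rw [e1, norm_smul, norm_zpow, e2]
    calc ‖(u : ℂ)‖⁻¹ ^ (j + 1) * ‖laurentCoeff (-(j : ℤ) - 1) α‖
        ≤ Real.exp n ^ (j + 1) * (Real.exp (-((n + 1 : ℕ) * j : ℝ)) * gnorm (n + 1) α) := by
          gcongr
          exact norm_laurentCoeff_neg_le (n + 1) j α
      _ = _ := by
          rw [← mul_assoc, ← mul_assoc, ← Real.exp_nat_mul, ← Real.exp_add, ← Real.exp_add]
          congr 2; push_cast; ring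

/-- The Laurent expansion of a holomorphic function on `ℂ*`. -/
lemma hasSum_laurent [CompleteSpace E] (α : HolForm E) (u : ℂˣ) :
    HasSum (fun k : ℤ => (u : ℂ) ^ k • laurentCoeff k α) (α u) := by
  have hsum := (summable_norm_laurent α u).of_norm
  refine hsum.hasSum_iff.2 ?_
  -- Continuous functionals reduce the claim to scalar functions. On the circle through `u` the
  -- Laurent series is then a Fourier series.
  refine (SeparatingDual.eq_iff_forall_dual_eq (R := ℂ)).2 fun ℓ => ?_
  rw [ℓ.map_tsum hsum]
  have : Fact (0 < 2 * π) := ⟨Real.two_pi_pos⟩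
  set r : ℝ := ‖(u : ℂ)‖ with hr'
  have hr : 0 < r := norm_pos_iff.2 u.ne_zero
  set e : AddCircle (2 * π) → ℂ := fun x => r * (AddCircle.toCircle x : ℂ) with he
  have hec : Continuous e := continuous_const.mul
    (continuous_subtype_val.comp AddCircle.continuous_toCircle)
  have he0 : ∀ x, e x ≠ 0 := fun x => mul_ne_zero (by exact_mod_cast hr.ne') (Circle.coe_ne_zero _)
  have heval : ∀ x : ℝ, e x = circleMap 0 r x := by
    intro x
    rw [he]
    simp only [AddCircle.toCircle_apply_mk, Circle.coe_exp, circleMap, zero_add]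
    congr 3
    have := Real.two_pi_pos.ne'
    push_cast
    field_simp
  let f : C(AddCircle (2 * π), ℂ) :=
    ⟨fun x => ℓ (α (unitOf (e x))), ℓ.continuous.comp (α.continuous.comp
      (continuous_iff_continuousAt.2 fun x => (continuousAt_unitOf (he0 x)).comp hec.continuousAt))⟩
  -- The Fourier coefficients on the circle of radius `r` are the Laurent coefficients scaled by `r
  -- ^ k`.
  have hcoef : ∀ k : ℤ, fourierCoeff f k = (r : ℂ) ^ k * ℓ (laurentCoeff k α) := by
    intro k
    rw [fourierCoeff_eq_intervalIntegral f k 0, laurentCoeff_eq k α hr, map_smul]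
    have hci := (α.circleIntegrable (-k - 1) hr)
    rw [circleIntegral, ← ContinuousLinearMap.intervalIntegral_comp_comm ℓ hci.out, zero_add,
      smul_eq_mul, ← mul_assoc, ← intervalIntegral.integral_const_mul,
      ← intervalIntegral.integral_smul]
    refine intervalIntegral.integral_congr fun x _ => ?_
    simp only [f, ContinuousMap.coe_mk, heval, deriv_circleMap, map_smul, smul_eq_mul,
      fourier_coe_apply, Complex.real_smul]
    have hz : circleMap 0 r x ≠ 0 := by rw [← heval]; exact he0 _
    have h1 : circleMap 0 r x ^ (-k - 1) = circleMap 0 r x ^ (-k) * (circleMap 0 r x)⁻¹ :=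
      zpow_sub_one₀ hz _
    have h2 : circleMap 0 r x ^ (-k) = (r : ℂ) ^ (-k) *
        Complex.exp (2 * π * I * ((-k : ℤ) : ℂ) * x / ((2 * π : ℝ) : ℂ)) := by
      rw [circleMap, zero_add, mul_zpow, ← Complex.exp_int_mul]
      congr 2
      have : (π : ℂ) ≠ 0 := by exact_mod_cast Real.pi_ne_zero
      push_cast
      field_simp
    rw [h1, h2, zpow_neg]
    have hrk : (r : ℂ) ^ k ≠ 0 := zpow_ne_zero _ (by exact_mod_cast hr.ne')
    have : (π : ℂ) ≠ 0 := by exact_mod_cast Real.pi_ne_zero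
    have hI := Complex.I_ne_zero
    push_cast
    field_simp
  obtain ⟨x, hx⟩ : ∃ x : ℝ, circleMap 0 r x = u := by
    have : (u : ℂ) ∈ Metric.sphere (0 : ℂ) |r| := by
      rw [abs_of_pos hr]; simp [hr']
    rw [← range_circleMap] at this
    exact this
  have hfour : ∀ k : ℤ, fourierCoeff f k • fourier k (x : AddCircle (2 * π)) =
      ℓ ((u : ℂ) ^ k • laurentCoeff k α) := by
    intro k
    rw [hcoef, map_smul, smul_eq_mul, smul_eq_mul, fourier_coe_apply, ← hx, circleMap, zero_add,
      mul_zpow, ← Complex.exp_int_mul, mul_right_comm]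
    congr 3
    have : (π : ℂ) ≠ 0 := by exact_mod_cast Real.pi_ne_zero
    push_cast
    field_simp
  -- Characters have modulus one, so the norms of the Fourier coefficients are those of the Laurent
  -- terms at `u`. Absolute summability makes the Fourier series converge pointwise to `f`.
  have hsumm : Summable (fourierCoeff f) := by
    have h1 := (hsum.map ℓ ℓ.continuous).norm
    refine Summable.of_norm (h1.congr fun k => ?_)
    rw [Function.comp_apply, ← hfour, norm_smul, fourier_apply, Circle.norm_coe, mul_one]
  have h1 := has_pointwise_sum_fourier_series_of_summable hsumm (x : AddCircle (2 * π))
  simp only [hfour] at h1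
  rw [h1.tsum_eq]
  simp [f, heval, hx]

end Tame

/-! ### The tame splitting by Laurent coefficients, and the model spaces -/

section TameSpaces

variable {E : Type*} [NormedAddCommGroup E] [NormedSpace ℂ E]

/-- The weight `e ^ (m j)` against decay `e ^ (-(m + 1) j)` leaves the summable `e ^ (-j)`. This is
why the coefficient map loses exactly one index in the bound. -/
lemma summable_expWeighted_laurent [CompleteSpace E] (m : ℕ) (α : HolForm E) :
    Summable (expWeighted m fun j : ℕ => (laurentCoeff (j : ℤ) α, laurentCoeff (-(j : ℤ) - 1) α)) ∧
    ∑' j, expWeighted m (fun j : ℕ => (laurentCoeff (j : ℤ) α, laurentCoeff (-(j : ℤ) - 1) α)) j ≤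
      (∑' j : ℕ, Real.exp (-(j : ℝ))) * gnorm (m + 1) α := by
  have hs : Summable fun j : ℕ => Real.exp (-(j : ℝ)) * gnorm (m + 1) α :=
    Real.summable_exp_neg_nat.mul_right _
  have hle : ∀ j : ℕ, expWeighted m (fun j : ℕ => (laurentCoeff (j : ℤ) α,
      laurentCoeff (-(j : ℤ) - 1) α)) j ≤ Real.exp (-(j : ℝ)) * gnorm (m + 1) α := by
    intro j
    have h : ‖(laurentCoeff (j : ℤ) α, laurentCoeff (-(j : ℤ) - 1) α)‖ ≤
        Real.exp (-((m + 1 : ℕ) * j : ℝ)) * gnorm (m + 1) α :=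
      max_le (norm_laurentCoeff_nat_le (m + 1) j α) (norm_laurentCoeff_neg_le (m + 1) j α)
    rw [expWeighted]
    calc _ ≤ Real.exp (m * j) * (Real.exp (-((m + 1 : ℕ) * j : ℝ)) * gnorm (m + 1) α) := by gcongr
      _ = _ := by
        rw [← mul_assoc, ← Real.exp_add]
        congr 2; push_cast; ring
  have h1 := Summable.of_nonneg_of_le (expWeighted_nonneg m _) hle hs
  refine ⟨h1, ?_⟩
  rw [← tsum_mul_right]
  exact h1.tsum_le_tsum hle hs

/-- The sequence of Laurent coefficients. -/
def laurentSeq (E : Type*) [NormedAddCommGroup E] [NormedSpace ℂ E] [CompleteSpace E] :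
    HolForm E →ₗ[ℝ] ExpSeq (E × E) where
  toFun α := ⟨fun j => (laurentCoeff (j : ℤ) α, laurentCoeff (-(j : ℤ) - 1) α),
    fun m => (summable_expWeighted_laurent m α).1⟩
  map_add' α β := Subtype.ext (funext fun j => by
    simp only [map_add]; rfl)
  map_smul' c α := Subtype.ext (funext fun j => by
    simp only [map_smul]; rfl)

/-- The `j`-th term of the Laurent series with coefficients `x`. -/
def laurentTerm (x : ℕ → E × E) (j : ℕ) (z : ℂ) : E :=
  z ^ j • (x j).1 + z ^ (-(j : ℤ) - 1) • (x j).2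

lemma norm_laurentTerm_le (x : ℕ → E × E) (n j : ℕ) {z : ℂ} (h1 : Real.exp (-(n : ℝ)) ≤ ‖z‖)
    (h2 : ‖z‖ ≤ Real.exp n) : ‖laurentTerm x j z‖ ≤ (1 + Real.exp n) * expWeighted n x j := by
  have hz : 0 < ‖z‖ := (Real.exp_pos _).trans_le h1
  have e3 : ‖z‖⁻¹ ≤ Real.exp n := by
    rw [inv_le_comm₀ hz (Real.exp_pos _), ← Real.exp_neg]; exact h1
  have e2 : ‖z‖ ^ (-(j : ℤ) - 1) = (‖z‖⁻¹) ^ (j + 1) := by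
    rw [show -(j : ℤ) - 1 = -((j : ℤ) + 1) by ring, zpow_neg, inv_pow]; norm_cast
  have e4 : Real.exp (n * j : ℝ) = Real.exp n ^ j := by rw [← Real.exp_nat_mul, mul_comm]
  refine (norm_add_le _ _).trans ?_
  rw [norm_smul, norm_smul, norm_pow, norm_zpow, e2, expWeighted, e4]
  calc ‖z‖ ^ j * ‖(x j).1‖ + ‖z‖⁻¹ ^ (j + 1) * ‖(x j).2‖
      ≤ Real.exp n ^ j * ‖x j‖ + Real.exp n ^ (j + 1) * ‖x j‖ := by
        gcongr
        · exact norm_fst_le _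
        · exact norm_snd_le _
    _ = _ := by ring

lemma summable_laurentTerm [CompleteSpace E] (x : ExpSeq (E × E)) {z : ℂ} (hz : z ≠ 0) :
    Summable fun j => laurentTerm x.1 j z := by
  obtain ⟨n, hn⟩ := exists_subset_annulus (isCompact_singleton (x := unitOf z))
  obtain ⟨h1, h2⟩ := hn (mem_singleton _)
  rw [val_unitOf hz] at h1 h2
  exact Summable.of_norm_bounded ((x.2 n).mul_left _) fun j => norm_laurentTerm_le x.1 n j h1 h2

lemma differentiableOn_tsum_laurentTerm [CompleteSpace E] (x : ExpSeq (E × E)) :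
    DifferentiableOn ℂ (fun z => ∑' j, laurentTerm x.1 j z) {0}ᶜ := by
  intro z hz
  obtain ⟨n, hn⟩ := exists_subset_annulus (isCompact_singleton (x := unitOf z))
  obtain ⟨h1, h2⟩ := hn (mem_singleton _)
  rw [val_unitOf hz] at h1 h2
  -- The next larger annulus, with its boundary removed, is an open neighbourhood of `z` on which
  -- the series is dominated.
  set U : Set ℂ := {z | Real.exp (-((n + 1 : ℕ) : ℝ)) < ‖z‖ ∧ ‖z‖ < Real.exp ((n + 1 : ℕ) : ℝ)}
  have hU : IsOpen U := (isOpen_lt continuous_const continuous_norm).inter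
    (isOpen_lt continuous_norm continuous_const)
  have hzU : z ∈ U := by
    refine ⟨lt_of_lt_of_le (Real.exp_lt_exp.2 ?_) h1, h2.trans_lt (Real.exp_lt_exp.2 ?_)⟩ <;>
    · push_cast; linarith
  have hd := Complex.differentiableOn_tsum_of_summable_norm (F := fun j => laurentTerm x.1 j)
    ((x.2 (n + 1)).mul_left _) (fun j y hy => ?_) hU
    (fun j y hy => norm_laurentTerm_le x.1 (n + 1) j hy.1.le hy.2.le)
  · exact (hd.differentiableAt (hU.mem_nhds hzU)).differentiableWithinAt
  · have hy0 : y ≠ 0 := norm_pos_iff.1 ((Real.exp_pos _).trans hy.1)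
    exact (((differentiableAt_id.pow j).smul_const _).add
      ((differentiableAt_zpow.2 (Or.inl hy0)).smul_const _)).differentiableWithinAt

/-- The form with given Laurent coefficients. -/
def laurentSum (E : Type*) [NormedAddCommGroup E] [NormedSpace ℂ E] [CompleteSpace E] :
    ExpSeq (E × E) →ₗ[ℝ] HolForm E where
  toFun x := HolForm.ofFun (fun z => ∑' j, laurentTerm x.1 j z) (differentiableOn_tsum_laurentTerm x)
  map_add' x y := by
    ext u
    rw [HolForm.add_apply, HolForm.ofFun_apply, HolForm.ofFun_apply, HolForm.ofFun_apply,
      ← (summable_laurentTerm x u.ne_zero).tsum_add (summable_laurentTerm y u.ne_zero)]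
    refine tsum_congr fun j => ?_
    change (u : ℂ) ^ j • ((x.1 j).1 + (y.1 j).1) + (u : ℂ) ^ (-(j : ℤ) - 1) •
      ((x.1 j).2 + (y.1 j).2) = _
    rw [laurentTerm, laurentTerm, smul_add, smul_add]
    abel
  map_smul' c x := by
    ext u
    rw [RingHom.id_apply, HolForm.smul_apply, HolForm.ofFun_apply, HolForm.ofFun_apply,
      ← (summable_laurentTerm x u.ne_zero).tsum_const_smul]
    refine tsum_congr fun j => ?_
    change (u : ℂ) ^ j • (c • (x.1 j).1) + (u : ℂ) ^ (-(j : ℤ) - 1) • (c • (x.1 j).2) = _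
    rw [laurentTerm, smul_add, smul_comm c, smul_comm c]

lemma isTameLinear_laurentSeq [CompleteSpace E] : IsTameLinear (laurentSeq E) :=
  ⟨1, 0, fun _ => ∑' j : ℕ, Real.exp (-(j : ℝ)), fun n _ α => (summable_expWeighted_laurent n α).2⟩

lemma isTameLinear_laurentSum [CompleteSpace E] : IsTameLinear (laurentSum E) := by
  refine ⟨0, 0, fun n => 1 + Real.exp n, fun n _ x => HolForm.gnorm_le fun u hu => ?_⟩
  have hs : Summable fun j => (1 + Real.exp n) * expWeighted n x.1 j := (x.2 n).mul_left _
  have hle : ∀ j, ‖laurentTerm x.1 j (u : ℂ)‖ ≤ (1 + Real.exp n) * expWeighted n x.1 j :=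
    fun j => norm_laurentTerm_le x.1 n j hu.1 hu.2
  have := tsum_of_norm_bounded hs.hasSum hle
  rwa [tsum_mul_left] at this

lemma laurentSum_laurentSeq [CompleteSpace E] (α : HolForm E) :
    laurentSum E (laurentSeq E α) = α := by
  ext u
  have h := (hasSum_laurent α u).nat_add_neg_add_one
  refine Eq.trans (tsum_congr fun j => ?_) h.tsum_eq
  have e1 : (-((j : ℤ) + 1)) = -(j : ℤ) - 1 := by ring
  rw [e1, zpow_natCast]
  rfl

lemma isTameDirectSummand_holForm [CompleteSpace E] :
    IsTameDirectSummand (HolForm E) (ExpSeq (E × E)) :=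
  ⟨laurentSeq E, laurentSum E, isTameLinear_laurentSeq, isTameLinear_laurentSum,
    laurentSum_laurentSeq⟩

variable (E) in
lemma isTameFrechetSpace_holForm [CompleteSpace E] : IsTameFrechetSpace (HolForm E) :=
  ⟨isGradedFrechetSpace_holForm E, E × E, inferInstance, inferInstance, inferInstance,
    isTameDirectSummand_holForm⟩

/-! ### Residues and the space of forms without residue -/

/-- The integral of a form over the unit circle. -/
def period (E : Type*) [NormedAddCommGroup E] [NormedSpace ℂ E] : HolForm E →ₗ[ℝ] E where
  toFun α := ∮ z in C(0, 1), α (unitOf z)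
  map_add' α β := by
    rw [← circleIntegral.integral_add]
    · simp
    · simpa using α.circleIntegrable 0 zero_lt_one
    · simpa using β.circleIntegrable 0 zero_lt_one
  map_smul' c α := by
    simp only [RingHom.id_apply, HolForm.smul_apply]
    rw [← circleIntegral.integral_smul]

lemma norm_period_le (α : HolForm E) : ‖period E α‖ ≤ 2 * π * gnorm 0 α := by
  have := circleIntegral.norm_integral_le_of_norm_le_const (f := fun z => α (unitOf z)) (c := 0)
    (R := 1) (C := gnorm 0 α) zero_le_one fun z hz =>
      α.norm_le_gnorm (unitOf_mem_annulus (x := 0) (by simp) (by simpa using hz))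
  rw [mul_one] at this
  exact this

/-- The form `(2πiz)⁻¹ x dz` of period `x`. -/
def periodForm (E : Type*) [NormedAddCommGroup E] [NormedSpace ℂ E] : E →ₗ[ℝ] HolForm E where
  toFun x := HolForm.ofFun (fun z => (2 * π * I * z : ℂ)⁻¹ • x) (fun z hz => by
    have h : (2 * π * I * z : ℂ) ≠ 0 := mul_ne_zero Complex.two_pi_I_ne_zero hz
    exact (((differentiableAt_id.const_mul _).inv h).smul_const x).differentiableWithinAt)
  map_add' x y := by ext u; simp
  map_smul' c x := by ext u; simp [smul_comm c]

lemma periodForm_apply (x : E) (u : ℂˣ) : periodForm E x u = (2 * π * I * u : ℂ)⁻¹ • x := rfl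

lemma gnorm_periodForm_le (n : ℕ) (x : E) : gnorm n (periodForm E x) ≤ Real.exp n * ‖x‖ := by
  refine HolForm.gnorm_le fun u hu => ?_
  rw [periodForm_apply, norm_smul]
  gcongr
  have hu0 : 0 < ‖(u : ℂ)‖ := norm_pos_iff.2 u.ne_zero
  have e3 : ‖(u : ℂ)‖⁻¹ ≤ Real.exp n := by
    rw [inv_le_comm₀ hu0 (Real.exp_pos _), ← Real.exp_neg]; exact hu.1
  have hpi : ‖(2 * π * I : ℂ)‖⁻¹ ≤ 1 := by
    refine inv_le_one_of_one_le₀ ?_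
    have := Real.pi_gt_three
    simp [abs_of_pos Real.pi_pos]
    linarith
  rw [norm_inv, norm_mul, mul_inv]
  calc _ ≤ 1 * Real.exp n := by gcongr
    _ = _ := one_mul _

lemma period_periodForm [CompleteSpace E] (x : E) : period E (periodForm E x) = x := by
  have h : ∀ z : ℂ, z ∈ Metric.sphere (0 : ℂ) 1 →
      periodForm E x (unitOf z) = ((2 * π * I : ℂ)⁻¹ * (z - 0)⁻¹) • x := fun z hz => by
    have hz0 : z ≠ 0 := by rintro rfl; simp at hz
    rw [periodForm_apply, val_unitOf hz0, mul_inv, sub_zero]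
  change (∮ z in C(0, 1), periodForm E x (unitOf z)) = x
  rw [circleIntegral.integral_congr zero_le_one h, circleIntegral.integral_smul_const,
    circleIntegral.integral_const_mul (2 * π * I : ℂ)⁻¹ (fun z => (z - 0)⁻¹) 0 1, circleIntegral.integral_sub_center_inv _ one_ne_zero,
    inv_mul_cancel₀ Complex.two_pi_I_ne_zero, one_smul]

/-- The space of forms without residue at `0`. -/
def exactForms (E : Type*) [NormedAddCommGroup E] [NormedSpace ℂ E] : Submodule ℝ (HolForm E) :=
  LinearMap.ker (period E)

/-- The projection onto the forms without residue. -/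
def exactPart (E : Type*) [NormedAddCommGroup E] [NormedSpace ℂ E] [CompleteSpace E] :
    HolForm E →ₗ[ℝ] exactForms E :=
  LinearMap.codRestrict _ (LinearMap.id - (periodForm E).comp (period E)) fun α => by
    simp [exactForms, period_periodForm]

lemma coe_exactPart [CompleteSpace E] (α : HolForm E) :
    (exactPart E α : HolForm E) = α - periodForm E (period E α) := rfl

lemma period_coe (κ : exactForms E) : period E (κ : HolForm E) = 0 := κ.2

lemma gnorm_exactPart_le [CompleteSpace E] (n : ℕ) (α : HolForm E) :
    gnorm n (exactPart E α) ≤ (1 + Real.exp n * (2 * π)) * gnorm n α := by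
  have h1 : gnorm n (exactPart E α) ≤ gnorm n α + gnorm n (periodForm E (period E α)) := by
    rw [gnorm_submodule, coe_exactPart]
    exact map_sub_le_add (Grading.seminorm (F := HolForm E) n) _ _
  have h2 := gnorm_periodForm_le n (period E α)
  have h3 := norm_period_le α
  have h4 := gnorm_mono (Nat.zero_le n) α
  calc _ ≤ gnorm n α + Real.exp n * (2 * π * gnorm n α) := by
        refine h1.trans (add_le_add le_rfl (h2.trans ?_))
        gcongr
        exact h3.trans (by gcongr)
    _ = _ := by ring

lemma isTameLinear_exactPart [CompleteSpace E] : IsTameLinear (exactPart E) :=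
  ⟨0, 0, _, fun n _ α => gnorm_exactPart_le n α⟩

lemma isTameLinear_subtype : IsTameLinear (exactForms E).subtype :=
  ⟨0, 0, fun _ => 1, fun n _ κ => by rw [one_mul]; rfl⟩

variable (E) in
lemma withSeminorms_exactForms : WithSeminorms (Grading.seminorm (F := exactForms E)) :=
  IsInducing.withSeminorms (HolForm.withSeminorms (E := E)) (f := (exactForms E).subtype)
    IsInducing.subtypeVal

lemma withSeminorms_normed (V : Type*) [NormedAddCommGroup V] [NormedSpace ℝ V] :
    WithSeminorms (Grading.seminorm (F := V)) := by
  have h := norm_withSeminorms ℝ V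
  refine h.congr (fun _ => ⟨{0}, 1, ?_⟩) (fun _ => ⟨{0}, 1, ?_⟩)
  · simp; rfl
  · simp; rfl

lemma continuous_period : Continuous (period E) :=
  continuous_of_gnorm_le HolForm.withSeminorms (withSeminorms_normed E) _ fun _ =>
    ⟨0, 2 * π, norm_period_le⟩

lemma continuous_periodForm : Continuous (periodForm E) :=
  continuous_of_gnorm_le (withSeminorms_normed E) HolForm.withSeminorms _ fun n =>
    ⟨0, Real.exp n, gnorm_periodForm_le n⟩

lemma continuous_exactPart [CompleteSpace E] : Continuous (exactPart E) :=
  continuous_of_gnorm_le HolForm.withSeminorms (withSeminorms_exactForms E) _ fun n =>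
    ⟨n, _, gnorm_exactPart_le n⟩

-- Completeness holds because the kernel of the continuous `period` is closed. Tameness holds
-- because `exactPart` is a tame retraction onto it.
variable (E) in
lemma isTameFrechetSpace_exactForms [CompleteSpace E] : IsTameFrechetSpace (exactForms E) := by
  have := HolForm.t2Space E
  refine ⟨⟨withSeminorms_exactForms E, inferInstance, fun u hu => ?_⟩, E × E, inferInstance,
    inferInstance, inferInstance, isTameDirectSummand_holForm.of_retract isTameLinear_subtype
      isTameLinear_exactPart fun κ => ?_⟩
  · obtain ⟨l, hl⟩ := (isGradedFrechetSpace_holForm E).complete (fun i => (u i : HolForm E)) hu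
    have h1 : period E l = 0 := by
      refine tendsto_nhds_unique ((continuous_period.tendsto l).comp hl) ?_
      simp [Function.comp_def, period_coe]
    exact ⟨⟨l, h1⟩, tendsto_subtype_rng.2 hl⟩
  · ext1
    simp [coe_exactPart, period_coe]

/-! ### The model space of the loop group -/

/-- The inverse of the decomposition of a form into a form without residue and a multiple of
`dz / z`. -/
def modelToForm (E : Type*) [NormedAddCommGroup E] [NormedSpace ℂ E] :
    exactForms E × E →ₗ[ℝ] HolForm E :=
  (exactForms E).subtype.coprod (periodForm E)

/-- The decomposition of a form into a form without residue and a multiple of `dz / z`. -/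
def formToModel (E : Type*) [NormedAddCommGroup E] [NormedSpace ℂ E] [CompleteSpace E] :
    HolForm E →ₗ[ℝ] exactForms E × E := (exactPart E).prod (period E)

lemma modelToForm_apply (p : exactForms E × E) :
    modelToForm E p = (p.1 : HolForm E) + periodForm E p.2 := rfl

lemma formToModel_modelToForm [CompleteSpace E] (p : exactForms E × E) :
    formToModel E (modelToForm E p) = p := by
  have h : period E (modelToForm E p) = p.2 := by
    rw [modelToForm_apply, map_add, period_coe, period_periodForm, zero_add]
  refine Prod.ext (Subtype.ext ?_) h
  change modelToForm E p - periodForm E (period E (modelToForm E p)) = p.1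
  rw [h, modelToForm_apply, add_sub_cancel_right]

lemma modelToForm_formToModel [CompleteSpace E] (α : HolForm E) :
    modelToForm E (formToModel E α) = α := by
  change (α - periodForm E (period E α)) + periodForm E (period E α) = α
  simp

lemma gnorm_modelToForm_le (n : ℕ) (p : exactForms E × E) :
    gnorm n (modelToForm E p) ≤ Real.exp n * gnorm n p := by
  rw [modelToForm_apply, gnorm_prod]
  have h1 : (1 : ℝ) ≤ Real.exp n := Real.one_le_exp (Nat.cast_nonneg n)
  calc _ ≤ gnorm n (p.1 : HolForm E) + gnorm n (periodForm E p.2) := gnorm_add_le _ _ _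
    _ ≤ Real.exp n * gnorm n p.1 + Real.exp n * gnorm n p.2 := by
        refine add_le_add ?_ (gnorm_periodForm_le n p.2)
        exact le_mul_of_one_le_left (gnorm_nonneg n p.1) h1
    _ = _ := by ring

lemma gnorm_formToModel_le [CompleteSpace E] (n : ℕ) (α : HolForm E) :
    gnorm n (formToModel E α) ≤ (1 + Real.exp n * (2 * π) + 2 * π) * gnorm n α := by
  rw [gnorm_prod, add_mul]
  refine add_le_add (gnorm_exactPart_le n α) ((norm_period_le α).trans ?_)
  gcongr
  exact gnorm_mono (Nat.zero_le n) α

lemma continuous_modelToForm : Continuous (modelToForm E) :=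
  (continuous_subtype_val.comp continuous_fst).add (continuous_periodForm.comp continuous_snd)

lemma continuous_formToModel [CompleteSpace E] : Continuous (formToModel E) :=
  continuous_exactPart.prodMk continuous_period

-- Decomposing a form into its residue-free part and its period is a linear homeomorphism onto the
-- model, and the estimates in both directions keep the index, so the two families of seminorms are
-- equivalent.
variable (E) in
lemma withSeminorms_model [CompleteSpace E] :
    WithSeminorms (Grading.seminorm (F := exactForms E × E)) := by
  have hind : IsInducing (modelToForm E) :=
    IsInducing.of_comp continuous_modelToForm continuous_formToModel (by
      convert IsInducing.id using 1
      funext p; exact formToModel_modelToForm p)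
  have h1 := hind.withSeminorms (HolForm.withSeminorms (E := E))
  refine h1.congr (fun n => ⟨{n}, ⟨1 + Real.exp n * (2 * π) + 2 * π, by positivity⟩, fun p => ?_⟩)
    (fun n => ⟨{n}, ⟨Real.exp n, by positivity⟩, fun p => ?_⟩)
  · rw [Finset.sup_singleton]
    have := gnorm_formToModel_le n (modelToForm E p)
    rw [formToModel_modelToForm] at this
    exact this
  · rw [Finset.sup_singleton]
    exact gnorm_modelToForm_le n p

variable (E) in
lemma isTameFrechetSpace_model [CompleteSpace E] : IsTameFrechetSpace (exactForms E × E) := by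
  have := HolForm.t2Space E
  refine ⟨⟨withSeminorms_model E, inferInstance, fun u hu => ?_⟩, E × E, inferInstance,
    inferInstance, inferInstance, isTameDirectSummand_holForm.of_retract
      (i := modelToForm E) (p := formToModel E) ⟨0, 0, _, fun n _ p => gnorm_modelToForm_le n p⟩
      ⟨0, 0, _, fun n _ p => gnorm_formToModel_le n p⟩ formToModel_modelToForm⟩
  obtain ⟨l, hl⟩ := (isGradedFrechetSpace_holForm E).complete (fun i => modelToForm E (u i))
    (fun n ε hε => by
      obtain ⟨N, hN⟩ := hu n (ε / Real.exp n) (by positivity)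
      refine ⟨N, fun i hi j hj => ?_⟩
      rw [← map_sub]
      refine (gnorm_modelToForm_le n _).trans_lt ?_
      have := hN i hi j hj
      rwa [lt_div_iff₀' (Real.exp_pos _)] at this)
  refine ⟨formToModel E l, ?_⟩
  have := (continuous_formToModel.tendsto l).comp hl
  simpa [Function.comp_def, formToModel_modelToForm] using this

end TameSpaces

/-! ## Perturbations of affine maps that factor through normed spaces -/

section FiniteType

universe u

variable {F F' F'' : Type u}
  [AddCommGroup F] [Module ℝ F] [TopologicalSpace F] [IsTopologicalAddGroup F]
  [ContinuousSMul ℝ F] [Grading F]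
  [AddCommGroup F'] [Module ℝ F'] [TopologicalSpace F'] [IsTopologicalAddGroup F']
  [ContinuousSMul ℝ F'] [Grading F']
  [AddCommGroup F''] [Module ℝ F''] [TopologicalSpace F''] [IsTopologicalAddGroup F'']
  [ContinuousSMul ℝ F''] [Grading F'']

/-- On `U`, the map `Φ` is the sum of a constant, a tame continuous linear map and a map
`J ∘ s ∘ ρ` where `ρ` and `J` are continuous linear maps to and from normed spaces and `s` is
smooth and bounded on an open set containing `ρ(U)`. -/
def IsNormedPerturbationOn (Φ : F → F') (U : Set F) : Prop :=
  ∃ (X Y : Type u) (_ : NormedAddCommGroup X) (_ : NormedSpace ℝ X) (_ : NormedAddCommGroup Y)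
    (_ : NormedSpace ℝ Y) (c : F') (L : F →L[ℝ] F') (ρ : F →L[ℝ] X) (J : Y →L[ℝ] F') (s : X → Y)
    (V : Set X), IsTameLinear (L : F →ₗ[ℝ] F') ∧ IsOpen V ∧ ContDiffOn ℝ ∞ s V ∧ MapsTo ρ U V ∧
      (∃ C : ℝ, ∀ x ∈ V, ‖s x‖ ≤ C) ∧ ∀ f ∈ U, Φ f = c + L f + J (s (ρ f))

lemma IsNormedPerturbationOn.mono {Φ : F → F'} {U U' : Set F} (h : IsNormedPerturbationOn Φ U)
    (hU : U' ⊆ U) : IsNormedPerturbationOn Φ U' := by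
  obtain ⟨X, Y, _, _, _, _, c, L, ρ, J, s, V, hL, hV, hs, hρ, hC, h⟩ := h
  exact ⟨X, Y, _, _, _, _, c, L, ρ, J, s, V, hL, hV, hs, hρ.mono_left hU, hC,
    fun f hf => h f (hU hf)⟩

lemma IsNormedPerturbationOn.congr {Φ Φ' : F → F'} {U : Set F} (h : IsNormedPerturbationOn Φ U)
    (hU : ∀ f ∈ U, Φ' f = Φ f) : IsNormedPerturbationOn Φ' U := by
  obtain ⟨X, Y, _, _, _, _, c, L, ρ, J, s, V, hL, hV, hs, hρ, hC, h⟩ := h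
  exact ⟨X, Y, _, _, _, _, c, L, ρ, J, s, V, hL, hV, hs, hρ, hC,
    fun f hf => (hU f hf).trans (h f hf)⟩

/-- The perturbation is absent: the auxiliary normed spaces are taken to be zero. -/
lemma isNormedPerturbationOn_affine (c : F') (L : F →L[ℝ] F')
    (hL : IsTameLinear (L : F →ₗ[ℝ] F')) (U : Set F) :
    IsNormedPerturbationOn (fun f => c + L f) U :=
  ⟨PUnit, PUnit, inferInstance, inferInstance, inferInstance, inferInstance, c, L, 0, 0, id, univ,
    hL, isOpen_univ, contDiff_id.contDiffOn, mapsTo_univ _ _, ⟨0, fun x _ => by simp⟩,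
    fun f _ => by simp⟩

/-- If Φ = c + L + J s ρ, then ρ'(Φ f) depends on f only through ρ f and ρ'(L f). The pair (ρ, ρ'L)
is therefore the new map into a normed space. The cross term L'J s ρ also leaves a normed space and
joins J' in the new outgoing map, so only L'L remains as linear part. -/
lemma IsNormedPerturbationOn.comp {Φ : F → F'} {Ψ : F' → F''} {U : Set F} {U' : Set F'}
    (hΨ : IsNormedPerturbationOn Ψ U') (hΦ : IsNormedPerturbationOn Φ U) (hU : MapsTo Φ U U') :
    IsNormedPerturbationOn (Ψ ∘ Φ) U := by
  obtain ⟨X, Y, _, _, _, _, c, L, ρ, J, s, V, hL, hV, hs, hρ, ⟨C, hC⟩, h⟩ := hΦ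
  obtain ⟨X', Y', _, _, _, _, c', L', ρ', J', s', V', hL', hV', hs', hρ', ⟨C', hC'⟩, h'⟩ := hΨ
  let q : X × X' → X' := fun x => ρ' c + x.2 + ρ'.comp J (s x.1)
  have hq : ContDiffOn ℝ ∞ q (V ×ˢ univ) :=
    (contDiff_const.add contDiff_snd).contDiffOn.add
      ((ρ'.comp J).contDiff.comp_contDiffOn (hs.comp contDiff_fst.contDiffOn fun x hx => hx.1))
  let W : Set (X × X') := (V ×ˢ univ) ∩ q ⁻¹' V'
  have hW : IsOpen W := hq.continuousOn.isOpen_inter_preimage (hV.prod isOpen_univ) hV'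
  refine ⟨X × X', Y × Y', inferInstance, inferInstance, inferInstance, inferInstance,
    c' + L' c, L'.comp L, ρ.prod (ρ'.comp L), (L'.comp J).coprod J',
    fun x => (s x.1, s' (q x)), W, hL'.comp hL, hW, ?_, ?_, ⟨max C C', ?_⟩, ?_⟩
  · exact (hs.comp contDiff_fst.contDiffOn fun x hx => hx.1.1).prodMk
      (hs'.comp (hq.mono inter_subset_left) fun x hx => hx.2)
  · intro f hf
    refine ⟨⟨hρ hf, mem_univ _⟩, ?_⟩
    have := hρ' (hU hf)
    rw [h f hf] at this
    simpa [q] using this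
  · intro x hx
    exact max_le_max (hC _ hx.1.1) (hC' _ hx.2)
  · intro f hf
    rw [Function.comp_apply, h' _ (hU hf), h f hf]
    simp [q]
    abel

lemma IsNormedPerturbationOn.prodMk {Φ : F → F'} {Ψ : F → F''} {U : Set F}
    (hΦ : IsNormedPerturbationOn Φ U) (hΨ : IsNormedPerturbationOn Ψ U) :
    IsNormedPerturbationOn (fun f => (Φ f, Ψ f)) U := by
  obtain ⟨X, Y, _, _, _, _, c, L, ρ, J, s, V, hL, hV, hs, hρ, ⟨C, hC⟩, h⟩ := hΦ
  obtain ⟨X', Y', _, _, _, _, c', L', ρ', J', s', V', hL', hV', hs', hρ', ⟨C', hC'⟩, h'⟩ := hΨ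
  refine ⟨X × X', Y × Y', inferInstance, inferInstance, inferInstance, inferInstance,
    (c, c'), L.prod L', ρ.prod ρ', J.prodMap J', Prod.map s s', V ×ˢ V', hL.prod hL', hV.prod hV',
    hs.prodMap hs', fun f hf => ⟨hρ hf, hρ' hf⟩, ⟨max C C', fun x hx => ?_⟩, fun f hf => ?_⟩
  · exact max_le_max (hC _ hx.1) (hC' _ hx.2)
  · simp only [h f hf, h' f hf]
    rfl

/-- The directional derivatives of the affine map `f ↦ c + L f`. -/
def affineDeriv (c : F') (L : F →L[ℝ] F') : (k : ℕ) → F → (Fin k → F) → F'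
  | 0, f, _ => c + L f
  | 1, _, h => L (h 0)
  | _ + 2, _, _ => 0

lemma continuous_affineDeriv (c : F') (L : F →L[ℝ] F') (k : ℕ) :
    Continuous fun p : F × (Fin k → F) => affineDeriv c L k p.1 p.2 := by
  match k with
  | 0 => exact continuous_const.add (L.continuous.comp continuous_fst)
  | 1 => exact L.continuous.comp ((continuous_apply 0).comp continuous_snd)
  | _ + 2 => exact continuous_const

lemma affineDeriv_slope (c : F') (L : F →L[ℝ] F') (k : ℕ) (f : F) (h : Fin k → F) (v : F) {t : ℝ}
    (ht : t ≠ 0) : t⁻¹ • (affineDeriv c L k (f + t • v) h - affineDeriv c L k f h) =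
      affineDeriv c L (k + 1) f (Fin.snoc (α := fun _ => F) h v) := by
  match k with
  | 0 => simp [affineDeriv, smul_smul, ht, Fin.snoc]
  | 1 => simp [affineDeriv]
  | _ + 2 => simp [affineDeriv]

lemma gnorm_affineDeriv_le {c : F'} {L : F →L[ℝ] F'} {r b : ℕ} {C : ℕ → ℝ}
    (hL : ∀ n ≥ b, ∀ f : F, gnorm n (L f) ≤ C n * gnorm (n + r) f) (k n : ℕ) (hn : b ≤ n) (f : F)
    (h : Fin k → F) : gnorm n (affineDeriv c L k f h) ≤
      (gnorm n c + |C n|) * (1 + gnorm (n + r) f + ∑ i, gnorm (n + r) (h i)) := by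
  have hsum : 0 ≤ ∑ i, gnorm (n + r) (h i) := Finset.sum_nonneg fun i _ => gnorm_nonneg _ _
  have hf := gnorm_nonneg (n + r) f
  have hc := gnorm_nonneg n c
  have hL' : ∀ f : F, gnorm n (L f) ≤ |C n| * gnorm (n + r) f := fun f =>
    (hL n hn f).trans (mul_le_mul_of_nonneg_right (le_abs_self _) (gnorm_nonneg _ _))
  have hC := abs_nonneg (C n)
  match k, h with
  | 0, h =>
    refine (gnorm_add_le n _ _).trans ((add_le_add le_rfl (hL' f)).trans ?_)
    rw [add_mul]
    refine add_le_add (le_mul_of_one_le_right hc (by linarith)) ?_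
    exact mul_le_mul_of_nonneg_left (by linarith) hC
  | 1, h =>
    refine (hL' _).trans (mul_le_mul (by linarith) ?_ (gnorm_nonneg _ _) (by linarith))
    rw [Fin.sum_univ_one]
    linarith
  | _ + 2, h =>
    have : gnorm n (0 : F') = 0 := map_zero (Grading.seminorm (F := F') n)
    simp only [affineDeriv, this]
    positivity

/-- A seminorm of the grading pulled back along `J` is a continuous seminorm on a normed space,
hence dominated by the norm. -/
lemma exists_gnorm_le_of_normedSpace (hF' : WithSeminorms (Grading.seminorm (F := F')))
    {Y : Type*} [NormedAddCommGroup Y] [NormedSpace ℝ Y] (J : Y →L[ℝ] F') (n : ℕ) :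
    ∃ C : ℝ, 0 < C ∧ ∀ y, gnorm n (J y) ≤ C * ‖y‖ :=
  Seminorm.bound_of_continuous_normedSpace
    ((Grading.seminorm (F := F') n).comp (J : Y →ₗ[ℝ] F'))
    ((hF'.continuous_seminorm n).comp J.continuous)

/-- The directional derivatives of `s ∘ ρ`. -/
lemma tendsto_slope_iteratedFDeriv {X Y : Type*} [NormedAddCommGroup X] [NormedSpace ℝ X]
    [NormedAddCommGroup Y] [NormedSpace ℝ Y] (ρ : F →L[ℝ] X) {s : X → Y} {f : F}
    (hs : ContDiffAt ℝ ∞ s (ρ f)) (k : ℕ) (h : Fin k → F) (v : F) :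
    Tendsto (fun t : ℝ => t⁻¹ • (iteratedFDeriv ℝ k s (ρ (f + t • v)) (fun i => ρ (h i.rev)) -
      iteratedFDeriv ℝ k s (ρ f) (fun i => ρ (h i.rev)))) (𝓝[≠] 0)
      (𝓝 (iteratedFDeriv ℝ (k + 1) s (ρ f)
        (fun i => ρ (Fin.snoc (α := fun _ => F) h v i.rev)))) := by
  have h1 : DifferentiableAt ℝ (iteratedFDeriv ℝ k s) (ρ f) :=
    (hs.iteratedFDeriv_right (m := 1) (i := k) (by exact_mod_cast le_top)).differentiableAt one_ne_zero
  have h2 : HasDerivAt (fun t : ℝ => ρ f + t • ρ v) (ρ v) 0 := by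
    simpa using ((hasDerivAt_id (0 : ℝ)).smul_const (ρ v)).const_add (ρ f)
  have h3 : HasDerivAt (fun t : ℝ => iteratedFDeriv ℝ k s (ρ f + t • ρ v))
      (fderiv ℝ (iteratedFDeriv ℝ k s) (ρ f) (ρ v)) 0 :=
    h1.hasFDerivAt.comp_hasDerivAt_of_eq (0 : ℝ) h2 (by simp)
  have h4 := ((ContinuousMultilinearMap.apply ℝ (fun _ : Fin k => X) Y
    (fun i => ρ (h i.rev))).hasFDerivAt (x := iteratedFDeriv ℝ k s (ρ f + (0 : ℝ) • ρ v))).comp_hasDerivAt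
      (0 : ℝ) h3
  have h5 := hasDerivAt_iff_tendsto_slope_zero.1 h4
  simp only [Function.comp_def, zero_add, zero_smul, add_zero,
    ContinuousMultilinearMap.apply_apply] at h5
  -- The iterated derivative takes the newest direction in its first slot, whereas `Fin.snoc`
  -- appends it at the end. The reversed indices reconcile the two conventions.
  have h6 : iteratedFDeriv ℝ (k + 1) s (ρ f) (fun i => ρ (Fin.snoc (α := fun _ => F) h v i.rev)) =
      fderiv ℝ (iteratedFDeriv ℝ k s) (ρ f) (ρ v) (fun i => ρ (h i.rev)) := by
    rw [iteratedFDeriv_succ_apply_left]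
    congr 2
    · simp
    · funext i
      simp [Fin.tail, Fin.rev_succ]
  rw [h6]
  simpa using h5

/-- Every seminorm of `J y` is at most a multiple of the one norm of `y`, so the nonlinear term
costs no index. Its value is bounded on all of `U` by hypothesis and its derivatives are bounded
near each point by continuity. Only the affine part contributes `r` and `b`. -/
theorem IsNormedPerturbationOn.isSmoothTameOn (hF' : WithSeminorms (Grading.seminorm (F := F')))
    {Φ : F → F'} {U : Set F} (hΦ : IsNormedPerturbationOn Φ U) : IsSmoothTameOn Φ U := by
  obtain ⟨X, Y, _, _, _, _, c, L, ρ, J, s, V, ⟨r, b, C, hL⟩, hV, hs, hρ, ⟨B, hB⟩, h⟩ := hΦ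
  choose K hK0 hK using exists_gnorm_le_of_normedSpace hF' J
  have hs' : ∀ f ∈ U, ContDiffAt ℝ ∞ s (ρ f) := fun f hf =>
    hs.contDiffAt (hV.mem_nhds (hρ hf))
  have hcont : ∀ (k : ℕ), ContinuousOn (fun p : F × (Fin k → F) =>
      iteratedFDeriv ℝ k s (ρ p.1) (fun i => ρ (p.2 i.rev))) (U ×ˢ univ) := by
    intro k p hp
    have h1 : ContinuousAt (iteratedFDeriv ℝ k s) (ρ p.1) :=
      ((hs' p.1 hp.1).iteratedFDeriv_right (m := 0) (i := k) (by exact_mod_cast le_top)).continuousAt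
    have h2 : ContinuousAt (fun p : F × (Fin k → F) => iteratedFDeriv ℝ k s (ρ p.1)) p :=
      ContinuousAt.comp (f := fun p : F × (Fin k → F) => ρ p.1) h1
        (ρ.continuous.comp continuous_fst).continuousAt
    refine (ContinuousAt.eval h2 (?_ : ContinuousAt
      (fun p : F × (Fin k → F) => fun i : Fin k => ρ (p.2 i.rev)) p)).continuousWithinAt
    exact (continuous_pi fun i => ρ.continuous.comp
      ((continuous_apply i.rev).comp continuous_snd)).continuousAt
  refine ⟨⟨r, b, fun n => (gnorm n c + |C n|) + K n * |B|, fun n hn f hf => ?_⟩,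
    fun k f h => affineDeriv c L k f h + J (iteratedFDeriv ℝ k s (ρ f) (fun i => ρ (h i.rev))),
    fun f hf _ => ?_, fun k f hf h v => ?_, fun k => ?_, fun k f hf h => ?_⟩
  · rw [h f hf, add_mul]
    refine (gnorm_add_le n _ _).trans (add_le_add ?_ ((hK n _).trans ?_))
    · simpa [affineDeriv] using gnorm_affineDeriv_le (c := c) hL 0 n hn f 0
    · have h1 : ‖s (ρ f)‖ ≤ |B| := (hB _ (hρ hf)).trans (le_abs_self B)
      have h2 := gnorm_nonneg (n + r) f
      calc K n * ‖s (ρ f)‖ ≤ K n * |B| * 1 := by rw [mul_one]; gcongr; exact (hK0 n).le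
        _ ≤ _ := by
          have := (hK0 n).le
          gcongr
          linarith
  · rw [h f hf]
    simp [affineDeriv]
  · have h1 := (J.continuous.tendsto _).comp (tendsto_slope_iteratedFDeriv ρ (hs' f hf) k h v)
    refine (h1.const_add (affineDeriv c L (k + 1) f (Fin.snoc (α := fun _ => F) h v))).congr' ?_
    filter_upwards [self_mem_nhdsWithin] with t ht
    rw [← affineDeriv_slope c L k f h v ht, Function.comp_apply, map_smul, map_sub, ← smul_add]
    congr 1
    abel
  · exact (continuous_affineDeriv c L k).continuousOn.add (J.continuous.comp_continuousOn (hcont k))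
  · have h1 := (hcont k (f, h) ⟨hf, mem_univ _⟩).norm
    -- This neighbourhood serves all seminorms simultaneously, since the bound is on the norm in
    -- `Y`.
    have h2 := h1.eventually (gt_mem_nhds (lt_add_one _))
    rw [eventually_nhdsWithin_iff] at h2
    set N : ℝ := ‖iteratedFDeriv ℝ k s (ρ f) (fun i => ρ (h i.rev))‖ + 1 with hN
    have hN0 : 0 ≤ N := by positivity
    refine ⟨_, h2, r, b, fun n => (gnorm n c + |C n|) + K n * N, fun n hn p hp hpU => ?_⟩
    have h3 := hp ⟨hpU, mem_univ _⟩
    rw [add_mul]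
    refine (gnorm_add_le n _ _).trans (add_le_add (gnorm_affineDeriv_le hL k n hn _ _) ?_)
    refine (hK n _).trans ?_
    have h4 : 0 ≤ ∑ i, gnorm (n + r) (p.2 i) := Finset.sum_nonneg fun i _ => gnorm_nonneg _ _
    have h5 := gnorm_nonneg (n + r) p.1
    have := (hK0 n).le
    calc _ ≤ K n * N * 1 := by rw [mul_one]; gcongr
      _ ≤ _ := by gcongr; linarith

end FiniteType

/-! ## The logarithmic derivative and forms with trivial monodromy -/

section Monodromy

variable {E : Type*} [NormedAddCommGroup E] [NormedSpace ℂ E] [CompleteSpace E]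
  {G : Type*} [TopologicalSpace G] [ChartedSpace E G] [Group G] [LieGroup 𝓘(ℂ, E) ω G]

/-- The left logarithmic derivative `f⁻¹ df`. -/
def loopForm (f : HolLoopGroup E G) : HolForm E :=
  HolForm.ofFun (fun z => leftLogDeriv f (unitOf z))
    (differentiableOn_of_hasHolLogDerivAt isOpen_compl_singleton fun _ hw => f.hasHolLogDerivAt hw)

lemma loopForm_apply (f : HolLoopGroup E G) (u : ℂˣ) : loopForm f u = leftLogDeriv f u := by
  rw [loopForm, HolForm.ofFun_apply, unitOf_val]

lemma hasHolLogDerivAt_loopForm (f : HolLoopGroup E G) {z : ℂ} (hz : z ≠ 0) :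
    HasHolLogDerivAt (fun z => f (unitOf z)) (loopForm f (unitOf z)) z := by
  rw [loopForm_apply]
  exact f.hasHolLogDerivAt hz

lemma loopForm_eq {f : HolLoopGroup E G} {α : HolForm E}
    (h : ∀ z : ℂ, z ≠ 0 → HasHolLogDerivAt (fun z => f (unitOf z)) (α (unitOf z)) z) :
    loopForm f = α := by
  ext u
  have := (hasHolLogDerivAt_loopForm f u.ne_zero).unique (h u u.ne_zero)
  simpa using this

lemma HolLoopGroup.mul_apply (f g : HolLoopGroup E G) (u : ℂˣ) : (f * g) u = f u * g u := rfl

lemma HolLoopGroup.inv_apply (f : HolLoopGroup E G) (u : ℂˣ) : (f⁻¹) u = (f u)⁻¹ := rfl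

lemma HolLoopGroup.ext {f g : HolLoopGroup E G} (h : ∀ u, f u = g u) : f = g :=
  Subtype.ext (funext h)

variable (E) in
/-- The constant maps. -/
def constLoop (g : G) : HolLoopGroup E G := ⟨fun _ => g, mdifferentiable_const⟩

lemma loopForm_constLoop_mul (g : G) (f : HolLoopGroup E G) :
    loopForm (constLoop E g * f) = loopForm f :=
  loopForm_eq fun _ hz => (hasHolLogDerivAt_loopForm f hz).const_mul g

lemma loopForm_mul_inv_apply (f g : HolLoopGroup E G) (u : ℂˣ) :
    loopForm (f * g⁻¹) u = adjointMap E (g u) (loopForm f u - loopForm g u) := by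
  have h1 := (hasHolLogDerivAt_loopForm f u.ne_zero).mul_inv (hasHolLogDerivAt_loopForm g u.ne_zero)
  have := (hasHolLogDerivAt_loopForm (f * g⁻¹) u.ne_zero).unique h1
  simpa using this

lemma loopForm_one : loopForm (1 : HolLoopGroup E G) = 0 := by
  ext u
  have := loopForm_mul_inv_apply (1 : HolLoopGroup E G) 1 u
  simpa using this

lemma loopForm_mul_apply (f g : HolLoopGroup E G) (u : ℂˣ) :
    loopForm (f * g) u = adjointMap E (g u)⁻¹ (loopForm f u) + loopForm g u := by
  have h1 := (hasHolLogDerivAt_loopForm f u.ne_zero).mul (hasHolLogDerivAt_loopForm g u.ne_zero)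
  have := (hasHolLogDerivAt_loopForm (f * g) u.ne_zero).unique h1
  simpa using this

/-- The covering map `w ↦ e^w` of `ℂ*`. -/
def expUnit (w : ℂ) : ℂˣ := Units.mk0 (Complex.exp w) (Complex.exp_ne_zero w)

@[simp] lemma val_expUnit (w : ℂ) : (expUnit w : ℂ) = Complex.exp w := rfl

@[simp] lemma unitOf_exp (w : ℂ) : unitOf (Complex.exp w) = expUnit w :=
  Units.ext (val_unitOf (Complex.exp_ne_zero w))

@[simp] lemma expUnit_zero : expUnit 0 = 1 := Units.ext (by simp)

lemma expUnit_log (u : ℂˣ) : expUnit (Complex.log u) = u :=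
  Units.ext (Complex.exp_log u.ne_zero)

lemma expUnit_add_two_pi_I (w : ℂ) : expUnit (w + 2 * π * I) = expUnit w :=
  Units.ext (Complex.exp_periodic w)

/-- The pull-back of a form under `w ↦ e^w`. -/
def expForm (α : HolForm E) (w : ℂ) : E := Complex.exp w • α (expUnit w)

lemma differentiable_expForm (α : HolForm E) : Differentiable ℂ (expForm α) := by
  intro w
  have h1 := (α.differentiableOn.differentiableAt
    (isOpen_compl_singleton.mem_nhds (Complex.exp_ne_zero w))).comp w Complex.differentiableAt_exp
  have h2 : (fun w => α (expUnit w)) = (fun z => α (unitOf z)) ∘ Complex.exp := by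
    funext w; simp
  rw [← h2] at h1
  exact Complex.differentiableAt_exp.smul h1

lemma hasHolLogDerivAt_expUnit (f : HolLoopGroup E G) (w : ℂ) :
    HasHolLogDerivAt (fun w => f (expUnit w)) (expForm (loopForm f) w) w := by
  have := (hasHolLogDerivAt_loopForm f (Complex.exp_ne_zero w)).comp (Complex.hasDerivAt_exp w)
  simpa [expForm] using this

/-- Pulled back by the exponential, both maps live on the convex set ℂ, where uniqueness applies. -/
lemma HolLoopGroup.eq_of_loopForm_eq {f g : HolLoopGroup E G} (h : loopForm f = loopForm g)
    (h1 : f 1 = g 1) : f = g := by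
  refine HolLoopGroup.ext fun u => ?_
  have := eqOn_of_hasLogDerivWithinAt convex_univ
    (fun w _ => hasHolLogDerivAt_expUnit f w) (fun w _ => h ▸ hasHolLogDerivAt_expUnit g w)
    (mem_univ 0) (by simpa using h1) (mem_univ (Complex.log u))
  simpa [expUnit_log] using this

/-- The restriction to the path `t ↦ 2πit` of a primitive of the pull-back of a form. -/
lemma hasLogDerivWithinAt_two_pi_I {α : HolForm E} {F : ℂ → G}
    (hF : ∀ w, HasHolLogDerivAt F (expForm α w) w) (t : ℝ) :
    HasLogDerivWithinAt (fun t : ℝ => F (2 * π * I * t))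
      (toSpanSingleton ℝ ((2 * π * I : ℂ) • expForm α (2 * π * I * t))) univ t := by
  have hc : HasDerivWithinAt (fun t : ℝ => (2 * π * I * t : ℂ)) (2 * π * I) univ t := by
    have := (Complex.ofRealCLM.hasDerivAt (x := t)).const_mul (2 * π * I : ℂ)
    simpa using this.hasDerivWithinAt (s := univ)
  exact (hF _).comp_path hc

lemma hasDerivAt_expUnit_two_pi_I (t : ℝ) : HasDerivAt (fun t : ℝ => (expUnit (2 * π * I * t) : ℂ))
    (2 * π * I * Complex.exp (2 * π * I * t)) t := by
  have h1 : HasDerivAt (fun t : ℝ => (2 * π * I * t : ℂ)) (2 * π * I) t := by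
    simpa using (Complex.ofRealCLM.hasDerivAt (x := t)).const_mul (2 * π * I : ℂ)
  rw [mul_comm (2 * π * I : ℂ) (Complex.exp _)]
  exact h1.cexp

lemma loopForm_mem_trivialMonodromyLocus (f : HolLoopGroup E G) :
    loopForm f ∈ trivialMonodromyLocus E G := by
  intro c hc hc0 hc1
  -- The solution along `c` is `f` itself along `c`, normalised at the base point; it closes up
  -- because `c` does.
  refine ⟨fun t => (f 1)⁻¹ * f (c t), isDevelopment_iff.2 fun t => ?_, by simp [hc0], by simp [hc1]⟩
  refine HasLogDerivWithinAt.const_mul _ ?_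
  have h1 := (hc.differentiable one_ne_zero t).hasDerivAt.hasDerivWithinAt (s := univ)
  have := (hasHolLogDerivAt_loopForm f (c t).ne_zero).comp_path h1
  simpa using this

/-- A form whose pull-back under `w ↦ e^w` has a primitive `F` with `F(2πi) = F(0)` is a
logarithmic derivative. -/
lemma exists_loopForm_eq_of_two_pi_I {α : HolForm E} {F : ℂ → G} (hF0 : F 0 = 1)
    (hF : ∀ w, HasHolLogDerivAt F (expForm α w) w) (h1 : F (2 * π * I) = 1) :
    ∃ f : HolLoopGroup E G, loopForm f = α ∧ f 1 = 1 := by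
  -- The pulled-back form is `2πi`-periodic, so the translate of `F` is again a primitive. It has
  -- the same value at `0` by hypothesis.
  have hper : Function.Periodic F (2 * π * I) := fun w => by
    have hF' : ∀ w, HasHolLogDerivAt (fun w => F (w + 2 * π * I)) (expForm α w) w := fun w => by
      have := HasHolLogDerivAt.comp (c := fun w : ℂ => w + 2 * π * I) (w := w)
        (hF (w + 2 * π * I)) ((hasDerivAt_id w).add_const (2 * π * I : ℂ))
      simpa [expForm, expUnit_add_two_pi_I, Complex.exp_periodic w] using this
    exact eqOn_of_hasLogDerivWithinAt convex_univ (fun w _ => hF' w) (fun w _ => hF w)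
      (mem_univ (0 : ℂ)) (by simp [h1, hF0]) (mem_univ w)
  have hFexp : ∀ w w' : ℂ, Complex.exp w = Complex.exp w' → F w = F w' := by
    intro w w' h
    obtain ⟨n, rfl⟩ := Complex.exp_eq_exp_iff_exists_int.1 h
    exact hper.int_mul n w'
  let f : ℂˣ → G := fun u => F (Complex.log u)
  have hf : ∀ z : ℂ, z ≠ 0 → HasHolLogDerivAt (fun z => f (unitOf z)) (α (unitOf z)) z := by
    intro z hz
    -- A branch of the logarithm that is holomorphic near `z`, even where the principal branch
    -- jumps. Since `F` depends only on the exponential of its argument, either branch defines the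
    -- same map.
    let c : ℂ → ℂ := fun y => Complex.log z + Complex.log (y / z)
    have hc : HasDerivAt c z⁻¹ z := by
      have h : HasDerivAt (fun y : ℂ => y / z) z⁻¹ z := by
        simpa using (hasDerivAt_id z).div_const z
      have h2 := h.clog (by simp [hz])
      have h3 := h2.const_add (Complex.log z)
      rwa [div_self hz, div_one] at h3
    have hcz : c z = Complex.log z := by simp [c, hz]
    have h2 := (hF (c z)).comp hc
    have h3 : z⁻¹ • expForm α (c z) = α (unitOf z) := by
      have : expUnit (Complex.log z) = unitOf z := by
        rw [← unitOf_exp, Complex.exp_log hz]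
      rw [hcz, expForm, this, Complex.exp_log hz, smul_smul, inv_mul_cancel₀ hz, one_smul]
    rw [h3] at h2
    refine HasLogDerivWithinAt.congr_of_eventuallyEq h2 ?_
    filter_upwards [isOpen_ne.mem_nhds hz] with y hy
    refine hFexp _ _ ?_
    rw [val_unitOf hy, Complex.exp_log hy, Complex.exp_add, Complex.exp_log hz,
      Complex.exp_log (div_ne_zero hy hz), mul_div_cancel₀ _ hz]
  refine ⟨⟨f, mdifferentiable_of_hasHolLogDerivAt fun z hz => ⟨_, hf z hz⟩⟩, loopForm_eq hf, ?_⟩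
  change F (Complex.log ((1 : ℂˣ) : ℂ)) = 1
  simp [hF0]

/-- Only the loop t ↦ e^{2πit} is used. By uniqueness its closed development is the restriction of
the primitive `F`, which gives F(2πi) = 1. A constant left factor then adjusts the value at 1
without changing the form. -/
lemma exists_loopForm_eq {α : HolForm E} (hα : α ∈ trivialMonodromyLocus E G) (g : G) :
    ∃ f : HolLoopGroup E G, loopForm f = α ∧ f 1 = g := by
  obtain ⟨F, hF0, hF⟩ := exists_primitive G (differentiable_expForm α)
  obtain ⟨γ, hγ, hγ0, hγ1⟩ := hα (fun t => expUnit (2 * π * I * t)) (by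
      simp only [val_expUnit]
      exact (contDiff_const.mul Complex.ofRealCLM.contDiff).cexp) (by simp)
    (Units.ext (by simp [Complex.exp_two_pi_mul_I]))
  rw [isDevelopment_iff] at hγ
  have h1 : F (2 * π * I) = 1 := by
    have := eqOn_of_hasLogDerivWithinAt convex_univ (fun t _ => hasLogDerivWithinAt_two_pi_I hF t)
      (fun t _ => ?_) (mem_univ (0 : ℝ)) (by simp [hF0, hγ0]) (mem_univ (1 : ℝ)) (γ₂ := γ)
    · simpa [hγ1] using this
    · have := hγ t
      rw [(hasDerivAt_expUnit_two_pi_I t).deriv] at this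
      rwa [expForm, smul_smul]
  obtain ⟨f, hf, hf1⟩ := exists_loopForm_eq_of_two_pi_I hF0 hF h1
  refine ⟨constLoop E g * f, by rw [loopForm_constLoop_mul, hf], ?_⟩
  rw [HolLoopGroup.mul_apply, hf1, mul_one]
  rfl

variable (E G) in
lemma range_loopForm :
    range (loopForm : HolLoopGroup E G → HolForm E) = trivialMonodromyLocus E G := by
  ext α
  constructor
  · rintro ⟨f, rfl⟩
    exact loopForm_mem_trivialMonodromyLocus f
  · intro h
    obtain ⟨f, hf, -⟩ := exists_loopForm_eq h 1
    exact ⟨f, hf⟩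

variable (E G) in
lemma range_loopForm_prod : range (fun f : HolLoopGroup E G => (loopForm f, f 1)) =
    trivialMonodromyLocus E G ×ˢ univ := by
  ext ⟨α, g⟩
  constructor
  · rintro ⟨f, hf⟩
    obtain ⟨rfl, -⟩ := Prod.ext_iff.1 hf
    exact ⟨loopForm_mem_trivialMonodromyLocus f, mem_univ _⟩
  · rintro ⟨h, -⟩
    obtain ⟨f, hf, hf1⟩ := exists_loopForm_eq h g
    exact ⟨f, Prod.ext hf hf1⟩

end Monodromy

/-! ## The logarithmic derivative is a topological embedding -/

section Embedding

variable {E : Type*} [NormedAddCommGroup E] [NormedSpace ℂ E] [CompleteSpace E]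
  {G : Type*} [TopologicalSpace G] [ChartedSpace E G] [Group G] [LieGroup 𝓘(ℂ, E) ω G]

lemma differentiableAt_adjointMap_loop (f : HolLoopGroup E G) {z : ℂ} (hz : z ≠ 0) :
    DifferentiableAt ℂ (fun z => adjointMap E (f (unitOf z))) z :=
  (f.hasHolLogDerivAt hz).differentiableAt_adjointMap

/-- The pointwise adjoint action of a loop on forms. -/
def adForm (f : HolLoopGroup E G) : HolForm E →ₗ[ℝ] HolForm E where
  toFun β := HolForm.ofFun (fun z => adjointMap E (f (unitOf z)) (β (unitOf z))) fun _ hz =>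
    ((differentiableAt_adjointMap_loop f hz).clm_apply (β.differentiableOn.differentiableAt
      (isOpen_compl_singleton.mem_nhds hz))).differentiableWithinAt
  map_add' _ _ := HolForm.ext fun u => (adjointMap E (f (unitOf u))).map_add _ _
  map_smul' c _ := HolForm.ext fun u =>
    ((adjointMap E (f (unitOf u))).restrictScalars ℝ).map_smul c _

lemma adForm_apply (f : HolLoopGroup E G) (β : HolForm E) (u : ℂˣ) :
    adForm f β u = adjointMap E (f u) (β u) := by
  change adjointMap E (f (unitOf u)) (β (unitOf u)) = _
  rw [unitOf_val]

@[simp] lemma adForm_inv_adForm (f : HolLoopGroup E G) (β : HolForm E) :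
    adForm f⁻¹ (adForm f β) = β := by
  ext u; simp [adForm_apply, HolLoopGroup.inv_apply]

@[simp] lemma adForm_adForm_inv (f : HolLoopGroup E G) (β : HolForm E) :
    adForm f (adForm f⁻¹ β) = β := by
  ext u; simp [adForm_apply, HolLoopGroup.inv_apply]

/-- Along the loop the adjoint operators are continuous, hence bounded in norm on the compact
annulus, so no index is lost. -/
lemma exists_gnorm_adForm_le (f : HolLoopGroup E G) (n : ℕ) :
    ∃ C : ℝ, ∀ β, gnorm n (adForm f β) ≤ C * gnorm n β := by
  have hc : Continuous fun u => adjointMap E (f u) := continuous_iff_continuousAt.2 fun u =>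
    continuousAt_comp_unitOf_iff.1 (differentiableAt_adjointMap_loop f u.ne_zero).continuousAt
  obtain ⟨C, hC⟩ := (isCompact_annulus n).exists_bound_of_continuousOn hc.continuousOn
  refine ⟨C, fun β => HolForm.gnorm_le fun u hu => ?_⟩
  rw [adForm_apply]
  exact ContinuousLinearMap.le_of_opNorm_le_of_le _ (hC u hu) (β.norm_le_gnorm hu)

lemma isTameLinear_adForm (f : HolLoopGroup E G) : IsTameLinear (adForm f) := by
  choose C hC using exists_gnorm_adForm_le f
  exact ⟨0, 0, C, fun n _ β => hC n β⟩

lemma continuous_adForm (f : HolLoopGroup E G) : Continuous (adForm f) :=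
  continuous_of_gnorm_le HolForm.withSeminorms HolForm.withSeminorms _ fun n =>
    ⟨n, exists_gnorm_adForm_le f n⟩

lemma loopForm_mul_inv (f g : HolLoopGroup E G) :
    loopForm (f * g⁻¹) = adForm g (loopForm f - loopForm g) := by
  ext u
  rw [loopForm_mul_inv_apply, adForm_apply, HolForm.sub_apply]

lemma loopForm_mul (f g : HolLoopGroup E G) :
    loopForm (f * g) = adForm g⁻¹ (loopForm f) + loopForm g := by
  ext u
  rw [loopForm_mul_apply, HolForm.add_apply, adForm_apply, HolLoopGroup.inv_apply]

variable (E G) in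
/-- The inclusion of the loop group into the group of continuous maps. -/
def HolLoopGroup.toContinuousMap : HolLoopGroup E G → C(ℂˣ, G) := fun f => ⟨f, f.continuous⟩

lemma HolLoopGroup.isInducing_toContinuousMap :
    IsInducing (HolLoopGroup.toContinuousMap E G) := ⟨rfl⟩

variable (E G) in
lemma HolLoopGroup.continuousMul : ContinuousMul (HolLoopGroup E G) := by
  have : IsTopologicalGroup G := topologicalGroup_of_lieGroup 𝓘(ℂ, E) ω
  let ι : HolLoopGroup E G →* C(ℂˣ, G) :=
    { toFun := HolLoopGroup.toContinuousMap E G, map_one' := rfl, map_mul' := fun _ _ => rfl }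
  exact continuousMul_induced ι

variable (E G) in
lemma HolLoopGroup.t2Space [T2Space G] : T2Space (HolLoopGroup E G) := by
  have hinj : Function.Injective (HolLoopGroup.toContinuousMap E G) := fun f g h =>
    HolLoopGroup.ext fun u => DFunLike.congr_fun h u
  exact T2Space.of_injective_continuous hinj HolLoopGroup.isInducing_toContinuousMap.continuous

lemma HolLoopGroup.continuous_apply (u : ℂˣ) : Continuous fun f : HolLoopGroup E G => f u :=
  (ContinuousEvalConst.continuous_eval_const u).comp HolLoopGroup.isInducing_toContinuousMap.continuous

lemma HolLoopGroup.tendsto_one_iff {ι : Type*} {l : Filter ι} {h : ι → HolLoopGroup E G} :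
    Tendsto h l (𝓝 1) ↔ ∀ n, ∀ V ∈ 𝓝 (1 : G), ∀ᶠ i in l, ∀ u ∈ annulus n, h i u ∈ V := by
  rw [HolLoopGroup.isInducing_toContinuousMap.tendsto_nhds_iff,
    ContinuousMap.tendsto_nhds_compactOpen]
  constructor
  · intro H n V hV
    filter_upwards [H (annulus n) (isCompact_annulus n) (interior V) isOpen_interior
      fun u _ => mem_interior_iff_mem_nhds.2 hV] with i hi u hu
    exact interior_subset (hi hu)
  · intro H K hK U hU hKU
    rcases K.eq_empty_or_nonempty with rfl | ⟨u, hu⟩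
    · exact Eventually.of_forall fun i => mapsTo_empty _ _
    obtain ⟨n, hn⟩ := exists_subset_annulus hK
    filter_upwards [H n U (hU.mem_nhds (hKU hu))] with i hi v hv
    exact hi v (hn hv)

/-- Cauchy's estimate for logarithmic derivatives. -/
lemma norm_loopForm_le {h : HolLoopGroup E G} {n : ℕ} {η B : ℝ}
    (hh : ∀ u ∈ annulus (n + 1), h u ∈ (idChart E G).source ∧ ‖idChart E G (h u)‖ ≤ η ∧
      ‖leftCoframe E G (idChart E G (h u))‖ ≤ B) {u : ℂˣ} (hu : u ∈ annulus n) :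
    ‖loopForm h u‖ ≤ B * (η / (Real.exp (-(n : ℝ)) - Real.exp (-((n : ℝ) + 1)))) := by
  -- The gap between consecutive annuli at the inner edge. It is at most the gap at the outer edge,
  -- so discs of this radius centred in one annulus stay inside the next.
  set r : ℝ := Real.exp (-(n : ℝ)) - Real.exp (-((n : ℝ) + 1)) with hr
  have hr0 : 0 < r := sub_pos.2 (Real.exp_lt_exp.2 (by linarith))
  have hball : ∀ z ∈ Metric.closedBall (u : ℂ) r, z ≠ 0 ∧ unitOf z ∈ annulus (n + 1) := by
    intro z hz
    rw [mem_closedBall_iff_norm] at hz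
    have h1 : Real.exp (-((n : ℝ) + 1)) ≤ ‖z‖ := by
      have := norm_sub_norm_le (u : ℂ) z
      rw [norm_sub_rev] at this
      have := hu.1
      linarith
    have h2 : ‖z‖ ≤ Real.exp ((n : ℝ) + 1) := by
      have h3 := norm_sub_norm_le z (u : ℂ)
      have h4 := hu.2
      have h5 : Real.exp (-(n : ℝ)) ≤ 1 := Real.exp_le_one_iff.2 (by simp)
      have h6 : 1 ≤ Real.exp (n : ℝ) := Real.one_le_exp (Nat.cast_nonneg n)
      have h7 : Real.exp ((n : ℝ) + 1) = Real.exp n * Real.exp 1 := Real.exp_add _ _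
      have h8 : (2 : ℝ) ≤ Real.exp 1 := by linarith [Real.add_one_le_exp (1 : ℝ)]
      have h9 := Real.exp_pos (-((n : ℝ) + 1))
      nlinarith
    have hz0 : z ≠ 0 := norm_pos_iff.1 ((Real.exp_pos _).trans_le h1)
    refine ⟨hz0, ?_⟩
    rw [annulus, mem_ofPred_eq, val_unitOf hz0]
    push_cast
    exact ⟨h1, h2⟩
  set k : ℂ → E := fun z => idChart E G (h (unitOf z)) with hk
  have hkd : ∀ z ∈ Metric.closedBall (u : ℂ) r, HasDerivAt k
      (leftFrame E G (k z) (loopForm h (unitOf z))) z := fun z hz =>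
    (hasHolLogDerivAt_loopForm h (hball z hz).1).hasDerivAt_idChart (hh _ (hball z hz).2).1
  have hd : DiffContOnCl ℂ k (Metric.ball (u : ℂ) r) := by
    refine DifferentiableOn.diffContOnCl fun z hz => ?_
    exact (hkd z (Metric.closure_ball_subset_closedBall hz)).differentiableAt.differentiableWithinAt
  have h1 := Complex.norm_deriv_le_of_forall_mem_sphere_norm_le hr0 hd
    (fun z hz => (hh _ (hball z (Metric.sphere_subset_closedBall hz)).2).2.1)
  have hmem : (u : ℂ) ∈ Metric.closedBall (u : ℂ) r := Metric.mem_closedBall_self hr0.le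
  obtain ⟨h2, -, h3⟩ := hh u (annulus_mono (Nat.le_succ n) hu)
  -- The coframe converts Cauchy's bound on the chart derivative into a bound on the logarithmic
  -- derivative.
  have h4 : loopForm h u = leftCoframe E G (k u) (deriv k u) := by
    rw [(hkd u hmem).deriv]
    have h5 : k u ∈ (idChart E G).target := by
      simpa [hk] using (idChart E G).map_source h2
    have := DFunLike.congr_fun (leftCoframe_leftFrame E G h5) (loopForm h (unitOf u))
    simpa using this.symm
  rw [h4]
  refine ContinuousLinearMap.le_of_opNorm_le_of_le _ ?_ h1
  simpa [hk] using h3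

lemma tendsto_loopForm_one : Tendsto (loopForm : HolLoopGroup E G → HolForm E) (𝓝 1) (𝓝 0) := by
  rw [HolForm.tendsto_nhds_iff]
  intro n
  simp only [sub_zero]
  set r : ℝ := Real.exp (-(n : ℝ)) - Real.exp (-((n : ℝ) + 1)) with hr
  have hr0 : 0 < r := sub_pos.2 (Real.exp_lt_exp.2 (by linarith))
  set B : ℝ := ‖leftCoframe E G 0‖ + 1
  have hB0 : 0 < B := by positivity
  rw [(Metric.nhds_basis_ball.tendsto_right_iff)]
  intro ε hε
  obtain ⟨η, hη0, hη⟩ : ∃ η : ℝ, 0 < η ∧ B * (η / r) < ε :=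
    ⟨ε * r / (2 * B), by positivity, by field_simp; linarith⟩
  have hcof : ∀ᶠ x in 𝓝 (0 : E), ‖leftCoframe E G x‖ ≤ B := by
    have hc : ContinuousAt (leftCoframe E G) 0 :=
      (contDiffOn_leftCoframe E G).continuousOn.continuousAt (idChart_target_mem_nhds E G)
    filter_upwards [hc.norm.eventually (gt_mem_nhds (lt_add_one _))] with x hx using hx.le
  have hchart : Tendsto (idChart E G) (𝓝 1) (𝓝 0) := by
    simpa [ContinuousAt] using (idChart E G).continuousAt (one_mem_idChart_source E G)
  have hV : {g : G | g ∈ (idChart E G).source ∧ ‖idChart E G g‖ ≤ η ∧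
      ‖leftCoframe E G (idChart E G g)‖ ≤ B} ∈ 𝓝 (1 : G) := by
    filter_upwards [idChart_source_mem_nhds E G, hchart.eventually hcof,
      hchart (Metric.closedBall_mem_nhds 0 hη0)] with g h1 h2 h3
    exact ⟨h1, by simpa using h3, h2⟩
  have hev := (HolLoopGroup.tendsto_one_iff (E := E) (G := G)).1 tendsto_id (n + 1) _ hV
  filter_upwards [hev] with h hh
  rw [mem_ball_zero_iff, Real.norm_of_nonneg (gnorm_nonneg _ _)]
  exact (HolForm.gnorm_le fun u hu => norm_loopForm_le hh hu).trans_lt hη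

/-- From δ(h) = Ad(f⁻¹)δ(hf⁻¹) + δ(f), continuity at `f` follows from continuity at 1. -/
lemma continuous_loopForm : Continuous (loopForm : HolLoopGroup E G → HolForm E) := by
  have := HolLoopGroup.continuousMul E G
  refine continuous_iff_continuousAt.2 fun f => ?_
  have h1 : Tendsto (fun h : HolLoopGroup E G => h * f⁻¹) (𝓝 f) (𝓝 1) := by
    simpa using (tendsto_id (α := HolLoopGroup E G) (x := 𝓝 f)).mul_const f⁻¹
  have h2 := ((continuous_adForm f⁻¹).tendsto 0).comp (tendsto_loopForm_one.comp h1)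
  have h3 := h2.add_const (loopForm f)
  rw [map_zero, zero_add] at h3
  refine h3.congr fun h => ?_
  simp [loopForm_mul_inv]

lemma expUnit_mem_annulus {n : ℕ} {w : ℂ} (hw : |w.re| ≤ n) : expUnit w ∈ annulus n := by
  rw [← unitOf_exp]
  exact unitOf_mem_annulus hw (Complex.norm_exp w)

lemma norm_expForm_le {n : ℕ} {w : ℂ} (hw : |w.re| ≤ n) (α : HolForm E) :
    ‖expForm α w‖ ≤ Real.exp n * gnorm n α := by
  rw [expForm, norm_smul]
  refine mul_le_mul ?_ (α.norm_le_gnorm (expUnit_mem_annulus hw)) (norm_nonneg _) (Real.exp_pos _).le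
  exact (expUnit_mem_annulus hw).2

lemma abs_log_re_le {n : ℕ} {u : ℂˣ} (hu : u ∈ annulus n) : |(Complex.log u).re| ≤ n := by
  have hu0 : 0 < ‖(u : ℂ)‖ := norm_pos_iff.2 u.ne_zero
  rw [Complex.log_re, abs_le]
  exact ⟨(Real.le_log_iff_exp_le hu0).2 hu.1, (Real.log_le_iff_le_exp hu0).2 hu.2⟩

/-- For `u` in the annulus the principal logarithm has real part at most `n` and imaginary part at
most `π` in absolute value. The segment from `0` has length at most `n + π` and stays in the strip
where the pulled-back form is controlled by one seminorm. -/
lemma norm_segForm_log_le (α : HolForm E) {n : ℕ} {u : ℂˣ} (hu : u ∈ annulus n) :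
    ‖segForm (expForm α) 0 (Complex.log u)‖ ≤ (n + π) * (Real.exp n * gnorm n α) := by
  have h1 := abs_log_re_le hu
  refine (norm_segForm_le (differentiable_expForm α) (C := Real.exp n * gnorm n α)
    fun z hz => norm_expForm_le ?_ α).trans ?_
  · obtain ⟨a, b, ha, hb, hab, rfl⟩ := hz
    rw [smul_zero, zero_add, Complex.smul_re, smul_eq_mul, abs_mul, abs_of_nonneg hb]
    exact (mul_le_of_le_one_left (abs_nonneg _) (by linarith)).trans h1
  · have h2 : ‖Complex.log u - 0‖ ≤ n + π := by
      rw [sub_zero]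
      refine (Complex.norm_le_abs_re_add_abs_im _).trans (add_le_add h1 ?_)
      rw [Complex.log_im]
      exact Complex.abs_arg_le_pi _
    have := gnorm_nonneg n α
    gcongr

lemma HolLoopGroup.apply_eq_mul_dev (h : HolLoopGroup E G) (u : ℂˣ)
    (hu : ‖segForm (expForm (loopForm h)) 0 (Complex.log u)‖ < devRadius E G) :
    h u = h 1 * (idChart E G).symm (dev E G (segForm (expForm (loopForm h)) 0 (Complex.log u)) 1) := by
  have := eq_mul_dev_segForm (differentiable_expForm (loopForm h)) (G := G) (p := 0)
    (q := Complex.log u) (fun z _ => hasHolLogDerivAt_expUnit h z) hu 1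
  simpa [expUnit_log] using this

/-- Each value is `h 1` times the development of a form along a logarithmic segment. These segment
forms tend to zero uniformly on the annulus, and `dev` is continuous at zero. -/
lemma tendsto_one_of_tendsto_loopForm {ι : Type*} {l : Filter ι} {h : ι → HolLoopGroup E G}
    (h1 : Tendsto (fun i => loopForm (h i)) l (𝓝 0)) (h2 : Tendsto (fun i => h i 1) l (𝓝 1)) :
    Tendsto h l (𝓝 1) := by
  have : IsTopologicalGroup G := topologicalGroup_of_lieGroup 𝓘(ℂ, E) ω
  rw [HolLoopGroup.tendsto_one_iff]
  intro n V hV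
  have hmul : Tendsto (fun p : G × E => p.1 * (idChart E G).symm p.2) (𝓝 1 ×ˢ 𝓝 0) (𝓝 1) := by
    have := (tendsto_fst (f := 𝓝 (1 : G)) (g := 𝓝 (0 : E))).mul
      ((tendsto_idChart_symm E G).comp tendsto_snd)
    simpa using this
  obtain ⟨V₁, hV₁, V₂, hV₂, hV₁₂⟩ := mem_prod_iff.1 (hmul hV)
  obtain ⟨η, hη, hηV⟩ := Metric.mem_nhds_iff.1 hV₂
  have hdev : ContinuousAt (dev E G) 0 :=
    (contDiffOn_dev E G).continuousOn.continuousAt (Metric.ball_mem_nhds 0 (devRadius_pos E G))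
  have hev : ∀ᶠ β in 𝓝 (0 : C(unitInterval, E)), ‖dev E G β‖ < η ∧ ‖β‖ < devRadius E G := by
    have h3 := hdev.norm
    rw [ContinuousAt, dev_zero, norm_zero] at h3
    refine (h3.eventually (gt_mem_nhds hη)).and ?_
    filter_upwards [Metric.ball_mem_nhds 0 (devRadius_pos E G)] with β hβ
    simpa using hβ
  obtain ⟨ε, hε, hεη⟩ := Metric.eventually_nhds_iff.1 hev
  have h3 : Tendsto (fun i => (n + π) * (Real.exp n * gnorm n (loopForm (h i)))) l (𝓝 0) := by
    have h4 := HolForm.tendsto_nhds_iff.1 h1 n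
    simp only [sub_zero] at h4
    simpa using (h4.const_mul (Real.exp n)).const_mul ((n : ℝ) + π)
  filter_upwards [h3.eventually (gt_mem_nhds hε), h2 hV₁] with i hi hi' u hu
  obtain ⟨h5, h6⟩ := hεη (y := segForm (expForm (loopForm (h i))) 0 (Complex.log u)) (by
    rw [dist_zero_right]
    exact (norm_segForm_log_le (loopForm (h i)) hu).trans_lt hi)
  rw [(h i).apply_eq_mul_dev u h6]
  refine hV₁₂ (mk_mem_prod hi' (hηV ?_))
  rw [mem_ball_zero_iff]
  exact (ContinuousMap.norm_coe_le_norm _ _).trans_lt h5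

variable (E G) in
theorem isEmbedding_loopForm_prod :
    IsEmbedding fun f : HolLoopGroup E G => (loopForm f, f 1) := by
  have := HolLoopGroup.continuousMul E G
  have : IsTopologicalGroup G := topologicalGroup_of_lieGroup 𝓘(ℂ, E) ω
  refine ⟨isInducing_iff_nhds.2 fun f => le_antisymm ?_ ?_, fun f g h =>
    HolLoopGroup.eq_of_loopForm_eq (congrArg Prod.fst h) (congrArg Prod.snd h)⟩
  · exact ((continuous_loopForm.prodMk (HolLoopGroup.continuous_apply 1)).tendsto f).le_comap
  · set l := comap (fun f : HolLoopGroup E G => (loopForm f, f 1)) (𝓝 (loopForm f, f 1)) with hl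
    have h0 : Tendsto (fun f : HolLoopGroup E G => (loopForm f, f 1)) l
        (𝓝 (loopForm f, f 1)) := tendsto_comap
    rw [nhds_prod_eq, tendsto_prod_iff'] at h0
    -- Right translation by `f⁻¹` reduces continuity of the inverse at `f` to the case of the
    -- identity.
    have h1 : Tendsto (fun h : HolLoopGroup E G => loopForm (h * f⁻¹)) l (𝓝 0) := by
      have h2 := ((continuous_adForm f).tendsto 0).comp (tendsto_sub_nhds_zero_iff.2 h0.1)
      rw [map_zero] at h2
      exact h2.congr fun h => (loopForm_mul_inv h f).symm
    have h2 : Tendsto (fun h : HolLoopGroup E G => (h * f⁻¹) 1) l (𝓝 1) := by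
      have := h0.2.mul_const (f 1)⁻¹
      rwa [mul_inv_cancel] at this
    have h3 := (tendsto_one_of_tendsto_loopForm h1 h2).mul_const f
    simp only [inv_mul_cancel_right, one_mul] at h3
    exact tendsto_id'.1 h3

end Embedding

/-! ## The holonomy along the unit circle -/

section Holonomy

/-- The constant paths. -/
def constPath (E : Type*) [NormedAddCommGroup E] [NormedSpace ℂ E] : E →L[ℂ] C(unitInterval, E) :=
  LinearMap.mkContinuous
    { toFun := fun x => ContinuousMap.const unitInterval x
      map_add' := fun _ _ => rfl
      map_smul' := fun _ _ => rfl } 1 fun x => by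
    rw [one_mul]
    exact (ContinuousMap.norm_le _ (norm_nonneg x)).2 fun _ => le_rfl

lemma constPath_apply {E : Type*} [NormedAddCommGroup E] [NormedSpace ℂ E] (x : E)
    (t : unitInterval) : constPath E x t = x := rfl

variable {E : Type*} [NormedAddCommGroup E] [NormedSpace ℂ E] [CompleteSpace E]

lemma volterra_constPath (x : E) (t : unitInterval) : volterra E (constPath E x) t = (t : ℝ) • x := by
  rw [volterra_apply, pathPrimitive]
  simp [constPath_apply]

/-- The pull-back of a form to the unit circle, parametrised by the unit interval. -/
def circlePath (E : Type*) [NormedAddCommGroup E] [NormedSpace ℂ E] [CompleteSpace E] :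
    HolForm E →ₗ[ℝ] C(unitInterval, E) where
  toFun β := ⟨fun t => (2 * π * I : ℂ) • expForm β (2 * π * I * (t : ℝ)), by
    have := (differentiable_expForm β).continuous
    fun_prop⟩
  map_add' α β := by
    ext t
    simp [expForm]
  map_smul' c α := by
    ext t
    simp [expForm, smul_comm c]

lemma circlePath_apply (β : HolForm E) (t : unitInterval) :
    circlePath E β t = (2 * π * I : ℂ) • expForm β (2 * π * I * (t : ℝ)) := rfl

lemma norm_circlePath_le (β : HolForm E) : ‖circlePath E β‖ ≤ 2 * π * gnorm 0 β := by
  have h0 := gnorm_nonneg 0 β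
  refine (ContinuousMap.norm_le _ (by positivity)).2 fun t => ?_
  have h := norm_expForm_le (n := 0) (w := 2 * π * I * (t : ℝ)) (by simp) β
  rw [circlePath_apply, norm_smul]
  simp only [Nat.cast_zero, Real.exp_zero, one_mul] at h
  have h2 : ‖(2 * π * I : ℂ)‖ = 2 * π := by simp [abs_of_pos Real.pi_pos]
  rw [h2]
  gcongr

variable (E) in
lemma continuous_circlePath : Continuous (circlePath E) :=
  continuous_of_gnorm_le HolForm.withSeminorms (withSeminorms_normed C(unitInterval, E)) _
    fun _ => ⟨0, 2 * π, norm_circlePath_le⟩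

lemma circlePath_periodForm (x : E) : circlePath E (periodForm E x) = constPath E x := by
  ext t
  have h1 := Complex.exp_ne_zero (2 * π * I * (t : ℝ))
  have h2 := Complex.two_pi_I_ne_zero
  rw [circlePath_apply, expForm, periodForm_apply, smul_smul, smul_smul, val_expUnit,
    constPath_apply, mul_inv_cancel₀ (mul_ne_zero h2 h1), one_smul]

/-- The residual multiple of dz/z pulls back to a constant path on the circle. This is why pairs of
a path and a vector suffice to describe the holonomy. -/
lemma circlePath_exactPart_add (β : HolForm E) :
    circlePath E (exactPart E β : HolForm E) + constPath E (period E β) = circlePath E β := by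
  rw [coe_exactPart, map_sub, circlePath_periodForm, sub_add_cancel]

variable {G : Type*} [TopologicalSpace G] [ChartedSpace E G] [Group G] [LieGroup 𝓘(ℂ, E) ω G]

lemma eq_dev_circlePath {β : HolForm E} (hβ : ‖circlePath E β‖ < devRadius E G) {F : ℂ → G}
    (hF0 : F 0 = 1) (hF : ∀ w, HasHolLogDerivAt F (expForm β w) w) :
    F (2 * π * I) = (idChart E G).symm (dev E G (circlePath E β) 1) := by
  have h := eq_mul_dev G hβ (γ := fun t : ℝ => F (2 * π * I * t)) (fun t ht => ?_) 1
  · simpa [hF0] using h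
  · have h1 := (hasLogDerivWithinAt_two_pi_I hF t).mono (subset_univ (Icc 0 1))
    rw [circlePath_apply, projIcc_of_mem _ ht]
    exact h1

/-- For a small form, trivial monodromy means that the development along the unit circle is
closed. -/
lemma mem_trivialMonodromyLocus_iff {β : HolForm E} (hβ : ‖circlePath E β‖ < devRadius E G) :
    β ∈ trivialMonodromyLocus E G ↔ dev E G (circlePath E β) 1 = 0 := by
  constructor
  · intro h
    obtain ⟨f, rfl, hf⟩ := exists_loopForm_eq h 1
    have h1 := eq_dev_circlePath hβ (F := fun w => f (expUnit w)) (by simpa using hf)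
      (hasHolLogDerivAt_expUnit f)
    have h2 : expUnit (2 * π * I) = 1 := by
      simpa using expUnit_add_two_pi_I 0
    rw [h2, hf] at h1
    rw [← (idChart E G).right_inv (dev_mem G hβ 1), ← h1, idChart_one]
  · intro h
    obtain ⟨F, hF0, hF⟩ := exists_primitive G (differentiable_expForm β)
    have h1 := eq_dev_circlePath hβ hF0 hF
    rw [h, idChart_symm_zero] at h1
    obtain ⟨f, rfl, -⟩ := exists_loopForm_eq_of_two_pi_I hF0 hF h1
    exact loopForm_mem_trivialMonodromyLocus f

variable (E G)

/-- The derivative at `0` of `straightening`. -/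
def straighteningDeriv (E : Type*) [NormedAddCommGroup E] [NormedSpace ℂ E] [CompleteSpace E] :
    (C(unitInterval, E) × E) ≃L[ℂ] (C(unitInterval, E) × E) :=
  let v : C(unitInterval, E) →L[ℂ] E := (ContinuousMap.evalCLM ℂ (1 : unitInterval)).comp (volterra E)
  ContinuousLinearEquiv.equivOfInverse
    ((ContinuousLinearMap.fst ℂ _ _).prod
      (v.comp (ContinuousLinearMap.fst ℂ _ _) + ContinuousLinearMap.snd ℂ _ _))
    ((ContinuousLinearMap.fst ℂ _ _).prod
      (ContinuousLinearMap.snd ℂ _ _ - v.comp (ContinuousLinearMap.fst ℂ _ _)))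
    (fun p => Prod.ext rfl (by simp)) (fun p => Prod.ext rfl (by simp))

/-- The map `(ξ, x) ↦ (ξ, m(ξ + x))` where `m` is the endpoint of the development. -/
def straightening (p : C(unitInterval, E) × E) : C(unitInterval, E) × E :=
  (p.1, dev E G (p.1 + constPath E p.2) 1)

/-- `dev` linearises to integration, and a constant path `x` integrates to `x` over the unit
interval. The derivative is therefore a shear, invertible irrespective of the integral of the first
component. -/
lemma hasFDerivAt_straightening : HasFDerivAt (straightening E G)
    (straighteningDeriv E : C(unitInterval, E) × E →L[ℂ] C(unitInterval, E) × E) 0 := by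
  let A : C(unitInterval, E) × E →L[ℂ] C(unitInterval, E) :=
    ContinuousLinearMap.fst ℂ _ _ + (constPath E).comp (ContinuousLinearMap.snd ℂ _ _)
  have h1 : HasFDerivAt (fun p : C(unitInterval, E) × E => dev E G (A p)) ((volterra E).comp A) 0 :=
    HasFDerivAt.comp (g := dev E G) (f := A) 0
      (by rw [map_zero]; exact hasFDerivAt_dev_zero E G) A.hasFDerivAt
  have h2 := (ContinuousMap.evalCLM ℂ (M := E) (1 : unitInterval)).hasFDerivAt.comp
    (0 : C(unitInterval, E) × E) h1
  have h3 := ((ContinuousLinearMap.fst ℂ C(unitInterval, E) E).hasFDerivAt (x := 0)).prodMk h2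
  refine h3.congr_fderiv (ContinuousLinearMap.ext fun p => Prod.ext rfl ?_)
  change volterra E (p.1 + constPath E p.2) 1 = volterra E p.1 1 + p.2
  rw [map_add, ContinuousMap.add_apply, volterra_constPath]
  simp

lemma contDiffOn_straightening : ContDiffOn ℂ ∞ (straightening E G)
    {p | ‖p.1 + constPath E p.2‖ < devRadius E G} := by
  have h1 : ContDiff ℂ ∞ fun p : C(unitInterval, E) × E => p.1 + constPath E p.2 :=
    contDiff_fst.add ((constPath E).contDiff.comp contDiff_snd)
  have h2 := (contDiffOn_dev E G).comp h1.contDiffOn (s := {p | ‖p.1 + constPath E p.2‖ < devRadius E G})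
    fun p hp => by simpa using hp
  exact contDiff_fst.contDiffOn.prodMk
    ((ContinuousMap.evalCLM ℂ (M := E) (1 : unitInterval)).contDiff.comp_contDiffOn h2)

lemma exists_straighteningHomeomorph :
    ∃ e : OpenPartialHomeomorph (C(unitInterval, E) × E) (C(unitInterval, E) × E),
      0 ∈ e.source ∧ (∀ p ∈ e.source, ‖p.1 + constPath E p.2‖ < devRadius E G ∧ ‖p‖ ≤ 1 ∧
        ‖straightening E G p‖ ≤ 1) ∧ (∀ p, e p = straightening E G p) ∧
      ContDiffOn ℝ ∞ e e.source ∧ ContDiffOn ℝ ∞ e.symm e.target := by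
  have h0 : straightening E G 0 = 0 := by
    simp [straightening]
  have hc := contDiffOn_straightening E G
  set U : Set (C(unitInterval, E) × E) := {p | ‖p.1 + constPath E p.2‖ < devRadius E G} with hU
  have hUo : IsOpen U := isOpen_lt (continuous_fst.add
    ((constPath E).continuous.comp continuous_snd)).norm continuous_const
  have hU0 : (0 : C(unitInterval, E) × E) ∈ U := by
    simpa [hU] using devRadius_pos E G
  -- Confining source and image to unit balls bounds the map and its inverse. Tame estimates are
  -- required on whole chart domains, and these bounds supply them for the nonlinear terms.
  set U' := (U ∩ straightening E G ⁻¹' Metric.ball 0 1) ∩ Metric.ball 0 1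
  have hU'o : IsOpen U' :=
    (hc.continuousOn.isOpen_inter_preimage hUo Metric.isOpen_ball).inter Metric.isOpen_ball
  obtain ⟨e, h1, h2, h3, h4⟩ := exists_openPartialHomeomorph_contDiffOn hU'o
    (hc.mono fun p hp => hp.1.1) (x := 0) ⟨⟨hU0, by simp [h0]⟩, by simp⟩
    (hasFDerivAt_straightening E G)
  refine ⟨e, h1, fun p hp => ⟨(h2 hp).1.1, ?_, ?_⟩, h3, ?_, h4.restrict_scalars ℝ⟩
  · exact (mem_ball_zero_iff.1 (h2 hp).2).le
  · exact (mem_ball_zero_iff.1 (h2 hp).1.2).le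
  · exact ((hc.mono fun p hp => (h2 hp).1.1).congr fun p _ => h3 p).restrict_scalars ℝ

/-- A local inverse of `straightening` at `0`. -/
def straighteningHomeomorph :
    OpenPartialHomeomorph (C(unitInterval, E) × E) (C(unitInterval, E) × E) :=
  (exists_straighteningHomeomorph E G).choose

lemma zero_mem_straighteningHomeomorph_source : 0 ∈ (straighteningHomeomorph E G).source :=
  (exists_straighteningHomeomorph E G).choose_spec.1

variable {E} in
lemma norm_lt_of_mem_straighteningHomeomorph_source {p : C(unitInterval, E) × E}
    (hp : p ∈ (straighteningHomeomorph E G).source) :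
    ‖p.1 + constPath E p.2‖ < devRadius E G ∧ ‖p‖ ≤ 1 ∧ ‖straightening E G p‖ ≤ 1 :=
  (exists_straighteningHomeomorph E G).choose_spec.2.1 p hp

lemma straighteningHomeomorph_apply (p : C(unitInterval, E) × E) :
    straighteningHomeomorph E G p = straightening E G p :=
  (exists_straighteningHomeomorph E G).choose_spec.2.2.1 p

lemma contDiffOn_straighteningHomeomorph :
    ContDiffOn ℝ ∞ (straighteningHomeomorph E G) (straighteningHomeomorph E G).source :=
  (exists_straighteningHomeomorph E G).choose_spec.2.2.2.1

lemma contDiffOn_straighteningHomeomorph_symm :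
    ContDiffOn ℝ ∞ (straighteningHomeomorph E G).symm (straighteningHomeomorph E G).target :=
  (exists_straighteningHomeomorph E G).choose_spec.2.2.2.2

variable {E} in
lemma straighteningHomeomorph_symm_fst {p : C(unitInterval, E) × E}
    (hp : p ∈ (straighteningHomeomorph E G).target) :
    ((straighteningHomeomorph E G).symm p).1 = p.1 := by
  have := congrArg Prod.fst ((straighteningHomeomorph E G).right_inv hp)
  rwa [straighteningHomeomorph_apply] at this

end Holonomy

/-! ## Submanifold charts for the forms with trivial monodromy -/

section GradedProducts

lemma withSeminorms_prod {F F' : Type*} [AddCommGroup F] [Module ℝ F] [TopologicalSpace F]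
    [IsTopologicalAddGroup F] [Grading F] [AddCommGroup F'] [Module ℝ F'] [TopologicalSpace F']
    [IsTopologicalAddGroup F'] [Grading F'] (hF : WithSeminorms (Grading.seminorm (F := F)))
    (hF' : WithSeminorms (Grading.seminorm (F := F'))) :
    WithSeminorms (Grading.seminorm (F := F × F')) := by
  have h1 := (SeminormFamily.withSeminorms_iff_nhds_eq_iInf _).1 hF
  have h2 := (SeminormFamily.withSeminorms_iff_nhds_eq_iInf _).1 hF'
  rw [SeminormFamily.withSeminorms_iff_nhds_eq_iInf, ← Prod.mk_zero_zero, nhds_prod_eq,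
    Filter.prod_eq_inf, h1, h2]
  refine le_antisymm (le_iInf fun n => tendsto_iff_comap.1 ?_) (le_inf ?_ ?_)
  · have h3 : Tendsto (fun p : F × F' => gnorm n p.1 + gnorm n p.2)
        (comap Prod.fst (⨅ i, comap (Grading.seminorm (F := F) i) (𝓝 0)) ⊓
          comap Prod.snd (⨅ i, comap (Grading.seminorm (F := F') i) (𝓝 0))) (𝓝 (0 + 0)) := by
      refine Tendsto.add ?_ ?_
      · exact ((tendsto_comap.mono_left (iInf_le _ n)).comp tendsto_comap).mono_left inf_le_left
      · exact ((tendsto_comap.mono_left (iInf_le _ n)).comp tendsto_comap).mono_left inf_le_right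
    rw [add_zero] at h3
    exact h3
  · rw [comap_iInf]
    refine le_iInf fun n => ?_
    rw [comap_comap]
    refine tendsto_iff_comap.1 (squeeze_zero (fun p => gnorm_nonneg n p.1) (fun p => ?_)
      (tendsto_comap.mono_left (iInf_le _ n)))
    exact le_add_of_nonneg_right (gnorm_nonneg n p.2)
  · rw [comap_iInf]
    refine le_iInf fun n => ?_
    rw [comap_comap]
    refine tendsto_iff_comap.1 (squeeze_zero (fun p => gnorm_nonneg n p.2) (fun p => ?_)
      (tendsto_comap.mono_left (iInf_le _ n)))
    exact le_add_of_nonneg_left (gnorm_nonneg n p.1)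

end GradedProducts

/-! ### The chart of the space of forms at zero -/

section SubmanifoldCharts

universe u

variable {E : Type u} [NormedAddCommGroup E] [NormedSpace ℂ E] [CompleteSpace E]
  {V : Type*} [NormedAddCommGroup V] [NormedSpace ℝ V]
  (G : Type*) [TopologicalSpace G] [ChartedSpace E G] [Group G] [LieGroup 𝓘(ℂ, E) ω G]

/-- Forms near `0` correspond to their part without residue and the endpoint of their
development along the unit circle. -/
def zeroChart (T : E ≃L[ℝ] V) : OpenPartialHomeomorph (HolForm E) (exactForms E × V) where
  -- The residue-free part is kept, and the period is replaced by the endpoint of the development.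
  -- The residue-free part enters the second component only through its path on the circle.
  toFun β := (exactPart E β, T (straighteningHomeomorph E G
    (circlePath E (exactPart E β : HolForm E), period E β)).2)
  invFun p := modelToForm E (p.1, ((straighteningHomeomorph E G).symm
    (circlePath E (p.1 : HolForm E), T.symm p.2)).2)
  source := {β | (circlePath E (exactPart E β : HolForm E), period E β) ∈
    (straighteningHomeomorph E G).source}
  target := {p | (circlePath E (p.1 : HolForm E), T.symm p.2) ∈ (straighteningHomeomorph E G).target}
  map_source' β hβ := by
    have h := (straighteningHomeomorph E G).map_source hβ
    rw [mem_ofPred_eq, T.symm_apply_apply]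
    rw [straighteningHomeomorph_apply] at h ⊢
    exact h
  map_target' p hp := by
    have h := (straighteningHomeomorph E G).map_target hp
    -- The inverse of the straightening leaves the path unchanged, so the path of `p.1` together
    -- with the solved period lies in the source of the straightening.
    have h1 := straighteningHomeomorph_symm_fst G hp
    have h2 := formToModel_modelToForm (E := E) (p.1, ((straighteningHomeomorph E G).symm
      (circlePath E (p.1 : HolForm E), T.symm p.2)).2)
    obtain ⟨h3, h4⟩ := Prod.ext_iff.1 h2
    change exactPart E _ = _ at h3
    change period E _ = _ at h4
    rw [mem_ofPred_eq, h3, h4]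
    have h5 : (circlePath E (p.1 : HolForm E), ((straighteningHomeomorph E G).symm
        (circlePath E (p.1 : HolForm E), T.symm p.2)).2) = (straighteningHomeomorph E G).symm
        (circlePath E (p.1 : HolForm E), T.symm p.2) := Prod.ext h1.symm rfl
    rwa [h5]
  left_inv' β hβ := by
    have h := (straighteningHomeomorph E G).left_inv hβ
    have h1 : (circlePath E (exactPart E β : HolForm E), (straighteningHomeomorph E G
        (circlePath E (exactPart E β : HolForm E), period E β)).2) = straighteningHomeomorph E G
        (circlePath E (exactPart E β : HolForm E), period E β) := by
      rw [straighteningHomeomorph_apply]; rfl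
    rw [T.symm_apply_apply, h1, h]
    exact modelToForm_formToModel β
  right_inv' p hp := by
    have h := (straighteningHomeomorph E G).right_inv hp
    have h1 := straighteningHomeomorph_symm_fst G hp
    have h2 := formToModel_modelToForm (E := E) (p.1, ((straighteningHomeomorph E G).symm
      (circlePath E (p.1 : HolForm E), T.symm p.2)).2)
    obtain ⟨h3, h4⟩ := Prod.ext_iff.1 h2
    change exactPart E _ = _ at h3
    change period E _ = _ at h4
    rw [h3, h4]
    have h5 : (circlePath E (p.1 : HolForm E), ((straighteningHomeomorph E G).symm
        (circlePath E (p.1 : HolForm E), T.symm p.2)).2) = (straighteningHomeomorph E G).symm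
        (circlePath E (p.1 : HolForm E), T.symm p.2) := Prod.ext h1.symm rfl
    rw [h5, h]
    exact Prod.ext rfl (T.apply_symm_apply p.2)
  open_source := (straighteningHomeomorph E G).open_source.preimage
    (((continuous_circlePath E).comp (continuous_subtype_val.comp continuous_exactPart)).prodMk
      continuous_period)
  open_target := (straighteningHomeomorph E G).open_target.preimage
    (((continuous_circlePath E).comp (continuous_subtype_val.comp continuous_fst)).prodMk
      (T.symm.continuous.comp continuous_snd))
  continuousOn_toFun := by
    refine continuous_exactPart.continuousOn.prodMk
      (T.continuous.comp_continuousOn (continuous_snd.comp_continuousOn ?_))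
    exact (straighteningHomeomorph E G).continuousOn.comp
      (((continuous_circlePath E).comp (continuous_subtype_val.comp continuous_exactPart)).prodMk
        continuous_period).continuousOn fun β hβ => hβ
  continuousOn_invFun := by
    refine continuous_modelToForm.comp_continuousOn (continuous_fst.continuousOn.prodMk
      (continuous_snd.comp_continuousOn ?_))
    exact (straighteningHomeomorph E G).symm.continuousOn.comp
      (((continuous_circlePath E).comp (continuous_subtype_val.comp continuous_fst)).prodMk
        (T.symm.continuous.comp continuous_snd)).continuousOn fun p hp => hp

lemma zero_mem_zeroChart_source (T : E ≃L[ℝ] V) : (0 : HolForm E) ∈ (zeroChart G T).source := by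
  change (circlePath E (exactPart E 0 : HolForm E), period E 0) ∈
    (straighteningHomeomorph E G).source
  simp only [map_zero, ZeroMemClass.coe_zero]
  exact zero_mem_straighteningHomeomorph_source E G

/-- Adding the constant path of the period to the path of the residue-free part restores the circle
path of `β`. The second component is thus the endpoint of its development, transported by `T`. -/
lemma mem_trivialMonodromyLocus_iff_zeroChart (T : E ≃L[ℝ] V) {β : HolForm E}
    (hβ : β ∈ (zeroChart G T).source) :
    β ∈ trivialMonodromyLocus E G ↔ (zeroChart G T β).2 = 0 := by
  have h1 := (norm_lt_of_mem_straighteningHomeomorph_source G hβ).1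
  simp only [circlePath_exactPart_add] at h1
  rw [mem_trivialMonodromyLocus_iff h1]
  change _ ↔ T (straighteningHomeomorph E G _).2 = 0
  rw [straighteningHomeomorph_apply, T.map_eq_zero_iff, straightening, circlePath_exactPart_add]

end SubmanifoldCharts

/-! ### Smooth tameness of the chart at zero and its transport by gauge transformations -/

section TameCharts

universe u

variable {E : Type u} [NormedAddCommGroup E] [NormedSpace ℂ E] [CompleteSpace E]
  {V : Type} [NormedAddCommGroup V] [NormedSpace ℝ V]
  {G : Type*} [TopologicalSpace G] [ChartedSpace E G] [Group G] [LieGroup 𝓘(ℂ, E) ω G]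

-- The linear part is the tame projection onto residue-free forms; everything nonlinear sits in the
-- factor `V` and factors through `C(unitInterval, E) × E`.
variable (G) in
lemma isNormedPerturbationOn_zeroChart (T : E ≃L[ℝ] V) :
    IsNormedPerturbationOn (zeroChart G T) (zeroChart G T).source := by
  let P : HolForm E →L[ℝ] exactForms E := ⟨exactPart E, continuous_exactPart⟩
  let c : HolForm E →L[ℝ] C(unitInterval, E) := ⟨circlePath E, continuous_circlePath E⟩
  let q : HolForm E →L[ℝ] E := ⟨period E, continuous_period⟩
  refine ⟨C(unitInterval, E) × E, E, inferInstance, inferInstance, inferInstance, inferInstance,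
    0, P.prod 0, (c.comp ((exactForms E).subtypeL.comp P)).prod q,
    (0 : E →L[ℝ] exactForms E).prod (T : E →L[ℝ] V), fun p => (straighteningHomeomorph E G p).2,
    (straighteningHomeomorph E G).source, isTameLinear_exactPart.prod isTameLinear_zero,
    (straighteningHomeomorph E G).open_source,
    contDiff_snd.comp_contDiffOn (contDiffOn_straighteningHomeomorph E G), fun β hβ => hβ,
    ⟨1, fun p hp => ?_⟩, fun β hβ => ?_⟩
  · dsimp only
    rw [straighteningHomeomorph_apply]
    exact (norm_snd_le _).trans (norm_lt_of_mem_straighteningHomeomorph_source G hp).2.2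
  · refine Prod.ext ?_ ?_
    · change exactPart E β = 0 + exactPart E β + 0
      simp
    · change T _ = 0 + 0 + T _
      simp only [add_zero, zero_add]
      rfl

-- The linear part is the inclusion of residue-free forms; the nonlinear part only determines the
-- coefficient of dz/z.
variable (G) in
lemma isNormedPerturbationOn_zeroChart_symm (T : E ≃L[ℝ] V) :
    IsNormedPerturbationOn (zeroChart G T).symm (zeroChart G T).target := by
  let c : HolForm E →L[ℝ] C(unitInterval, E) := ⟨circlePath E, continuous_circlePath E⟩
  let j : E →L[ℝ] HolForm E := ⟨periodForm E, continuous_periodForm⟩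
  refine ⟨C(unitInterval, E) × E, E, inferInstance, inferInstance, inferInstance, inferInstance,
    0, (exactForms E).subtypeL.comp (ContinuousLinearMap.fst ℝ (exactForms E) V),
    (c.comp ((exactForms E).subtypeL.comp (ContinuousLinearMap.fst ℝ (exactForms E) V))).prod
      ((T.symm : V →L[ℝ] E).comp (ContinuousLinearMap.snd ℝ (exactForms E) V)),
    j, fun p => ((straighteningHomeomorph E G).symm p).2,
    (straighteningHomeomorph E G).target, isTameLinear_subtype.comp isTameLinear_fst,
    (straighteningHomeomorph E G).open_target,
    contDiff_snd.comp_contDiffOn (contDiffOn_straighteningHomeomorph_symm E G), fun β hβ => hβ,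
    ⟨1, fun p hp => ?_⟩, fun β hβ => ?_⟩
  · exact (norm_snd_le _).trans (norm_lt_of_mem_straighteningHomeomorph_source G
      ((straighteningHomeomorph E G).map_target hp)).2.1
  · rw [zero_add]
    rfl

/-- The affine transformation of the space of forms induced by right translation by `f⁻¹`. -/
def gaugeTransform (f : HolLoopGroup E G) : HolForm E ≃ₜ HolForm E where
  toFun β := adForm f (β - loopForm f)
  invFun β := adForm f⁻¹ β + loopForm f
  left_inv β := by simp
  right_inv β := by simp
  continuous_toFun := (continuous_adForm f).comp (continuous_id.sub continuous_const)
  continuous_invFun := ((continuous_adForm f⁻¹).comp continuous_id).add continuous_const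

lemma gaugeTransform_loopForm (f h : HolLoopGroup E G) :
    gaugeTransform f (loopForm h) = loopForm (h * f⁻¹) := (loopForm_mul_inv h f).symm

lemma gaugeTransform_symm_loopForm (f h : HolLoopGroup E G) :
    (gaugeTransform f).symm (loopForm h) = loopForm (h * f) := (loopForm_mul h f).symm

/-- On logarithmic derivatives the gauge transformation is right translation by `f⁻¹` of the loops,
which permutes the range of `loopForm`. -/
lemma gaugeTransform_mem_trivialMonodromyLocus_iff (f : HolLoopGroup E G) {β : HolForm E} :
    gaugeTransform f β ∈ trivialMonodromyLocus E G ↔ β ∈ trivialMonodromyLocus E G := by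
  rw [← range_loopForm]
  constructor
  · rintro ⟨h, hh⟩
    refine ⟨h * f, ?_⟩
    rw [← gaugeTransform_symm_loopForm, hh, Homeomorph.symm_apply_apply]
  · rintro ⟨h, rfl⟩
    exact ⟨h * f⁻¹, (gaugeTransform_loopForm f h).symm⟩

lemma isNormedPerturbationOn_gaugeTransform (f : HolLoopGroup E G) (U : Set (HolForm E)) :
    IsNormedPerturbationOn (gaugeTransform f) U := by
  refine (isNormedPerturbationOn_affine (-adForm f (loopForm f)) ⟨adForm f, continuous_adForm f⟩
    (isTameLinear_adForm f) U).congr fun β _ => ?_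
  change adForm f (β - loopForm f) = -adForm f (loopForm f) + adForm f β
  rw [map_sub]; abel

lemma isNormedPerturbationOn_gaugeTransform_symm (f : HolLoopGroup E G) (U : Set (HolForm E)) :
    IsNormedPerturbationOn (gaugeTransform f).symm U := by
  refine (isNormedPerturbationOn_affine (loopForm f) ⟨adForm f⁻¹, continuous_adForm f⁻¹⟩
    (isTameLinear_adForm f⁻¹) U).congr fun β _ => ?_
  exact add_comm _ _

/-- The submanifold chart at the logarithmic derivative of `f`. -/
def gaugeChart (T : E ≃L[ℝ] V) (f : HolLoopGroup E G) :
    OpenPartialHomeomorph (HolForm E) (exactForms E × V) :=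
  (gaugeTransform f).transOpenPartialHomeomorph (zeroChart G T)

lemma loopForm_mem_gaugeChart_source (T : E ≃L[ℝ] V) (f : HolLoopGroup E G) :
    loopForm f ∈ (gaugeChart T f).source := by
  change gaugeTransform f (loopForm f) ∈ (zeroChart G T).source
  rw [gaugeTransform_loopForm, mul_inv_cancel, loopForm_one]
  exact zero_mem_zeroChart_source G T

lemma isNormedPerturbationOn_gaugeChart (T : E ≃L[ℝ] V) (f : HolLoopGroup E G) :
    IsNormedPerturbationOn (gaugeChart T f) (gaugeChart T f).source :=
  (isNormedPerturbationOn_zeroChart G T).comp (isNormedPerturbationOn_gaugeTransform f _)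
    fun _ hβ => hβ

lemma isNormedPerturbationOn_gaugeChart_symm (T : E ≃L[ℝ] V) (f : HolLoopGroup E G) :
    IsNormedPerturbationOn (gaugeChart T f).symm (gaugeChart T f).target :=
  (isNormedPerturbationOn_gaugeTransform_symm f univ).comp
    (isNormedPerturbationOn_zeroChart_symm G T) fun _ _ => mem_univ _

lemma mem_trivialMonodromyLocus_iff_gaugeChart (T : E ≃L[ℝ] V) (f : HolLoopGroup E G)
    {β : HolForm E} (hβ : β ∈ (gaugeChart T f).source) :
    β ∈ trivialMonodromyLocus E G ↔ (gaugeChart T f β).2 = 0 :=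
  (gaugeTransform_mem_trivialMonodromyLocus_iff f).symm.trans
    (mem_trivialMonodromyLocus_iff_zeroChart G T hβ)

lemma isTameSubmanifoldChart_gaugeChart {n : ℕ} (T : E ≃L[ℝ] EuclideanSpace ℝ (Fin n))
    (f : HolLoopGroup E G) :
    IsTameSubmanifoldChart (trivialMonodromyLocus E G) (gaugeChart T f) where
  smoothTame := (isNormedPerturbationOn_gaugeChart T f).isSmoothTameOn
    (withSeminorms_prod (withSeminorms_exactForms E) (withSeminorms_normed _))
  smoothTame_symm := (isNormedPerturbationOn_gaugeChart_symm T f).isSmoothTameOn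
    HolForm.withSeminorms
  image_eq := by
    ext p
    constructor
    · rintro ⟨β, ⟨h1, h2⟩, rfl⟩
      exact ⟨(mem_trivialMonodromyLocus_iff_gaugeChart T f h2).1 h1,
        (gaugeChart T f).map_source h2⟩
    · rintro ⟨h1, h2⟩
      have h3 := (gaugeChart T f).map_target h2
      refine ⟨(gaugeChart T f).symm p, ⟨?_, h3⟩, (gaugeChart T f).right_inv h2⟩
      rw [mem_trivialMonodromyLocus_iff_gaugeChart T f h3, (gaugeChart T f).right_inv h2]
      exact h1

variable (G) in
lemma isTameSubmanifold_trivialMonodromyLocus {n : ℕ} (T : E ≃L[ℝ] EuclideanSpace ℝ (Fin n)) :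
    IsTameSubmanifold (exactForms E) n (trivialMonodromyLocus E G) where
  ambient := isTameFrechetSpace_holForm E
  model := isTameFrechetSpace_exactForms E
  chart := by
    -- Every form in the locus is the logarithmic derivative of a loop, and that loop supplies the
    -- gauge transformation moving it to zero.
    rw [← range_loopForm]
    rintro _ ⟨f, rfl⟩
    refine ⟨gaugeChart T f, loopForm_mem_gaugeChart_source T f, ?_⟩
    rw [range_loopForm]
    exact isTameSubmanifoldChart_gaugeChart T f

end TameCharts

/-! ## The atlas of the loop group -/

section LoopAtlas

universe u

variable {E : Type u} [NormedAddCommGroup E] [NormedSpace ℂ E] [CompleteSpace E]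
  {n : ℕ} {G : Type*} [TopologicalSpace G] [ChartedSpace E G] [Group G] [LieGroup 𝓘(ℂ, E) ω G]

variable (E) in
/-- The preferred chart at `g`, restricted to a neighbourhood of `g` with bounded image. -/
def boundedChart (g : G) : OpenPartialHomeomorph G E :=
  (chartAt E g).restr ((chartAt E g).source ∩ chartAt E g ⁻¹' Metric.ball (chartAt E g g) 1)

lemma isOpen_boundedChart_domain (g : G) :
    IsOpen ((chartAt E g).source ∩ chartAt E g ⁻¹' Metric.ball (chartAt E g g) 1) :=
  (chartAt E g).isOpen_inter_preimage Metric.isOpen_ball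

lemma mem_boundedChart_source (g : G) : g ∈ (boundedChart E g).source := by
  rw [boundedChart, OpenPartialHomeomorph.restr_source, (isOpen_boundedChart_domain g).interior_eq]
  exact ⟨mem_chart_source E g, mem_chart_source E g, Metric.mem_ball_self one_pos⟩

lemma norm_boundedChart_le {g x : G} (hx : x ∈ (boundedChart E g).source) :
    ‖boundedChart E g x‖ ≤ ‖chartAt E g g‖ + 1 := by
  rw [boundedChart, OpenPartialHomeomorph.restr_source,
    (isOpen_boundedChart_domain g).interior_eq] at hx
  have h1 : ‖chartAt E g x - chartAt E g g‖ < 1 := mem_ball_iff_norm.1 hx.2.2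
  have h2 := norm_sub_norm_le (chartAt E g x) (chartAt E g g)
  change ‖chartAt E g x‖ ≤ _
  linarith

lemma boundedChart_mem_maximalAtlas (g : G) :
    boundedChart E g ∈ IsManifold.maximalAtlas 𝓘(ℂ, E) ω G :=
  _root_.restr_mem_maximalAtlas (contDiffGroupoid ω 𝓘(ℂ, E))
    (IsManifold.chart_mem_maximalAtlas g) (isOpen_boundedChart_domain g)

/-- The chart of the loop group defined by a submanifold chart `ψ` of the space of forms and a
chart `θ` of the group. -/
def loopChart (ψ : OpenPartialHomeomorph (HolForm E) (exactForms E × EuclideanSpace ℝ (Fin n)))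
    (hψ : IsTameSubmanifoldChart (trivialMonodromyLocus E G) ψ) (θ : OpenPartialHomeomorph G E) :
    OpenPartialHomeomorph (HolLoopGroup E G) (exactForms E × E) :=
  let φ : HolLoopGroup E G → HolForm E × G := fun f => (loopForm f, f 1)
  -- `Function.invFun` is a genuine inverse at these points: the submanifold property puts the form
  -- in the locus, and any value at `1` can be prescribed.
  have hφ : ∀ p : exactForms E × E, (p.1, (0 : EuclideanSpace ℝ (Fin n))) ∈ ψ.target →
      φ (Function.invFun φ (ψ.symm (p.1, 0), θ.symm p.2)) = (ψ.symm (p.1, 0), θ.symm p.2) := by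
    intro p hp
    refine Function.invFun_eq (f := φ) ?_
    have h1 : (p.1, (0 : EuclideanSpace ℝ (Fin n))) ∈ ψ '' (trivialMonodromyLocus E G ∩ ψ.source) := by
      rw [hψ.image_eq]
      exact ⟨rfl, hp⟩
    obtain ⟨β, ⟨hβ, hβ'⟩, h2⟩ := h1
    rw [← h2, ψ.left_inv hβ']
    obtain ⟨f, hf, hf1⟩ := exists_loopForm_eq hβ (θ.symm p.2)
    exact ⟨f, Prod.ext hf hf1⟩
  have hψ0 : ∀ f : HolLoopGroup E G, loopForm f ∈ ψ.source →
      ψ (loopForm f) = ((ψ (loopForm f)).1, 0) := by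
    intro f hf
    have h1 : ψ (loopForm f) ∈ ψ '' (trivialMonodromyLocus E G ∩ ψ.source) :=
      mem_image_of_mem _ ⟨loopForm_mem_trivialMonodromyLocus f, hf⟩
    rw [hψ.image_eq] at h1
    exact Prod.ext rfl h1.1
  have hsrc : ContinuousOn (fun f : HolLoopGroup E G => ψ (loopForm f))
      (loopForm ⁻¹' ψ.source) :=
    ψ.continuousOn.comp continuous_loopForm.continuousOn fun f hf => hf
  have hzero : Continuous fun p : exactForms E × E =>
      (p.1, (0 : EuclideanSpace ℝ (Fin n))) := continuous_fst.prodMk continuous_const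
  { toFun := fun f => ((ψ (loopForm f)).1, θ (f 1))
    invFun := fun p => Function.invFun φ (ψ.symm (p.1, 0), θ.symm p.2)
    source := {f | loopForm f ∈ ψ.source ∧ f 1 ∈ θ.source}
    target := {p | (p.1, (0 : EuclideanSpace ℝ (Fin n))) ∈ ψ.target ∧ p.2 ∈ θ.target}
    map_source' := fun f hf => by
      refine ⟨?_, θ.map_source hf.2⟩
      rw [← hψ0 f hf.1]
      exact ψ.map_source hf.1
    map_target' := fun p hp => by
      obtain ⟨h1, h2⟩ := Prod.ext_iff.1 (hφ p hp.1)
      change loopForm (Function.invFun φ _) = _ at h1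
      change (Function.invFun φ _) 1 = _ at h2
      rw [mem_ofPred_eq, h1, h2]
      exact ⟨ψ.map_target hp.1, θ.map_target hp.2⟩
    left_inv' := fun f hf => by
      rw [← hψ0 f hf.1, ψ.left_inv hf.1, θ.left_inv hf.2]
      exact Function.leftInverse_invFun (isEmbedding_loopForm_prod E G).injective f
    right_inv' := fun p hp => by
      obtain ⟨h1, h2⟩ := Prod.ext_iff.1 (hφ p hp.1)
      change loopForm (Function.invFun φ _) = _ at h1
      change (Function.invFun φ _) 1 = _ at h2
      rw [h1, h2, ψ.right_inv hp.1, θ.right_inv hp.2]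
    open_source := (ψ.open_source.preimage continuous_loopForm).inter
      (θ.open_source.preimage (HolLoopGroup.continuous_apply 1))
    open_target := (ψ.open_target.preimage hzero).inter (θ.open_target.preimage continuous_snd)
    continuousOn_toFun := (continuous_fst.comp_continuousOn (hsrc.mono fun f hf => hf.1)).prodMk
      (θ.continuousOn.comp (HolLoopGroup.continuous_apply 1).continuousOn fun f hf => hf.2)
    continuousOn_invFun := by
      -- The topology of the loop group is induced by the embedding, so it suffices that the form
      -- and the value at `1` vary continuously.
      rw [(isEmbedding_loopForm_prod E G).isInducing.continuousOn_iff]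
      refine ContinuousOn.congr (f := fun p : exactForms E × E => (ψ.symm (p.1, 0), θ.symm p.2))
        ?_ fun p hp => hφ p hp.1
      exact (ψ.symm.continuousOn.comp hzero.continuousOn fun p hp => hp.1).prodMk
        (θ.symm.continuousOn.comp continuousOn_snd fun p hp => hp.2) }

variable {ψ ψ' : OpenPartialHomeomorph (HolForm E) (exactForms E × EuclideanSpace ℝ (Fin n))}
  {hψ : IsTameSubmanifoldChart (trivialMonodromyLocus E G) ψ}
  {hψ' : IsTameSubmanifoldChart (trivialMonodromyLocus E G) ψ'}
  {θ θ' : OpenPartialHomeomorph G E}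

lemma loopForm_loopChart_symm {p : exactForms E × E} (hp : p ∈ (loopChart ψ hψ θ).target) :
    loopForm ((loopChart ψ hψ θ).symm p) = ψ.symm (p.1, 0) ∧
      ((loopChart ψ hψ θ).symm p) 1 = θ.symm p.2 := by
  set f := (loopChart ψ hψ θ).symm p with hf
  have h1 : f ∈ (loopChart ψ hψ θ).source := (loopChart ψ hψ θ).map_target hp
  have h2 : ((ψ (loopForm f)).1, θ (f 1)) = p := (loopChart ψ hψ θ).right_inv hp
  have h3 : ψ (loopForm f) ∈ ψ '' (trivialMonodromyLocus E G ∩ ψ.source) :=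
    mem_image_of_mem _ ⟨loopForm_mem_trivialMonodromyLocus f, h1.1⟩
  rw [hψ.image_eq] at h3
  have h4 : ψ (loopForm f) = (p.1, 0) := Prod.ext (congrArg (fun q => q.1) h2) h3.1
  rw [← h4, ← h2, ψ.left_inv h1.1, θ.left_inv h1.2]
  exact ⟨rfl, rfl⟩

/-- The group factor is itself normed, so the whole coordinate change is taken as the perturbation,
with zero affine part. The constant `C` supplies the required bound. -/
lemma isNormedPerturbationOn_snd_coordChange (hθ : θ ∈ IsManifold.maximalAtlas 𝓘(ℂ, E) ω G)
    (hθ' : θ' ∈ IsManifold.maximalAtlas 𝓘(ℂ, E) ω G) {C : ℝ} (hC : ∀ g ∈ θ'.source, ‖θ' g‖ ≤ C) :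
    IsNormedPerturbationOn (fun p : exactForms E × E => θ' (θ.symm p.2))
      {p | p.2 ∈ (θ.symm.trans θ').source} := by
  have h1 : ContDiffOn ℂ ω (fun x => θ' (θ.symm x)) (θ.symm.trans θ').source := by
    refine ContMDiffOn.contDiffOn ?_
    exact (contMDiffOn_of_mem_maximalAtlas hθ').comp
      ((contMDiffOn_symm_of_mem_maximalAtlas hθ).mono fun x hx => hx.1) fun x hx => hx.2
  refine ⟨E, E, inferInstance, inferInstance, inferInstance, inferInstance, 0, 0,
    ContinuousLinearMap.snd ℝ (exactForms E) E, ContinuousLinearMap.id ℝ E,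
    fun x => θ' (θ.symm x), (θ.symm.trans θ').source, isTameLinear_zero,
    (θ.symm.trans θ').open_source, (h1.of_le (by simp)).restrict_scalars ℝ, fun p hp => hp,
    ⟨C, fun x hx => hC _ hx.2⟩, fun p hp => ?_⟩
  simp

/-- On the model, a transition is the slice inclusion p ↦ (p, 0), followed by ψ'∘ψ⁻¹ and projection
to the residue-free part, paired with a coordinate change of the group. Each piece is a normed
perturbation, and the class is closed under composition and pairing. -/
lemma isNormedPerturbationOn_loopChart_transition
    (h1 : IsNormedPerturbationOn ψ.symm ψ.target) (h2 : IsNormedPerturbationOn ψ' ψ'.source)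
    (hθ : θ ∈ IsManifold.maximalAtlas 𝓘(ℂ, E) ω G)
    (hθ' : θ' ∈ IsManifold.maximalAtlas 𝓘(ℂ, E) ω G) {C : ℝ} (hC : ∀ g ∈ θ'.source, ‖θ' g‖ ≤ C) :
    IsNormedPerturbationOn ((loopChart ψ hψ θ).symm.trans (loopChart ψ' hψ' θ'))
      ((loopChart ψ hψ θ).symm.trans (loopChart ψ' hψ' θ')).source := by
  set U := ((loopChart ψ hψ θ).symm.trans (loopChart ψ' hψ' θ')).source with hU
  have hmem : ∀ p ∈ U, ((p.1, 0) ∈ ψ.target ∧ p.2 ∈ θ.target) ∧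
      ψ.symm (p.1, 0) ∈ ψ'.source ∧ θ.symm p.2 ∈ θ'.source := by
    intro p hp
    have h3 : p ∈ (loopChart ψ hψ θ).target := hp.1
    have h4 : (loopChart ψ hψ θ).symm p ∈ (loopChart ψ' hψ' θ').source := hp.2
    obtain ⟨h5, h6⟩ := loopForm_loopChart_symm h3
    refine ⟨h3, ?_, ?_⟩
    · rw [← h5]; exact h4.1
    · rw [← h6]; exact h4.2
  let ι : exactForms E × E →L[ℝ] exactForms E × EuclideanSpace ℝ (Fin n) :=
    (ContinuousLinearMap.fst ℝ (exactForms E) E).prod 0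
  have hι := isNormedPerturbationOn_affine 0 ι (isTameLinear_fst.prod isTameLinear_zero) U
  have hpr := isNormedPerturbationOn_affine 0
    (ContinuousLinearMap.fst ℝ (exactForms E) (EuclideanSpace ℝ (Fin n))) isTameLinear_fst univ
  have h3 := hpr.comp ((h2.comp (h1.mono inter_subset_left (U' := ψ.target ∩ ψ.symm ⁻¹' ψ'.source))
    fun p hp => hp.2).comp hι fun p hp => ?_) fun _ _ => mem_univ _
  · refine (h3.prodMk ((isNormedPerturbationOn_snd_coordChange hθ hθ' hC).mono
      fun p hp => ?_)).congr fun p hp => ?_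
    · exact ⟨(hmem p hp).1.2, (hmem p hp).2.2⟩
    · obtain ⟨h5, h6⟩ := loopForm_loopChart_symm (hψ := hψ) (show p ∈ (loopChart ψ hψ θ).target from hp.1)
      change ((ψ' (loopForm ((loopChart ψ hψ θ).symm p))).1,
        θ' (((loopChart ψ hψ θ).symm p) 1)) = (0 + (ψ' (ψ.symm (0 + ι p))).1, θ' (θ.symm p.2))
      rw [h5, h6, zero_add, zero_add]
      rfl
  · simp only [zero_add]
    exact ⟨(hmem p hp).1.1, (hmem p hp).2.1⟩

/-- The atlas of the loop group. -/
def loopAtlas (G : Type*) [TopologicalSpace G] [ChartedSpace E G] [Group G]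
    [LieGroup 𝓘(ℂ, E) ω G] (T : E ≃L[ℝ] EuclideanSpace ℝ (Fin n)) :
    Set (OpenPartialHomeomorph (HolLoopGroup E G) (exactForms E × E)) :=
  {Φ | ∃ (f : HolLoopGroup E G) (g : G),
    Φ = loopChart (gaugeChart T f) (isTameSubmanifoldChart_gaugeChart T f) (boundedChart E g)}

lemma isTameFrechetManifold_loopGroup [T2Space G] (T : E ≃L[ℝ] EuclideanSpace ℝ (Fin n)) :
    IsTameFrechetManifold (exactForms E × E) (HolLoopGroup E G) (loopAtlas G T) where
  model := isTameFrechetSpace_model E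
  t2 := HolLoopGroup.t2Space E G
  cover f := ⟨_, ⟨f, f 1, rfl⟩, loopForm_mem_gaugeChart_source T f, mem_boundedChart_source (f 1)⟩
  transition := by
    rintro _ ⟨f, g, rfl⟩ _ ⟨f', g', rfl⟩
    exact (isNormedPerturbationOn_loopChart_transition (isNormedPerturbationOn_gaugeChart_symm T f)
      (isNormedPerturbationOn_gaugeChart T f') (boundedChart_mem_maximalAtlas g)
      (boundedChart_mem_maximalAtlas g') fun _ hx => norm_boundedChart_le hx).isSmoothTameOn
      (withSeminorms_model E)

end LoopAtlas

theorem mainTheorem1 {E : Type*} [NormedAddCommGroup E] [NormedSpace ℂ E] [FiniteDimensional ℂ E]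
    [CompleteSpace E]
    {G : Type*} [TopologicalSpace G] [T2Space G] [ChartedSpace E G] [Group G]
    [LieGroup 𝓘(ℂ, E) ω G] [LieAlgebra.IsSemisimple ℂ (GroupLieAlgebra 𝓘(ℂ, E) G)] :
    ∃ δ : HolLoopGroup E G → HolForm E,
      (∀ (f : HolLoopGroup E G) (z : ℂˣ), δ f z = leftLogDeriv f z) ∧
      Topology.IsEmbedding (fun f : HolLoopGroup E G => (δ f, f 1)) ∧
      Set.range δ = trivialMonodromyLocus E G ∧
      Set.range (fun f : HolLoopGroup E G => (δ f, f 1)) =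
        trivialMonodromyLocus E G ×ˢ Set.univ ∧
      ∃ K : Submodule ℝ (HolForm E),
        IsTameSubmanifold K (Module.finrank ℝ E) (trivialMonodromyLocus E G) ∧
        ∃ A : Set (OpenPartialHomeomorph (HolLoopGroup E G) (K × E)),
          IsTameFrechetManifold (K × E) (HolLoopGroup E G) A ∧
          ∀ Φ ∈ A, ∃ (ψ : OpenPartialHomeomorph (HolForm E)
              (K × EuclideanSpace ℝ (Fin (Module.finrank ℝ E))))
            (θ : OpenPartialHomeomorph G E),
            IsTameSubmanifoldChart (trivialMonodromyLocus E G) ψ ∧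
            θ ∈ IsManifold.maximalAtlas 𝓘(ℂ, E) ω G ∧
            Φ.source = {f | δ f ∈ ψ.source ∧ f 1 ∈ θ.source} ∧
            ∀ f ∈ Φ.source, Φ f = ((ψ (δ f)).1, θ (f 1)) := by
  have hn : Module.finrank ℝ E =
      Module.finrank ℝ (EuclideanSpace ℝ (Fin (Module.finrank ℝ E))) :=
    finrank_euclideanSpace_fin.symm
  -- Any real-linear isomorphism serves; it carries the holonomy endpoint in `E` to the ℝⁿ factor of
  -- the submanifold charts, which fixes the codimension.
  let T : E ≃L[ℝ] EuclideanSpace ℝ (Fin (Module.finrank ℝ E)) :=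
    ContinuousLinearEquiv.ofFinrankEq hn
  refine ⟨loopForm, loopForm_apply, isEmbedding_loopForm_prod E G, range_loopForm E G,
    range_loopForm_prod E G, exactForms E, isTameSubmanifold_trivialMonodromyLocus G T,
    loopAtlas G T, isTameFrechetManifold_loopGroup T, ?_⟩
  rintro _ ⟨f, g, rfl⟩
  exact ⟨gaugeChart T f, boundedChart E g, isTameSubmanifoldChart_gaugeChart T f,
    boundedChart_mem_maximalAtlas g, rfl, fun _ _ => rfl⟩

end
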